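/- Let $\lambda<0$, let $K\ge 2$ be an even integer, let $s>2K+5$, and let $\phi,\psi\in H^s(\mathbb R^2)$ be real-valued. Let $T^*\in[0,\infty]$ be the existence time of the Cauchy problem $$2i\,\partial_t g_0-\Delta g_0+3\lambda|g_0|^2g_0=0,\qquad g_0(0,\cdot)=\tfrac{\phi-i\psi}{2},$$ that is, the supremum of the $T$ such that it has a solution in $C([0,T);H^s(\mathbb R^2))$. For $U=(w_1,w_2,v,u)^{\rm T}$ put $$A(\partial_x)U=(\partial_{x_1}v,\ \partial_{x_2}v,\ \partial_{x_1}w_1+\partial_{x_2}w_2,\ 0)^{\rm T},\qquad A_0U=(0,0,u,-v)^{\rm T},\qquad F(U)=(0,0,-\lambda u^3,0)^{\rm T}.$$ For $n\ge 0$ let $H_n$ be the set of odd integers $p$ with $|p|\le n+1$ if $n$ is even, and with $|p|\le n$ if $n$ is odd. Then $T^*>0$, the Cauchy problem above has a solution $g_0\in C([0,T^*);H^s(\mathbb R^2))$, and there are $\varepsilon$-independent amplitudes $$U_{n,p}\in C([0,T^*);H^{s-2n}(\mathbb R^2)),\qquad 0\le n\le K+2,\ p\in H_n,$$ with $U_{n,-p}=\overline{U_{n,p}}$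 and $U_{0,1}=g_0\,(0,0,i,1)^{\rm T}$, with the following properties. Set $U_{n,p}=0$ for all other $(n,p)\in\mathbb Z^2$, and write $u_{n,p}$ for the last component of $U_{n,p}$. 1. (WKB equations) For all integers $-2\le n\le K$, all $p\in\mathbb Z$ and all $t\in(0,T^*)$, $$\partial_tU_{n,p}-A(\partial_x)U_{n+1,p}+(ip+A_0)U_{n+2,p}=\Bigl(0,\,0,\,-\lambda\sum_{n_1+n_2+n_3=n}\ \sum_{p_1+p_2+p_3=p}u_{n_1,p_1}u_{n_2,p_2}u_{n_3,p_3},\,0\Bigr)^{\rm T}.$$ 2. (Approximate solution) There are a constant $C_0$ and a positive, continuous, nondecreasing function $C:[0,T^*)\to\mathbb R$, both independent of $\varepsilon$, such that for every $\varepsilon\in(0,1]$ the function $$U_a(t)=\sum_{n=0}^{K+2}\varepsilon^n\sum_{p\in H_n}e^{ipt/\varepsilon^2}\,U_{n,p}(t)$$ satisfies, for all $t\in(0,T^*)$, $$\partial_tU_a-\frac1\varepsilon A(\partial_x)U_a+\frac1{\varepsilon^2}A_0U_a=F(U_a)-\varepsilon^{K+1}R_\varepsilon,$$ and $$U_a(0,\cdot)=(\varepsilon\,\partial_{x_1}\phi,\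 \varepsilon\,\partial_{x_2}\phi,\ \psi,\ \phi)^{\rm T}-\varepsilon^{K+2}r_\varepsilon,$$ with $$\|R_\varepsilon(t,\cdot)\|_{H^{s-2K-4}(\mathbb R^2)}\le C(t)\quad\text{for all }t\in(0,T^*),\qquad \|r_\varepsilon\|_{H^{s-2K-2}(\mathbb R^2)}\le C_0.$$ -/

import Mathlib

open MeasureTheory TemperedDistribution Filter Topology
open scoped SchwartzMap LineDeriv Laplacian ENNReal

noncomputable section

namespace KleinGordon

/-! ### Function spaces on the plane -/

/-- The Euclidean plane `ℝ²`. -/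
abbrev Plane : Type := EuclideanSpace ℝ (Fin 2)

/-- Complex-valued `L²(ℝ²)`. Every space `H^r` below has `r > 0`, hence is a subspace of it. -/
abbrev L2 : Type := Lp ℂ 2 (volume : Measure Plane)

/-- An `L²` function as a tempered distribution. -/
def toDist (f : L2) : 𝓢'(Plane, ℂ) := Lp.toTemperedDistribution f

/-- A real-valued `L²` function as a complex-valued one. -/
def complexify (f : Lp ℝ 2 (volume : Measure Plane)) : L2 := Complex.ofRealCLM.compLp f

/-- `‖f‖_{H^r} ≤ C` (in particular `f ∈ H^r`), where `‖f‖_{H^r}` is the `L²` norm of the Bessel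
potential of order `r` of `f`. -/
def SobolevNormLE (r : ℝ) (f : L2) (C : ℝ) : Prop :=
  ∃ g : L2, besselPotential Plane ℂ r (toDist f) = toDist g ∧ ‖g‖ ≤ C

/-- The half-open time interval `[0, T)`, where `T ∈ [0, ∞]`. -/
def timeIco (T : ℝ≥0∞) : Set ℝ := {t | 0 ≤ t ∧ ENNReal.ofReal t < T}

/-- The open time interval `(0, T)`, where `T ∈ [0, ∞]`. -/
def timeIoo (T : ℝ≥0∞) : Set ℝ := {t | 0 < t ∧ ENNReal.ofReal t < T}

/-- `f ∈ C([0, T); H^r)`: the Bessel potentials of order `r` of the `f t` are in `L²` and depend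
continuously on `t` in the norm of `L²`. -/
def ContinuousSobolev (r : ℝ) (T : ℝ≥0∞) (f : ℝ → L2) : Prop :=
  ∃ g : ℝ → L2, ContinuousOn g (timeIco T) ∧
    ∀ t ∈ timeIco T, besselPotential Plane ℂ r (toDist (f t)) = toDist (g t)

open Classical in
/-- The pointwise product `f g h`. It is an `L²` function whenever the factors are in `H^r` with
`r > 1` (they are bounded then), which is the only case in which it is used. -/
def tripleProd (f g h : L2) : L2 :=
  if H : MemLp (fun x : Plane => f x * g x * h x) 2 volume then H.toLp _ else 0

/-- The partial derivative `∂_{x_j}` of a tempered distribution. -/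
def partialX (j : Fin 2) (f : 𝓢'(Plane, ℂ)) : 𝓢'(Plane, ℂ) :=
  ∂_{(EuclideanSpace.single j (1 : ℝ) : Plane)} f

/-! ### The cubic Schrödinger equation -/

/-- `g ∈ C([0, T); H^s)` solves `2i ∂_t g - Δ g + 3 λ |g|² g = 0` on `(0, T)` with
`g(0) = (φ - iψ) / 2`. -/
def IsNLSSolution (lam s : ℝ) (φ ψ : Lp ℝ 2 (volume : Measure Plane)) (T : ℝ≥0∞)
    (g : ℝ → L2) : Prop :=
  ContinuousSobolev s T g ∧
  g 0 = (1 / 2 : ℂ) • (complexify φ - Complex.I • complexify ψ) ∧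
  ∀ t ∈ timeIoo T, ∃ g' : L2, HasDerivAt g g' t ∧
    (2 * Complex.I) • toDist g' - Δ (toDist (g t))
      + (3 * (lam : ℂ)) • toDist (tripleProd (g t) (g t) (star (g t))) = 0

/-- The (maximal) existence time `T^* ∈ [0, ∞]` of the Cauchy problem for the cubic Schrödinger
equation in `H^s`. -/
def existenceTime (lam s : ℝ) (φ ψ : Lp ℝ 2 (volume : Measure Plane)) : ℝ≥0∞ :=
  sSup {T | ∃ g : ℝ → L2, IsNLSSolution lam s φ ψ T g}

/-! ### The symmetric hyperbolic system

Unknowns are `U = (w₁, w₂, v, u)`, indexed by `Fin 4`. -/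

/-- A vector of `L²` functions as a vector of tempered distributions. -/
def vecDist (U : Fin 4 → L2) : Fin 4 → 𝓢'(Plane, ℂ) := fun i => toDist (U i)

/-- `A(∂_x) U = (∂₁ v, ∂₂ v, ∂₁ w₁ + ∂₂ w₂, 0)`. -/
def opA (U : Fin 4 → 𝓢'(Plane, ℂ)) : Fin 4 → 𝓢'(Plane, ℂ) :=
  ![partialX 0 (U 2), partialX 1 (U 2), partialX 0 (U 0) + partialX 1 (U 1), 0]

/-- `A₀ U = (0, 0, u, -v)`. -/
def opA0 (U : Fin 4 → 𝓢'(Plane, ℂ)) : Fin 4 → 𝓢'(Plane, ℂ) := ![0, 0, U 3, -U 2]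

/-- `F(U) = (0, 0, -λ u³, 0)`. -/
def nonlinF (lam : ℝ) (U : Fin 4 → L2) : Fin 4 → L2 :=
  ![0, 0, -((lam : ℂ) • tripleProd (U 3) (U 3) (U 3)), 0]

/-! ### WKB expansions -/

/-- The largest harmonic of order `n`: `n + 1` for even `n` and `n` for odd `n`. -/
def maxHarmonic (n : ℤ) : ℤ := if Even n then n + 1 else n

/-- The set `H_n` of harmonics of order `n`. -/
def harmonics (n : ℤ) : Finset ℤ :=
  (Finset.Icc (-maxHarmonic n) (maxHarmonic n)).filter (fun p => Odd p)

/-- Amplitudes `U_{n,p}(t)`; they do not depend on `ε`. -/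
abbrev Amplitudes : Type := ℤ → ℤ → ℝ → Fin 4 → L2

/-- `U_a(t) = ∑_{n=0}^{K+2} εⁿ ∑_{p ∈ H_n} e^{ipt/ε²} U_{n,p}(t)`. -/
def wkbSum (K : ℕ) (U : Amplitudes) (ε t : ℝ) : Fin 4 → L2 :=
  ∑ n ∈ Finset.Icc (0 : ℤ) (K + 2), ((ε : ℂ) ^ n) • ∑ p ∈ harmonics n,
    Complex.exp (Complex.I * (p : ℂ) * ((t / ε ^ 2 : ℝ) : ℂ)) • U n p t

/-- `f(u_a)_{n,p} = λ ∑_{n₁+n₂+n₃=n} ∑_{p₁+p₂+p₃=p} u_{n₁,p₁} u_{n₂,p₂} u_{n₃,p₃}`, where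
`0 ≤ n_i ≤ K + 2` and `p_i ∈ H_{n_i}`. -/
def fCoeff (lam : ℝ) (K : ℕ) (U : Amplitudes) (n p : ℤ) (t : ℝ) : L2 :=
  (lam : ℂ) •
    ∑ n₁ ∈ Finset.Icc (0 : ℤ) (K + 2), ∑ n₂ ∈ Finset.Icc (0 : ℤ) (K + 2),
    ∑ n₃ ∈ Finset.Icc (0 : ℤ) (K + 2), if n₁ + n₂ + n₃ = n then
      ∑ p₁ ∈ harmonics n₁, ∑ p₂ ∈ harmonics n₂, ∑ p₃ ∈ harmonics n₃,
        if p₁ + p₂ + p₃ = p then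
          tripleProd (U n₁ p₁ t 3) (U n₂ p₂ t 3) (U n₃ p₃ t 3) else 0
      else 0

/-- `Φ_{n,p} = 0` at time `t`, that is,
`∂_t U_{n,p} - A(∂_x) U_{n+1,p} + (ip + A₀) U_{n+2,p} = F(U_a)_{n,p}`. -/
def PhiVanishes (lam : ℝ) (K : ℕ) (U : Amplitudes) (n p : ℤ) (t : ℝ) : Prop :=
  ∃ U' : Fin 4 → L2, HasDerivAt (U n p) U' t ∧
    vecDist U' - opA (vecDist (U (n + 1) p t))
      + ((Complex.I * (p : ℂ)) • vecDist (U (n + 2) p t) + opA0 (vecDist (U (n + 2) p t)))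
      = vecDist ![0, 0, -fCoeff lam K U n p t, 0]

/-- The amplitudes of a real WKB approximate solution of order `K` on `[0, T)`: `U_{n,p}` is zero
unless `0 ≤ n ≤ K + 2` and `p ∈ H_n`, one has `U_{n,-p} = conj U_{n,p}`, and `Φ_{n,p} = 0` for
`-2 ≤ n ≤ K` and all `p`. -/
structure IsWKB (lam : ℝ) (K : ℕ) (T : ℝ≥0∞) (U : Amplitudes) : Prop where
  eq_zero : ∀ n p : ℤ, ¬ (0 ≤ n ∧ n ≤ K + 2 ∧ p ∈ harmonics n) → ∀ t : ℝ, U n p t = 0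
  conj : ∀ n p : ℤ, ∀ t ∈ timeIco T, ∀ i : Fin 4, U n (-p) t i = star (U n p t i)
  phi : ∀ n p : ℤ, -2 ≤ n → n ≤ K → ∀ t ∈ timeIoo T, PhiVanishes lam K U n p t

/-- The initial datum `U(0) = (ε ∂₁ φ, ε ∂₂ φ, ψ, φ)`. -/
def initialU (ε : ℝ) (φ ψ : Lp ℝ 2 (volume : Measure Plane)) : Fin 4 → 𝓢'(Plane, ℂ) :=
  ![(ε : ℂ) • partialX 0 (toDist (complexify φ)), (ε : ℂ) • partialX 1 (toDist (complexify φ)),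
    toDist (complexify ψ), toDist (complexify φ)]

end KleinGordon

end

open KleinGordon

/-! ### Conjugation, embedding into distributions, and bounded Fourier multipliers on `L2`. -/

noncomputable section

open FourierTransform

namespace KleinGordon

/-! ### Conjugation on `L²` -/

/-! The system is a Klein–Gordon equation in first-order form, with v = ε²∂_t u and w = ε∇u. For the
amplitudes, the last component of the WKB equations forces v_{n,p} = ip u_{n,p} + ∂_t u_{n-2,p}. The
first two are then solved by w_{n,p} = ∇u_{n-1,p}, so `amp` builds every vector amplitude from the
scalar ones. The third component becomes (1 - p²) u_{n+2,p} + 2ip ∂_t u_{n,p} - Δu_{n,p} + ∂_t²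
u_{n-2,p} + λ Σ u u u = 0, where all terms but the first form `src`.

Only odd p occur, so 1 - p² vanishes only at p = ±1. Away from these resonances, u_{n+2,p} is given
algebraically by lower orders. At p = 1 the solvability condition `src` = 0 is an evolution equation
for u_{n,1}. For n = 0 it is the cubic Schrödinger equation for g₀, the factor 3 counting the
positions of the conjugate. For n ≥ 2 it is a forced Schrödinger equation that is real-affine in
u_{n,1}, because three nonnegative orders with sum n > 0 contain n at most once; its solution
therefore lives as long as g₀. Scalar amplitudes of odd order are zero. The data for u and v at
order n are two real conditions, and they fix u_{n,1}(0), since u_{n,-1} is its conjugate. At order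
K + 2 the resonant part is set to zero and the data mismatch is r. The induction is
`exists_isExpansion`, with step `IsExpansion.extend` and resonant amplitude
`IsExpansion.exists_resonant`.

H^a is handled as the range of the injective bounded operator `J a`. Each time derivative and each
passage from n to n + 1 costs two space derivatives; `RegFamily` records K + 2 - n time derivatives
at order n. The condition s > 2K + 5 keeps the last space H^{s-2K-4} an algebra (`exists_product`).
Schrödinger equations are solved in the interaction picture, where the vector field is Lipschitz
(`exists_maximal_nls`, `exists_linear_schrodinger`). The WKB equations for -2 ≤ n ≤ K cancel every
power of ε below K + 1 (`residual_identity`), and the rest is bounded termwise. -/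

instance : StarAddMonoid L2 where
  star_add f g := by
    apply Lp.ext
    filter_upwards [Lp.coeFn_star (f + g), Lp.coeFn_add f g, Lp.coeFn_star f, Lp.coeFn_star g,
      Lp.coeFn_add (star f) (star g)] with x h1 h2 h3 h4 h5
    simp_all

instance : NormedStarGroup L2 where
  norm_star_le f := by
    refine Lp.norm_le_norm_of_ae_le ?_
    filter_upwards [Lp.coeFn_star f] with x hx
    simp [hx]

instance : StarModule ℂ L2 where
  star_smul c f := by
    apply Lp.ext
    filter_upwards [Lp.coeFn_star (c • f), Lp.coeFn_smul c f, Lp.coeFn_star f,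
      Lp.coeFn_smul (star c) (star f)] with x h1 h2 h3 h4
    simp_all

instance : StarModule ℝ L2 where
  star_smul c f := by
    have h : ∀ g : L2, c • g = (c : ℂ) • g := fun g => (Complex.coe_smul c g).symm
    rw [h f, star_smul, Complex.star_def, Complex.conj_ofReal]
    exact (h (star f)).symm

theorem star_complexify (f : Lp ℝ 2 (volume : Measure Plane)) :
    star (complexify f) = complexify f := by
  apply Lp.ext
  filter_upwards [Lp.coeFn_star (complexify f), Complex.ofRealCLM.coeFn_compLp f] with x h1 h2
  have h2' : (complexify f : Plane → ℂ) x = (f x : ℂ) := h2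
  rw [h1, Pi.star_apply, h2']
  simp

/-! ### `L²` functions as distributions -/

theorem toDist_eq (f : L2) : toDist f = Lp.toTemperedDistributionCLM ℂ volume 2 f := rfl

theorem toDist_injective : Function.Injective toDist := by
  have h := Lp.ker_toTemperedDistributionCLM_eq_bot (F := ℂ) (μ := (volume : Measure Plane)) (p := 2)
  intro f g hfg
  have := LinearMap.ker_eq_bot.mp h
  exact this hfg

@[simp] theorem toDist_add (f g : L2) : toDist (f + g) = toDist f + toDist g := by
  simp only [toDist_eq, map_add]

@[simp] theorem toDist_sub (f g : L2) : toDist (f - g) = toDist f - toDist g := by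
  simp only [toDist_eq, map_sub]

@[simp] theorem toDist_zero : toDist 0 = 0 := by
  simp only [toDist_eq, map_zero]

@[simp] theorem toDist_smul (c : ℂ) (f : L2) : toDist (c • f) = c • toDist f := by
  simp only [toDist_eq, map_smul]

@[simp] theorem toDist_sum {ι : Type*} (s : Finset ι) (f : ι → L2) :
    toDist (∑ i ∈ s, f i) = ∑ i ∈ s, toDist (f i) := by
  simp only [toDist_eq, map_sum]

/-! ### Fourier multipliers on `L²` -/

/-- Bounded measurable symbols. -/
def IsSymbol (m : Plane → ℂ) : Prop := Measurable m ∧ ∃ C, ∀ ξ, ‖m ξ‖ ≤ C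

theorem IsSymbol.memLp {m : Plane → ℂ} (h : IsSymbol m) : MemLp m ∞ volume := by
  obtain ⟨hm, C, hC⟩ := h
  exact memLp_top_of_bound hm.aestronglyMeasurable C (ae_of_all _ hC)

theorem IsSymbol.mul {m n : Plane → ℂ} (hm : IsSymbol m) (hn : IsSymbol n) :
    IsSymbol (fun ξ => m ξ * n ξ) := by
  obtain ⟨hm, C, hC⟩ := hm
  obtain ⟨hn, D, hD⟩ := hn
  refine ⟨hm.mul hn, C * D, fun ξ => ?_⟩
  rw [norm_mul]
  exact mul_le_mul (hC ξ) (hD ξ) (norm_nonneg _) ((norm_nonneg _).trans (hC ξ))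

open Classical in
/-- The Fourier multiplier with a bounded symbol. -/
def mulOp (m : Plane → ℂ) : L2 →L[ℂ] L2 :=
  if h : IsSymbol m then
    ((Lp.fourierTransformₗᵢ Plane ℂ).symm : L2 →L[ℂ] L2) ∘L
      ((ContinuousLinearMap.mul ℂ ℂ).holderL volume ∞ 2 2 (h.memLp.toLp m)) ∘L
      ((Lp.fourierTransformₗᵢ Plane ℂ) : L2 →L[ℂ] L2)
  else 0

theorem fourier_mulOp {m : Plane → ℂ} (h : IsSymbol m) (f : L2) :
    (𝓕 (mulOp m f) : L2) =ᵐ[volume] fun ξ => m ξ * (𝓕 f : L2) ξ := by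
  have h1 : (𝓕 (mulOp m f) : L2) =
      (ContinuousLinearMap.mul ℂ ℂ).holderL volume ∞ 2 2 (h.memLp.toLp m) (𝓕 f : L2) := by
    rw [mulOp, dif_pos h]
    exact (Lp.fourierTransformₗᵢ Plane ℂ).apply_symm_apply _
  rw [h1]
  filter_upwards [(ContinuousLinearMap.mul ℂ ℂ).coeFn_holder (r := 2) (h.memLp.toLp m) (𝓕 f : L2),
    h.memLp.coeFn_toLp] with x h2 h3
  refine h2.trans ?_
  simp [h3]

theorem fourier_L2_injective : Function.Injective (fun f : L2 => (𝓕 f : L2)) :=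
  (Lp.fourierTransformₗᵢ Plane ℂ).injective

theorem ext_fourier {f g : L2} (h : (𝓕 f : L2) =ᵐ[volume] (𝓕 g : L2)) : f = g :=
  fourier_L2_injective (Lp.ext h)

theorem mulOp_comp {m n : Plane → ℂ} (hm : IsSymbol m) (hn : IsSymbol n) (f : L2) :
    mulOp m (mulOp n f) = mulOp (fun ξ => m ξ * n ξ) f := by
  apply ext_fourier
  filter_upwards [fourier_mulOp hm (mulOp n f), fourier_mulOp hn f, fourier_mulOp (hm.mul hn) f]
    with x h1 h2 h3
  rw [h1, h2, h3, mul_assoc]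

theorem mulOp_one (f : L2) : mulOp (fun _ => 1) f = f := by
  apply ext_fourier
  filter_upwards [fourier_mulOp (m := fun _ => 1) ⟨measurable_const, 1, by simp⟩ f] with x h
  simp [h]

theorem mulOp_injective {m : Plane → ℂ} (hm : IsSymbol m) (h0 : ∀ ξ, m ξ ≠ 0) :
    Function.Injective (mulOp m) := by
  intro f g hfg
  apply ext_fourier
  have h := fourier_mulOp hm f
  rw [hfg] at h
  filter_upwards [h, fourier_mulOp hm g] with x h1 h2
  exact mul_left_cancel₀ (h0 x) (h1.symm.trans h2)

theorem norm_fourier_L2 (f : L2) : ‖(𝓕 f : L2)‖ = ‖f‖ := Lp.norm_fourier_eq f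

theorem norm_mulOp_le {m : Plane → ℂ} (hm : Measurable m) {C : ℝ} (hC : ∀ ξ, ‖m ξ‖ ≤ C) (f : L2) :
    ‖mulOp m f‖ ≤ C * ‖f‖ := by
  rw [← norm_fourier_L2 (mulOp m f), ← norm_fourier_L2 f]
  apply Lp.norm_le_mul_norm_of_ae_le_mul
  filter_upwards [fourier_mulOp ⟨hm, C, hC⟩ f] with x hx
  rw [hx, norm_mul]
  gcongr
  exact hC x

theorem mulOp_add {m n : Plane → ℂ} (hm : IsSymbol m) (hn : IsSymbol n) (f : L2) :
    mulOp (fun ξ => m ξ + n ξ) f = mulOp m f + mulOp n f := by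
  have h : IsSymbol (fun ξ => m ξ + n ξ) := by
    obtain ⟨hm, C, hC⟩ := hm
    obtain ⟨hn, D, hD⟩ := hn
    exact ⟨hm.add hn, C + D, fun ξ => (norm_add_le _ _).trans (add_le_add (hC ξ) (hD ξ))⟩
  apply ext_fourier
  have h4 : (𝓕 (mulOp m f + mulOp n f) : L2) = 𝓕 (mulOp m f) + 𝓕 (mulOp n f) :=
    FourierTransform.fourier_add _ _
  rw [h4]
  filter_upwards [fourier_mulOp hm f, fourier_mulOp hn f, fourier_mulOp h f,
    Lp.coeFn_add (𝓕 (mulOp m f) : L2) (𝓕 (mulOp n f))] with x h1 h2 h3 h5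
  rw [h3, h5, Pi.add_apply, h1, h2, add_mul]

theorem mulOp_const_mul {m : Plane → ℂ} (c : ℂ) (hm : IsSymbol m) (f : L2) :
    mulOp (fun ξ => c * m ξ) f = c • mulOp m f := by
  have hc : IsSymbol (fun _ => c) := ⟨measurable_const, ‖c‖, by simp⟩
  apply ext_fourier
  have h4 : (𝓕 (c • mulOp m f) : L2) = c • 𝓕 (mulOp m f) := FourierTransform.fourier_smul _ _
  rw [h4]
  filter_upwards [fourier_mulOp hm f, fourier_mulOp (hc.mul hm) f,
    Lp.coeFn_smul c (𝓕 (mulOp m f) : L2)] with x h1 h2 h3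
  rw [h2, h3, Pi.smul_apply, h1, smul_eq_mul, mul_assoc]

/-- Strong convergence of multipliers whose symbols are uniformly bounded and converge pointwise. -/
theorem tendsto_mulOp {ι : Type*} {l : Filter ι} [l.IsCountablyGenerated] {m : ι → Plane → ℂ}
    {m₀ : Plane → ℂ} (hm : ∀ i, Measurable (m i)) (hm₀ : Measurable m₀) {C : ℝ}
    (hC : ∀ᶠ i in l, ∀ ξ, ‖m i ξ‖ ≤ C) (hC₀ : ∀ ξ, ‖m₀ ξ‖ ≤ C)
    (hlim : ∀ ξ, Tendsto (fun i => m i ξ) l (𝓝 (m₀ ξ))) (f : L2) :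
    Tendsto (fun i => mulOp (m i) f) l (𝓝 (mulOp m₀ f)) := by
  -- By Plancherel this is the integral of |m_i - m₀|²|𝓕 f|², dominated by (2C)²|𝓕 f|².
  have key : Tendsto (fun i => ‖mulOp (m i) f - mulOp m₀ f‖ ^ 2) l (𝓝 0) := by
    have h0 : (∫ _ : Plane, (0:ℝ)) = 0 := by simp
    have hint : Integrable (fun ξ => (2 * C) ^ 2 * ‖(𝓕 f : L2) ξ‖ ^ 2) (volume : Measure Plane) :=
      ((memLp_two_iff_integrable_sq_norm (Lp.aestronglyMeasurable _)).1
        (Lp.memLp (𝓕 f : L2))).const_mul _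
    have hD := tendsto_integral_filter_of_dominated_convergence (l := l) (μ := (volume : Measure Plane))
      (F := fun i ξ => ‖m i ξ - m₀ ξ‖ ^ 2 * ‖(𝓕 f : L2) ξ‖ ^ 2) (f := fun _ => 0)
      (fun ξ => (2 * C) ^ 2 * ‖(𝓕 f : L2) ξ‖ ^ 2)
      (Eventually.of_forall fun i => ((((hm i).sub hm₀).norm.pow_const 2).aestronglyMeasurable).mul
        ((Lp.aestronglyMeasurable (𝓕 f : L2)).norm.pow 2))
      (hC.mono fun i hi => ae_of_all _ fun ξ => by
        have h1 : ‖m i ξ - m₀ ξ‖ ≤ 2 * C := (norm_sub_le _ _).trans (by linarith [hi ξ, hC₀ ξ])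
        rw [Real.norm_of_nonneg (by positivity)]
        gcongr)
      hint
      (ae_of_all _ fun ξ => by
        have h1 := ((hlim ξ).sub_const (m₀ ξ)).norm.pow 2
        have h2 := h1.mul_const (‖(𝓕 f : L2) ξ‖ ^ 2)
        simpa using h2)
    rw [h0] at hD
    refine (tendsto_congr' ?_).mpr hD
    filter_upwards [hC] with i hi
    rw [← norm_fourier_L2]
    have h4 : (𝓕 (mulOp (m i) f - mulOp m₀ f) : L2) = 𝓕 (mulOp (m i) f) - 𝓕 (mulOp m₀ f) :=
      map_sub (Lp.fourierTransformₗᵢ Plane ℂ) _ _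
    rw [h4, ← real_inner_self_eq_norm_sq]
    have h5 : inner ℝ ((𝓕 (mulOp (m i) f) : L2) - 𝓕 (mulOp m₀ f))
      ((𝓕 (mulOp (m i) f) : L2) - 𝓕 (mulOp m₀ f)) =
      ∫ ξ, ‖(((𝓕 (mulOp (m i) f) : L2) - 𝓕 (mulOp m₀ f) : L2) : Plane → ℂ) ξ‖ ^ 2 := by
      rw [L2.inner_def]
      refine integral_congr_ae (ae_of_all _ fun ξ => ?_)
      exact real_inner_self_eq_norm_sq _
    rw [h5]
    refine integral_congr_ae ?_
    filter_upwards [fourier_mulOp ⟨hm i, C, hi⟩ f, fourier_mulOp ⟨hm₀, C, hC₀⟩ f,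
      Lp.coeFn_sub (𝓕 (mulOp (m i) f) : L2) (𝓕 (mulOp m₀ f))] with x h1 h2 h3
    rw [h3, Pi.sub_apply, h1, h2, ← sub_mul, norm_mul, mul_pow]
  rw [tendsto_iff_norm_sub_tendsto_zero]
  have := key.sqrt
  simpa [Real.sqrt_sq] using this

/-! ### The Fourier transform on `L¹ ∩ L²` -/

/-- Reconciles the L² transform with the integral formula: for both, the transform can be moved onto
a compactly supported smooth test function. -/
theorem fourier_toLp_ae {f : Plane → ℂ} (h1 : Integrable f) (h2 : MemLp f 2 volume) :
    (𝓕 (h2.toLp f : L2) : L2) =ᵐ[volume] (𝓕 f : Plane → ℂ) := by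
  have hcont : Continuous (𝓕 f : Plane → ℂ) :=
    VectorFourier.fourierIntegral_continuous Real.continuous_fourierChar
      (by exact continuous_inner) h1
  refine ae_eq_of_integral_contDiff_smul_eq
    ((Lp.memLp (𝓕 (h2.toLp f : L2) : L2)).locallyIntegrable (by norm_num))
    hcont.locallyIntegrable fun g hg hgc => ?_
  have hg1 : HasCompactSupport (Complex.ofRealCLM ∘ g) := hgc.comp_left rfl
  have hg2 : ContDiff ℝ (⊤ : ℕ∞) (Complex.ofRealCLM ∘ g) := by fun_prop
  let φ : 𝓢(Plane, ℂ) := hg1.toSchwartzMap hg2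
  have hφ : ∀ x, φ x = (g x : ℂ) := fun x => rfl
  have e1 : toDist (𝓕 (h2.toLp f : L2)) φ = toDist (h2.toLp f) (𝓕 φ) := by
    rw [toDist, toDist, ← Lp.fourier_toTemperedDistribution_eq]
    rfl
  have e2 : toDist (𝓕 (h2.toLp f : L2)) φ = ∫ x, g x • (𝓕 (h2.toLp f : L2) : L2) x := by
    rw [toDist, Lp.toTemperedDistribution_apply]
    simp [hφ]
  have e3 : toDist (h2.toLp f) (𝓕 φ) = ∫ x, (𝓕 (φ : Plane → ℂ)) x • f x := by
    rw [toDist, Lp.toTemperedDistribution_apply]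
    refine integral_congr_ae ?_
    filter_upwards [h2.coeFn_toLp] with x hx
    rw [hx, SchwartzMap.fourier_coe]
  rw [← e2, e1, e3]
  have e4 := VectorFourier.integral_fourierIntegral_smul_eq_flip (L := innerₗ Plane)
    Real.continuous_fourierChar continuous_inner (φ.integrable (μ := volume)) h1
  simp only [flip_innerₗ] at e4
  refine e4.trans (integral_congr_ae (ae_of_all _ fun x => ?_))
  simp only [hφ]
  exact Complex.coe_smul _ _

/-- The L² transform applied twice is the reflection, by density of Schwartz functions;
`fourier_toLp_ae` then applies to f. This lets pointwise products be read off from convolutions. -/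
theorem fourierInv_ae {g : L2} {f : Plane → ℂ} (h1 : Integrable f)
    (h : (𝓕 g : L2) =ᵐ[volume] f) : g =ᵐ[volume] (𝓕⁻ f : Plane → ℂ) := by
  have hneg : MeasurePreserving (fun x : Plane => -x) volume volume :=
    Measure.measurePreserving_neg _
  let N : L2 →L[ℂ] L2 :=
    (Lp.compMeasurePreservingₗᵢ ℂ (fun x : Plane => -x) hneg).toContinuousLinearMap
  have hN : ∀ u : L2, N u =ᵐ[volume] fun x => u (-x) := fun u => Lp.coeFn_compMeasurePreserving u hneg
  have key : ∀ u : L2, (𝓕 (𝓕 u : L2) : L2) = N u := by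
    intro u
    refine DenseRange.induction_on (p := fun u : L2 => (𝓕 (𝓕 u : L2) : L2) = N u)
      (SchwartzMap.denseRange_toLpCLM (p := 2) ENNReal.ofNat_ne_top) u ?_ ?_
    · exact isClosed_eq ((Lp.fourierTransformₗᵢ Plane ℂ).continuous.comp
        (Lp.fourierTransformₗᵢ Plane ℂ).continuous) N.continuous
    · intro φ
      change (𝓕 (𝓕 (φ.toLp 2 volume) : L2) : L2) = N (φ.toLp 2 volume)
      rw [SchwartzMap.toLp_fourier_eq, SchwartzMap.toLp_fourier_eq]
      apply Lp.ext
      have h3 := hneg.quasiMeasurePreserving.ae_eq_comp (φ.coeFn_toLp 2 volume)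
      filter_upwards [hN (φ.toLp 2 volume), (𝓕 (𝓕 φ)).coeFn_toLp 2 volume, h3] with x h1 h2 h3
      rw [h1, h2]
      refine Eq.trans ?_ h3.symm
      have h4 : (𝓕⁻ (𝓕 φ) : 𝓢(Plane, ℂ)) (-x) = φ (-x) := by
        rw [FourierTransform.fourierInv_fourier_eq]
      simp only [Function.comp]
      rw [← h4, SchwartzMap.fourierInv_coe, SchwartzMap.fourier_coe, Real.fourierInv_eq_fourier_neg,
        neg_neg]
  have h2 : MemLp f 2 volume := (memLp_congr_ae h).1 (Lp.memLp _)
  have hg : (𝓕 g : L2) = h2.toLp f := Lp.ext (h.trans h2.coeFn_toLp.symm)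
  have h3 := fourier_toLp_ae h1 h2
  rw [← hg, key] at h3
  have h4 := hneg.quasiMeasurePreserving.ae_eq_comp ((hN g).symm.trans h3)
  filter_upwards [h4] with x hx
  simp only [Function.comp, neg_neg] at hx
  rw [hx, Real.fourierInv_eq_fourier_neg]

/-- The Fourier transform of the conjugate. -/
theorem fourier_star_ae (f : L2) :
    (𝓕 (star f) : L2) =ᵐ[volume] fun ξ => star ((𝓕 f : L2) (-ξ)) := by
  have hneg : MeasurePreserving (fun x : Plane => -x) volume volume :=
    Measure.measurePreserving_neg _
  let N : L2 →L[ℂ] L2 :=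
    (Lp.compMeasurePreservingₗᵢ ℂ (fun x : Plane => -x) hneg).toContinuousLinearMap
  have hN : ∀ u : L2, N u =ᵐ[volume] fun x => u (-x) := fun u => Lp.coeFn_compMeasurePreserving u hneg
  have key : (𝓕 (star f) : L2) = star (N (𝓕 f)) := by
    refine DenseRange.induction_on (p := fun u : L2 => (𝓕 (star u) : L2) = star (N (𝓕 u)))
      (SchwartzMap.denseRange_toLpCLM (p := 2) ENNReal.ofNat_ne_top) f ?_ ?_
    · exact isClosed_eq ((Lp.fourierTransformₗᵢ Plane ℂ).continuous.comp continuous_star)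
        (N.continuous.comp (Lp.fourierTransformₗᵢ Plane ℂ).continuous).star
    · intro φ
      change (𝓕 (star (φ.toLp 2 volume)) : L2) = star (N (𝓕 (φ.toLp 2 volume)))
      have h2 : MemLp (fun x => star (φ x)) 2 volume := (φ.memLp 2 volume).star
      have h1 : Integrable (fun x => star (φ x)) := by
        refine φ.integrable.mono h2.1 (ae_of_all _ fun x => by simp)
      have e1 : star (φ.toLp 2 volume) = h2.toLp _ := by
        apply Lp.ext
        filter_upwards [Lp.coeFn_star (φ.toLp 2 volume), h2.coeFn_toLp, φ.coeFn_toLp 2 volume]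
          with x h1 h2 h3
        rw [h1, h2, Pi.star_apply, h3]
      rw [e1, SchwartzMap.toLp_fourier_eq]
      apply Lp.ext
      have h3 := hneg.quasiMeasurePreserving.ae_eq_comp ((𝓕 φ).coeFn_toLp 2 volume)
      filter_upwards [fourier_toLp_ae h1 h2, Lp.coeFn_star (N ((𝓕 φ).toLp 2 volume)),
        hN ((𝓕 φ).toLp 2 volume), h3] with x h4 h5 h6 h7
      rw [h4, h5, Pi.star_apply, h6]
      simp only [Function.comp] at h7
      rw [h7, SchwartzMap.fourier_coe, Real.fourier_eq, Real.fourier_eq]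
      simp only [Complex.star_def]
      rw [← integral_conj]
      refine integral_congr_ae (ae_of_all _ fun y => ?_)
      simp [Circle.smul_def]
  rw [key]
  filter_upwards [Lp.coeFn_star (N (𝓕 f)), hN (𝓕 f)] with x h1 h2
  rw [h1, Pi.star_apply, h2]

/-- Symbols with conj m(-ξ) = m(ξ) therefore commute with conjugation, which gives the reality of
`J`, `Lap` and `Dx`. -/
theorem star_mulOp {m : Plane → ℂ} (hm : IsSymbol m) (f : L2) :
    star (mulOp m f) = mulOp (fun ξ => star (m (-ξ))) (star f) := by
  have hm' : IsSymbol (fun ξ => star (m (-ξ))) := by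
    obtain ⟨hm, C, hC⟩ := hm
    exact ⟨continuous_star.measurable.comp (hm.comp measurable_neg), C, fun ξ => by simpa using hC (-ξ)⟩
  have hneg : MeasurePreserving (fun x : Plane => -x) volume volume :=
    Measure.measurePreserving_neg _
  apply ext_fourier
  have h3 := hneg.quasiMeasurePreserving.ae_eq_comp (fourier_mulOp hm f)
  filter_upwards [fourier_star_ae (mulOp m f), fourier_mulOp hm' (star f), fourier_star_ae f, h3]
    with x h1 h2 h3 h4
  simp only [Function.comp] at h4
  rw [h1, h2, h3, h4, star_mul']

end KleinGordon

end

/-! ### The Sobolev scale and the operators acting on it, as multipliers. -/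

noncomputable section

open FourierTransform

namespace KleinGordon

/-! ### Bessel potentials, derivatives and the Schrödinger group on `L²` -/

/-- The bridge through which Bessel potentials, ∂_j and Δ of distributions are replaced by bounded
operators on `L2`. -/
theorem fourierMultiplierCLM_toDist {m : Plane → ℂ} (hm : m.HasTemperateGrowth) (hs : IsSymbol m)
    (f : L2) : fourierMultiplierCLM ℂ m (toDist f) = toDist (mulOp m f) := by
  rw [fourierMultiplierCLM_apply, toDist, Lp.fourier_toTemperedDistribution_eq,
    ← Lp.toTemperedDistribution_smul_eq (p := ∞) (r := 2) hm hs.memLp,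
    Lp.fourierInv_toTemperedDistribution_eq, toDist]
  congr 1
  apply ext_fourier
  rw [FourierTransform.fourier_fourierInv_eq]
  filter_upwards [fourier_mulOp hs f, Lp.coeFn_lpSMul (r := 2) (hs.memLp.toLp m) (𝓕 f : L2),
    hs.memLp.coeFn_toLp] with x h1 h2 h3
  rw [h1, h2, Pi.smul_apply', h3, smul_eq_mul]

/-- The symbol `(1 + |ξ|²)^{-a/2}`. -/
def jSymbol (a : ℝ) (ξ : Plane) : ℂ := (((1 + ‖ξ‖ ^ 2) ^ (-a / 2) : ℝ) : ℂ)

theorem jSymbol_temperate (a : ℝ) : (jSymbol a).HasTemperateGrowth := by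
  unfold jSymbol; fun_prop

theorem measurable_jSymbol (a : ℝ) : Measurable (jSymbol a) :=
  (jSymbol_temperate a).1.continuous.measurable

theorem norm_jSymbol (a : ℝ) (ξ : Plane) : ‖jSymbol a ξ‖ = (1 + ‖ξ‖ ^ 2) ^ (-a / 2) := by
  rw [jSymbol, Complex.norm_real, Real.norm_of_nonneg (by positivity)]

theorem norm_jSymbol_le {a : ℝ} (ha : 0 ≤ a) (ξ : Plane) : ‖jSymbol a ξ‖ ≤ 1 := by
  rw [norm_jSymbol]
  exact Real.rpow_le_one_of_one_le_of_nonpos (by nlinarith [sq_nonneg ‖ξ‖]) (by linarith)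

theorem isSymbol_jSymbol {a : ℝ} (ha : 0 ≤ a) : IsSymbol (jSymbol a) :=
  ⟨measurable_jSymbol a, 1, norm_jSymbol_le ha⟩

theorem jSymbol_ne_zero (a : ℝ) (ξ : Plane) : jSymbol a ξ ≠ 0 := by
  rw [← norm_ne_zero_iff, norm_jSymbol]
  positivity

theorem jSymbol_add (a b : ℝ) (ξ : Plane) : jSymbol (a + b) ξ = jSymbol a ξ * jSymbol b ξ := by
  rw [jSymbol, jSymbol, jSymbol, ← Complex.ofReal_mul, ← Real.rpow_add (by positivity)]
  congr 2
  ring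

/-- The Bessel potential of order `-a` on `L²`: `H^a` is the range of `J a`. -/
def J (a : ℝ) : L2 →L[ℂ] L2 := mulOp (jSymbol a)

theorem J_comp {a b : ℝ} (ha : 0 ≤ a) (hb : 0 ≤ b) (f : L2) : J a (J b f) = J (a + b) f := by
  have h : (fun ξ => jSymbol a ξ * jSymbol b ξ) = jSymbol (a + b) :=
    funext fun ξ => (jSymbol_add a b ξ).symm
  rw [J, J, mulOp_comp (isSymbol_jSymbol ha) (isSymbol_jSymbol hb), J, h]

theorem J_injective {a : ℝ} (ha : 0 ≤ a) : Function.Injective (J a) :=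
  mulOp_injective (isSymbol_jSymbol ha) (jSymbol_ne_zero a)

theorem norm_J_le {a : ℝ} (ha : 0 ≤ a) (f : L2) : ‖J a f‖ ≤ ‖f‖ := by
  exact (norm_mulOp_le (measurable_jSymbol a) (norm_jSymbol_le ha) f).trans_eq (one_mul _)

/-- From here on, membership in H^a means being of the form `J a g`, and ‖g‖ is the Sobolev norm. -/
theorem besselPotential_toDist_iff {a : ℝ} (ha : 0 ≤ a) (f g : L2) :
    besselPotential Plane ℂ a (toDist f) = toDist g ↔ f = J a g := by
  rw [← besselPotential_neg_apply_eq_iff, besselPotential]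
  have h := fourierMultiplierCLM_toDist (jSymbol_temperate a) (isSymbol_jSymbol ha) g
  unfold jSymbol at h
  rw [h, toDist_injective.eq_iff]
  exact eq_comm

theorem star_J {a : ℝ} (ha : 0 ≤ a) (f : L2) : star (J a f) = J a (star f) := by
  rw [J, star_mulOp (isSymbol_jSymbol ha)]
  congr 2
  ext ξ
  simp [jSymbol]

/-- The symbol of `∂_j (1 - Δ)^{-1/2}` (up to normalization). -/
def dxSymbol (j : Fin 2) (ξ : Plane) : ℂ :=
  (2 * Real.pi * Complex.I) *
    (((inner ℝ ξ (EuclideanSpace.single j (1 : ℝ)) : ℝ) : ℂ) * jSymbol 1 ξ)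

theorem isSymbol_dxSymbol (j : Fin 2) : IsSymbol (dxSymbol j) := by
  refine ⟨?_, 2 * Real.pi, fun ξ => ?_⟩
  · unfold dxSymbol
    have := measurable_jSymbol 1
    have h2 : Measurable fun ξ : Plane => inner ℝ ξ (EuclideanSpace.single j (1 : ℝ)) :=
      (continuous_id.inner continuous_const).measurable
    fun_prop
  · have h1 : ‖(2 * Real.pi * Complex.I : ℂ)‖ = 2 * Real.pi := by
      simp [Real.pi_pos.le]
    rw [dxSymbol, norm_mul, h1, norm_mul, norm_jSymbol, Complex.norm_real]
    have h2 : ‖inner ℝ ξ (EuclideanSpace.single j (1 : ℝ))‖ ≤ ‖ξ‖ := by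
      simpa using norm_inner_le_norm (𝕜 := ℝ) ξ (EuclideanSpace.single j (1 : ℝ))
    have h3 : ‖ξ‖ ≤ (1 + ‖ξ‖ ^ 2) ^ (1 / 2 : ℝ) := by
      rw [← Real.sqrt_eq_rpow]
      exact Real.le_sqrt_of_sq_le (by linarith)
    have h4 : (1 + ‖ξ‖ ^ 2) ^ (-1 / 2 : ℝ) = ((1 + ‖ξ‖ ^ 2) ^ (1 / 2 : ℝ))⁻¹ := by
      rw [← Real.rpow_neg (by positivity)]; norm_num
    have h5 : ‖inner ℝ ξ (EuclideanSpace.single j (1 : ℝ))‖ * (1 + ‖ξ‖ ^ 2) ^ (-1 / 2 : ℝ) ≤ 1 := by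
      rw [h4, ← div_eq_mul_inv]
      exact div_le_one_of_le₀ (h2.trans h3) (by positivity)
    have := Real.pi_pos
    nlinarith

/-- `∂_j` as a bounded operator from `H^a` to `H^{a-1}`. -/
def Dx (j : Fin 2) : L2 →L[ℂ] L2 := mulOp (dxSymbol j)

/-- The symbol of `Δ (1 - Δ)^{-1}` (up to normalization). -/
def lapSymbol (ξ : Plane) : ℂ :=
  (-(2 * Real.pi) ^ 2 : ℝ) * ((((‖ξ‖ ^ 2 : ℝ)) : ℂ) * jSymbol 2 ξ)

theorem norm_sq_mul_jSymbol_le (ξ : Plane) : ‖(((‖ξ‖ ^ 2 : ℝ)) : ℂ) * jSymbol 2 ξ‖ ≤ 1 := by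
  rw [norm_mul, norm_jSymbol, Complex.norm_real, Real.norm_of_nonneg (by positivity)]
  have h4 : (1 + ‖ξ‖ ^ 2) ^ (-2 / 2 : ℝ) = (1 + ‖ξ‖ ^ 2)⁻¹ := by
    rw [show (-2 / 2 : ℝ) = -1 by norm_num, Real.rpow_neg_one]
  rw [h4, ← div_eq_mul_inv]
  exact div_le_one_of_le₀ (by linarith) (by positivity)

theorem measurable_norm_sq_mul_jSymbol :
    Measurable fun ξ : Plane => (((‖ξ‖ ^ 2 : ℝ)) : ℂ) * jSymbol 2 ξ := by
  have := measurable_jSymbol 2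
  fun_prop

theorem isSymbol_lapSymbol : IsSymbol lapSymbol :=
  IsSymbol.mul (m := fun _ => ((-(2 * Real.pi) ^ 2 : ℝ) : ℂ)) ⟨measurable_const, _, fun _ => le_rfl⟩
    ⟨measurable_norm_sq_mul_jSymbol, 1, norm_sq_mul_jSymbol_le⟩

/-- `Δ` as a bounded operator from `H^a` to `H^{a-2}`. -/
def Lap : L2 →L[ℂ] L2 := mulOp lapSymbol

/-- The weight of order a splits into those of orders a - 1 and 1, and the latter absorbs the
unbounded factor 2πiξ_j. -/
theorem partialX_J {a : ℝ} (ha : 1 ≤ a) (j : Fin 2) (f : L2) :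
    partialX j (toDist (J a f)) = toDist (J (a - 1) (Dx j f)) := by
  have h1 : IsSymbol (fun ξ => jSymbol (a - 1) ξ * dxSymbol j ξ) :=
    (isSymbol_jSymbol (by linarith)).mul (isSymbol_dxSymbol j)
  have h2 : (fun ξ => jSymbol (a - 1) ξ * dxSymbol j ξ) = (2 * Real.pi * Complex.I : ℂ) •
      (jSymbol a * fun ξ => ((inner ℝ ξ (EuclideanSpace.single j (1 : ℝ)) : ℝ) : ℂ)) := by
    ext ξ
    have : jSymbol a ξ = jSymbol (a - 1) ξ * jSymbol 1 ξ := by rw [← jSymbol_add]; simp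
    simp only [Pi.smul_apply, Pi.mul_apply, smul_eq_mul, this, dxSymbol]
    ring
  have h3 : (fun ξ : Plane => ((inner ℝ ξ (EuclideanSpace.single j (1 : ℝ)) : ℝ) : ℂ)).HasTemperateGrowth := by
    fun_prop
  have h4 : (jSymbol a * fun ξ : Plane =>
      ((inner ℝ ξ (EuclideanSpace.single j (1 : ℝ)) : ℝ) : ℂ)).HasTemperateGrowth :=
    (jSymbol_temperate a).mul h3
  have h5 : ((2 * Real.pi * Complex.I : ℂ) • (jSymbol a * fun ξ : Plane =>
      ((inner ℝ ξ (EuclideanSpace.single j (1 : ℝ)) : ℝ) : ℂ))).HasTemperateGrowth := by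
    have h6 : (fun _ : Plane => (2 * Real.pi * Complex.I : ℂ)).HasTemperateGrowth :=
      .const _
    exact h6.mul h4
  rw [J, ← fourierMultiplierCLM_toDist (jSymbol_temperate a) (isSymbol_jSymbol (by linarith)),
    partialX, lineDeriv_eq_fourierMultiplierCLM,
    fourierMultiplierCLM_fourierMultiplierCLM_apply (jSymbol_temperate a) h3, J, Dx,
    mulOp_comp (isSymbol_jSymbol (by linarith)) (isSymbol_dxSymbol j), h2]
  rw [h2] at h1
  rw [← fourierMultiplierCLM_toDist h5 h1, fourierMultiplierCLM_smul h4]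
  rfl

theorem laplacian_J {a : ℝ} (ha : 2 ≤ a) (f : L2) :
    Δ (toDist (J a f)) = toDist (J (a - 2) (Lap f)) := by
  have h1 : IsSymbol (fun ξ => jSymbol (a - 2) ξ * lapSymbol ξ) :=
    (isSymbol_jSymbol (by linarith)).mul isSymbol_lapSymbol
  have h2 : (fun ξ => jSymbol (a - 2) ξ * lapSymbol ξ) = ((-(2 * Real.pi) ^ 2 : ℝ) : ℂ) •
      (jSymbol a * fun ξ => ((‖ξ‖ ^ 2 : ℝ) : ℂ)) := by
    ext ξ
    have : jSymbol a ξ = jSymbol (a - 2) ξ * jSymbol 2 ξ := by rw [← jSymbol_add]; simp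
    simp only [Pi.smul_apply, Pi.mul_apply, smul_eq_mul, this, lapSymbol]
    ring
  have h3 : (fun ξ : Plane => ((‖ξ‖ ^ 2 : ℝ) : ℂ)).HasTemperateGrowth := by
    fun_prop
  have h4 : (jSymbol a * fun ξ : Plane => ((‖ξ‖ ^ 2 : ℝ) : ℂ)).HasTemperateGrowth :=
    (jSymbol_temperate a).mul h3
  have h5 : (((-(2 * Real.pi) ^ 2 : ℝ) : ℂ) •
      (jSymbol a * fun ξ : Plane => ((‖ξ‖ ^ 2 : ℝ) : ℂ))).HasTemperateGrowth := by
    have h6 : (fun _ : Plane => ((-(2 * Real.pi) ^ 2 : ℝ) : ℂ)).HasTemperateGrowth :=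
      .const _
    exact h6.mul h4
  rw [J, ← fourierMultiplierCLM_toDist (jSymbol_temperate a) (isSymbol_jSymbol (by linarith)),
    laplacian_eq_fourierMultiplierCLM,
    fourierMultiplierCLM_fourierMultiplierCLM_apply (jSymbol_temperate a) h3, J, Lap,
    mulOp_comp (isSymbol_jSymbol (by linarith)) isSymbol_lapSymbol, h2]
  rw [h2] at h1
  rw [← fourierMultiplierCLM_toDist h5 h1, fourierMultiplierCLM_smul h4]
  exact (Complex.coe_smul (E := 𝓢'(Plane, ℂ)) _ _).symm

/-- The phase of the Schrödinger group. -/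
def sSymbol (t : ℝ) (ξ : Plane) : ℂ :=
  Complex.exp ((t : ℂ) * ((2 * Real.pi ^ 2 * ‖ξ‖ ^ 2 : ℝ) : ℂ) * Complex.I)

theorem norm_sSymbol (t : ℝ) (ξ : Plane) : ‖sSymbol t ξ‖ = 1 := by
  rw [sSymbol, ← Complex.ofReal_mul, Complex.norm_exp_ofReal_mul_I]

theorem measurable_sSymbol (t : ℝ) : Measurable (sSymbol t) := by
  unfold sSymbol; fun_prop

theorem isSymbol_sSymbol (t : ℝ) : IsSymbol (sSymbol t) :=
  ⟨measurable_sSymbol t, 1, fun ξ => (norm_sSymbol t ξ).le⟩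

/-- The group generated by `-(i/2) Δ`. -/
def S (t : ℝ) : L2 →L[ℂ] L2 := mulOp (sSymbol t)

theorem norm_S_le (t : ℝ) (f : L2) : ‖S t f‖ ≤ ‖f‖ := by
  exact (norm_mulOp_le (measurable_sSymbol t) (fun ξ => (norm_sSymbol t ξ).le) f).trans_eq
    (one_mul _)

theorem S_comp (t r : ℝ) (f : L2) : S t (S r f) = S (t + r) f := by
  have h : (fun ξ => sSymbol t ξ * sSymbol r ξ) = sSymbol (t + r) := by
    funext ξ
    simp only [sSymbol]
    rw [← Complex.exp_add]
    congr 1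
    push_cast
    ring
  rw [S, S, mulOp_comp (isSymbol_sSymbol t) (isSymbol_sSymbol r), S, h]

theorem S_zero (f : L2) : S 0 f = f := by
  have h : sSymbol 0 = fun _ => 1 := funext fun ξ => by simp [sSymbol]
  rw [S, h, mulOp_one]

theorem S_S_neg (t : ℝ) (f : L2) : S t (S (-t) f) = f := by
  rw [S_comp, add_neg_cancel, S_zero]

theorem mulOp_comm {m n : Plane → ℂ} (hm : IsSymbol m) (hn : IsSymbol n) (f : L2) :
    mulOp m (mulOp n f) = mulOp n (mulOp m f) := by
  rw [mulOp_comp hm hn, mulOp_comp hn hm]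
  simp_rw [mul_comm]

theorem S_J {a : ℝ} (ha : 0 ≤ a) (t : ℝ) (f : L2) : S t (J a f) = J a (S t f) :=
  mulOp_comm (isSymbol_sSymbol t) (isSymbol_jSymbol ha) f

theorem S_Lap (t : ℝ) (f : L2) : S t (Lap f) = Lap (S t f) :=
  mulOp_comm (isSymbol_sSymbol t) isSymbol_lapSymbol f

theorem continuous_S (f : L2) : Continuous fun t => S t f := by
  rw [continuous_iff_continuousAt]
  intro t
  refine tendsto_mulOp (C := 1) measurable_sSymbol (measurable_sSymbol t)
    (Eventually.of_forall fun r ξ => (norm_sSymbol r ξ).le) (fun ξ => (norm_sSymbol t ξ).le)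
    (fun ξ => ?_) f
  have : Continuous fun r => sSymbol r ξ := by unfold sSymbol; fun_prop
  exact this.tendsto t

/-- The group is only strongly continuous; joint continuity comes from the uniform bound ‖S t‖ ≤ 1.
-/
theorem continuous_S_apply : Continuous fun q : ℝ × L2 => S q.1 q.2 := by
  rw [continuous_iff_continuousAt]
  rintro ⟨t, f⟩
  have h1 : Tendsto (fun q : ℝ × L2 => S q.1 f) (𝓝 (t, f)) (𝓝 (S t f)) :=
    ((continuous_S f).comp continuous_fst).tendsto (t, f)
  have h2 : Tendsto (fun q : ℝ × L2 => S q.1 (q.2 - f)) (𝓝 (t, f)) (𝓝 0) := by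
    refine squeeze_zero_norm (fun q => norm_S_le q.1 (q.2 - f)) ?_
    have : Continuous fun q : ℝ × L2 => ‖q.2 - f‖ := by fun_prop
    simpa using this.tendsto (t, f)
  have h3 := h1.add h2
  simpa [ContinuousAt] using h3

/-- Differentiability of the Schrödinger group on `H²`. -/
theorem hasDerivAt_S_J (f : L2) (t : ℝ) :
    HasDerivAt (fun r => S r (J 2 f)) ((-Complex.I / 2) • S t (Lap f)) t := by
  rw [hasDerivAt_iff_tendsto_slope]
  let q : ℝ → Plane → ℂ := fun r ξ =>
    ((r - t : ℝ) : ℂ)⁻¹ * (sSymbol r ξ * jSymbol 2 ξ + (-1) * (sSymbol t ξ * jSymbol 2 ξ))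
  have hmeas : ∀ r, IsSymbol fun ξ => sSymbol r ξ * jSymbol 2 ξ := fun r =>
    (isSymbol_sSymbol r).mul (isSymbol_jSymbol (by norm_num))
  have hneg : IsSymbol fun ξ => (-1 : ℂ) * (sSymbol t ξ * jSymbol 2 ξ) :=
    IsSymbol.mul (m := fun _ => (-1 : ℂ)) ⟨measurable_const, 1, by simp⟩ (hmeas t)
  have hsum : ∀ r, IsSymbol fun ξ =>
      sSymbol r ξ * jSymbol 2 ξ + (-1 : ℂ) * (sSymbol t ξ * jSymbol 2 ξ) := by
    intro r
    obtain ⟨h1, C, hC⟩ := hmeas r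
    obtain ⟨h2, D, hD⟩ := hneg
    exact ⟨h1.add h2, C + D, fun ξ => (norm_add_le _ _).trans (add_le_add (hC ξ) (hD ξ))⟩
  have hq : ∀ r, slope (fun r => S r (J 2 f)) t r = mulOp (q r) f := by
    intro r
    simp only [q]
    rw [mulOp_const_mul _ (hsum r), mulOp_add (hmeas r) hneg, mulOp_const_mul _ (hmeas t),
      ← mulOp_comp (isSymbol_sSymbol r) (isSymbol_jSymbol (by norm_num)),
      ← mulOp_comp (isSymbol_sSymbol t) (isSymbol_jSymbol (by norm_num)), slope_def_module,
      ← Complex.ofReal_inv]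
    refine (Complex.coe_smul _ _).symm.trans ?_
    congr 1
    rw [neg_one_smul, ← sub_eq_add_neg]
    rfl
  have hlim : (-Complex.I / 2) • S t (Lap f) =
      mulOp (fun ξ => (-Complex.I / 2) * (sSymbol t ξ * lapSymbol ξ)) f := by
    rw [mulOp_const_mul _ ((isSymbol_sSymbol t).mul isSymbol_lapSymbol),
      ← mulOp_comp (isSymbol_sSymbol t) isSymbol_lapSymbol]
    rfl
  rw [hlim]
  rw [funext hq]
  have hder : ∀ ξ r, HasDerivAt (fun r => sSymbol r ξ)
      (sSymbol r ξ * (((2 * Real.pi ^ 2 * ‖ξ‖ ^ 2 : ℝ) : ℂ) * Complex.I)) r := by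
    intro ξ r
    have h1 : HasDerivAt (fun r : ℝ => (r : ℂ) * ((2 * Real.pi ^ 2 * ‖ξ‖ ^ 2 : ℝ) : ℂ) * Complex.I)
        (((2 * Real.pi ^ 2 * ‖ξ‖ ^ 2 : ℝ) : ℂ) * Complex.I) r := by
      have := ((Complex.ofRealCLM.hasDerivAt (x := r)).mul_const
        ((2 * Real.pi ^ 2 * ‖ξ‖ ^ 2 : ℝ) : ℂ)).mul_const Complex.I
      simpa using this
    exact h1.cexp
  -- The difference quotients are multipliers. The phase is Lipschitz in time with constant 2π²|ξ|²,
  -- and |ξ|²(1 + |ξ|²)⁻¹ ≤ 1, so 2π² bounds all their symbols and the limit.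
  refine tendsto_mulOp (C := 2 * Real.pi ^ 2) (fun r => ?_) ?_
    (Eventually.of_forall fun r ξ => ?_) (fun ξ => ?_) (fun ξ => ?_) f
  · exact measurable_const.mul (hsum r).1
  · exact measurable_const.mul ((isSymbol_sSymbol t).mul isSymbol_lapSymbol).1
  · have h1 : ‖sSymbol r ξ - sSymbol t ξ‖ ≤ (2 * Real.pi ^ 2 * ‖ξ‖ ^ 2) * ‖r - t‖ := by
      refine Convex.norm_image_sub_le_of_norm_hasDerivWithin_le (s := Set.univ)
        (fun x _ => (hder ξ x).hasDerivWithinAt) (fun x _ => ?_) convex_univ trivial trivial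
      rw [norm_mul, norm_sSymbol, norm_mul, Complex.norm_I, Complex.norm_real,
        Real.norm_of_nonneg (by positivity)]
      simp
    have h2 : q r ξ = ((r - t : ℝ) : ℂ)⁻¹ * ((sSymbol r ξ - sSymbol t ξ) * jSymbol 2 ξ) := by
      simp only [q]; ring
    have h3 := norm_sq_mul_jSymbol_le ξ
    rw [norm_mul, Complex.norm_real, Real.norm_of_nonneg (by positivity : (0:ℝ) ≤ ‖ξ‖ ^ 2)] at h3
    rw [h2, norm_mul, norm_mul, norm_inv, Complex.norm_real]
    rcases eq_or_ne r t with rfl | hrt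
    · simp; positivity
    have hpos : 0 < ‖r - t‖ := norm_pos_iff.mpr (sub_ne_zero.mpr hrt)
    rw [inv_mul_le_iff₀ hpos]
    calc ‖sSymbol r ξ - sSymbol t ξ‖ * ‖jSymbol 2 ξ‖
        ≤ ((2 * Real.pi ^ 2 * ‖ξ‖ ^ 2) * ‖r - t‖) * ‖jSymbol 2 ξ‖ := by gcongr
      _ = (2 * Real.pi ^ 2 * ‖r - t‖) * (‖ξ‖ ^ 2 * ‖jSymbol 2 ξ‖) := by ring
      _ ≤ (2 * Real.pi ^ 2 * ‖r - t‖) * 1 := by gcongr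
      _ = _ := by ring
  · have h3 := norm_sq_mul_jSymbol_le ξ
    rw [lapSymbol, norm_mul, norm_mul, norm_sSymbol, norm_mul, Complex.norm_real]
    have h4 : ‖(-Complex.I / 2 : ℂ)‖ = 1 / 2 := by simp
    have h5 : ‖-(2 * Real.pi) ^ 2‖ = 4 * Real.pi ^ 2 := by
      rw [norm_neg, Real.norm_of_nonneg (by positivity)]; ring
    rw [h4, h5]
    nlinarith [sq_nonneg Real.pi, norm_nonneg ((((‖ξ‖ ^ 2 : ℝ)) : ℂ) * jSymbol 2 ξ)]
  · have h1 := (hder ξ t).mul_const (jSymbol 2 ξ)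
    rw [hasDerivAt_iff_tendsto_slope] at h1
    have h2 : sSymbol t ξ * (((2 * Real.pi ^ 2 * ‖ξ‖ ^ 2 : ℝ) : ℂ) * Complex.I) * jSymbol 2 ξ =
        -Complex.I / 2 * (sSymbol t ξ * lapSymbol ξ) := by
      rw [lapSymbol]
      push_cast
      ring
    rw [← h2]
    refine h1.congr fun r => ?_
    simp only [q, slope_def_module]
    rw [← Complex.ofReal_inv, ← Complex.coe_smul, smul_eq_mul]
    ring

end KleinGordon

end

/-! ### Products in Sobolev spaces. -/

noncomputable section

open FourierTransform

namespace KleinGordon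

/-! ### `H^a` is an algebra for `a > 1` -/

/-- The weight decays like |ξ|^{-2a}; in dimension 2 it is integrable for a > 1, which is where this
threshold enters the algebra property. -/
theorem integrable_weight {a : ℝ} (ha : 1 < a) :
    Integrable (fun ξ : Plane => (1 + ‖ξ‖ ^ 2) ^ (-a)) := by
  have h := integrable_rpow_neg_one_add_norm_sq (E := Plane) (μ := volume) (r := 2 * a)
    (by simp; linarith)
  refine h.congr (ae_of_all _ fun ξ => ?_)
  simp only
  congr 1
  ring

/-- Since 1 + |ζ|² is at most four times the larger of 1 + |η|² and 1 + |ζ - η|², its power cancels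
one of the two decaying factors. -/
theorem weight_le {a : ℝ} (ha : 0 ≤ a) (ζ η : Plane) :
    (1 + ‖ζ‖ ^ 2) ^ a * ((1 + ‖η‖ ^ 2) ^ (-a) * (1 + ‖ζ - η‖ ^ 2) ^ (-a)) ≤
      4 ^ a * ((1 + ‖η‖ ^ 2) ^ (-a) + (1 + ‖ζ - η‖ ^ 2) ^ (-a)) := by
  set x := 1 + ‖η‖ ^ 2 with hx
  set y := 1 + ‖ζ - η‖ ^ 2 with hy
  have hx0 : 0 < x := by positivity
  have hy0 : 0 < y := by positivity
  have h1 : 1 + ‖ζ‖ ^ 2 ≤ 2 * (x + y) := by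
    have : ‖ζ‖ ≤ ‖η‖ + ‖ζ - η‖ := by
      simpa using norm_add_le η (ζ - η)
    nlinarith [sq_nonneg (‖η‖ - ‖ζ - η‖), norm_nonneg ζ, norm_nonneg η]
  have h2 : (1 + ‖ζ‖ ^ 2) ^ a ≤ 4 ^ a * (x ^ a + y ^ a) := by
    rcases le_total x y with h | h
    · calc (1 + ‖ζ‖ ^ 2) ^ a ≤ (4 * y) ^ a :=
            Real.rpow_le_rpow (by positivity) (by linarith) ha
        _ = 4 ^ a * y ^ a := Real.mul_rpow (by norm_num) hy0.le
        _ ≤ _ := by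
          have : 0 ≤ x ^ a := by positivity
          gcongr
          linarith
    · calc (1 + ‖ζ‖ ^ 2) ^ a ≤ (4 * x) ^ a :=
            Real.rpow_le_rpow (by positivity) (by linarith) ha
        _ = 4 ^ a * x ^ a := Real.mul_rpow (by norm_num) hx0.le
        _ ≤ _ := by
          have : 0 ≤ y ^ a := by positivity
          gcongr
          linarith
  have h3 : x ^ a * x ^ (-a) = 1 := by rw [← Real.rpow_add hx0]; simp
  have h4 : y ^ a * y ^ (-a) = 1 := by rw [← Real.rpow_add hy0]; simp
  calc (1 + ‖ζ‖ ^ 2) ^ a * (x ^ (-a) * y ^ (-a))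
      ≤ 4 ^ a * (x ^ a + y ^ a) * (x ^ (-a) * y ^ (-a)) := by gcongr
    _ = 4 ^ a * ((x ^ a * x ^ (-a)) * y ^ (-a) + (y ^ a * y ^ (-a)) * x ^ (-a)) := by ring
    _ = _ := by rw [h3, h4]; ring

/-- The constant in the algebra property. -/
def algConst (a : ℝ) : ℝ≥0∞ :=
  ENNReal.ofReal (4 ^ a) * (2 * ∫⁻ ξ : Plane, ENNReal.ofReal ((1 + ‖ξ‖ ^ 2) ^ (-a)))

theorem algConst_ne_top {a : ℝ} (ha : 1 < a) : algConst a ≠ ⊤ := by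
  have h : ∫⁻ ξ : Plane, ENNReal.ofReal ((1 + ‖ξ‖ ^ 2) ^ (-a)) < ⊤ :=
    (integrable_weight ha).lintegral_lt_top
  exact ENNReal.mul_ne_top ENNReal.ofReal_ne_top (ENNReal.mul_ne_top (by simp) h.ne)

theorem lintegral_weight_le {a : ℝ} (ha : 0 ≤ a) (ζ : Plane) :
    ∫⁻ η : Plane, ENNReal.ofReal
      ((1 + ‖ζ‖ ^ 2) ^ a * ((1 + ‖η‖ ^ 2) ^ (-a) * (1 + ‖ζ - η‖ ^ 2) ^ (-a))) ≤ algConst a := by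
  have hm : Measurable fun ξ : Plane => ENNReal.ofReal ((1 + ‖ξ‖ ^ 2) ^ (-a)) := by fun_prop
  calc _ ≤ ∫⁻ η : Plane, ENNReal.ofReal (4 ^ a) * (ENNReal.ofReal ((1 + ‖η‖ ^ 2) ^ (-a)) +
        ENNReal.ofReal ((1 + ‖ζ - η‖ ^ 2) ^ (-a))) := by
        refine lintegral_mono fun η => ?_
        rw [← ENNReal.ofReal_add (by positivity) (by positivity),
          ← ENNReal.ofReal_mul (by positivity)]
        exact ENNReal.ofReal_le_ofReal (weight_le ha ζ η)
    _ = _ := by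
        rw [lintegral_const_mul' _ _ ENNReal.ofReal_ne_top, lintegral_add_left hm,
          lintegral_sub_left_eq_self (fun ξ : Plane => ENNReal.ofReal ((1 + ‖ξ‖ ^ 2) ^ (-a))) ζ,
          algConst, two_mul]

/-- The weighted `L²` bound for convolutions. -/
theorem lintegral_convolution_le {a : ℝ} (ha : 0 ≤ a) {P Q : Plane → ℝ≥0∞} (hP : Measurable P)
    (hQ : Measurable Q) :
    ∫⁻ ζ : Plane, (∫⁻ η : Plane, ENNReal.ofReal ((1 + ‖ζ‖ ^ 2) ^ (a / 2) *
        ((1 + ‖η‖ ^ 2) ^ (-a / 2) * (1 + ‖ζ - η‖ ^ 2) ^ (-a / 2))) * (P η * Q (ζ - η))) ^ (2 : ℝ) ≤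
      algConst a * ((∫⁻ η, P η ^ (2 : ℝ)) * ∫⁻ η, Q η ^ (2 : ℝ)) := by
  have hPQ : Measurable fun z : Plane × Plane => (P z.2 * Q (z.1 - z.2)) ^ (2 : ℝ) :=
    ((hP.comp measurable_snd).mul (hQ.comp (measurable_fst.sub measurable_snd))).pow_const _
  -- Cauchy–Schwarz in η separates the weight, whose squared integral is bounded uniformly in ζ;
  -- Tonelli then factors the remaining double integral.
  have h1 : ∀ ζ : Plane, (∫⁻ η : Plane, ENNReal.ofReal ((1 + ‖ζ‖ ^ 2) ^ (a / 2) *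
        ((1 + ‖η‖ ^ 2) ^ (-a / 2) * (1 + ‖ζ - η‖ ^ 2) ^ (-a / 2))) * (P η * Q (ζ - η))) ^ (2 : ℝ) ≤
      algConst a * ∫⁻ η, (P η * Q (ζ - η)) ^ (2 : ℝ) := by
    intro ζ
    have h2 := ENNReal.lintegral_mul_le_Lp_mul_Lq (volume : Measure Plane)
      Real.HolderConjugate.two_two
      (f := fun η => ENNReal.ofReal ((1 + ‖ζ‖ ^ 2) ^ (a / 2) *
        ((1 + ‖η‖ ^ 2) ^ (-a / 2) * (1 + ‖ζ - η‖ ^ 2) ^ (-a / 2))))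
      (g := fun η => P η * Q (ζ - η))
      (by fun_prop) (by fun_prop)
    refine (ENNReal.rpow_le_rpow h2 (by norm_num : (0:ℝ) ≤ 2)).trans ?_
    rw [ENNReal.mul_rpow_of_nonneg _ _ (by norm_num), ← ENNReal.rpow_mul, ← ENNReal.rpow_mul]
    norm_num only [ENNReal.rpow_one]
    gcongr
    refine le_trans (lintegral_mono fun η => ?_) (lintegral_weight_le ha ζ)
    rw [ENNReal.ofReal_rpow_of_nonneg (by positivity) (by norm_num)]
    refine ENNReal.ofReal_le_ofReal (le_of_eq ?_)
    rw [Real.mul_rpow (by positivity) (by positivity), Real.mul_rpow (by positivity) (by positivity),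
      ← Real.rpow_mul (by positivity), ← Real.rpow_mul (by positivity),
      ← Real.rpow_mul (by positivity)]
    norm_num
  refine (lintegral_mono h1).trans ?_
  rw [lintegral_const_mul _ (Measurable.lintegral_prod_right' hPQ)]
  gcongr
  rw [lintegral_lintegral_swap hPQ.aemeasurable]
  have h3 : ∀ η : Plane, ∫⁻ ζ, (P η * Q (ζ - η)) ^ (2 : ℝ) = P η ^ (2:ℝ) * ∫⁻ ζ, Q ζ ^ (2 : ℝ) := by
    intro η
    simp_rw [ENNReal.mul_rpow_of_nonneg _ _ (by norm_num : (0:ℝ) ≤ 2)]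
    rw [lintegral_const_mul _ (f := fun ζ => Q (ζ - η) ^ (2 : ℝ)) (by fun_prop)]
    congr 1
    exact lintegral_sub_right_eq_self (fun ζ => Q ζ ^ (2 : ℝ)) η
  simp_rw [h3]
  rw [lintegral_mul_const _ (hP.pow_const _)]

theorem memLp_jSymbol {a : ℝ} (ha : 1 < a) : MemLp (jSymbol a) 2 (volume : Measure Plane) := by
  rw [memLp_two_iff_integrable_sq_norm (measurable_jSymbol a).aestronglyMeasurable]
  refine (integrable_weight ha).congr (ae_of_all _ fun ξ => ?_)
  simp only [norm_jSymbol]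
  rw [← Real.rpow_mul_natCast (by positivity)]
  congr 1
  push_cast
  ring

theorem eLpNorm_two_rpow (f : Plane → ℂ) :
    eLpNorm f 2 volume ^ (2 : ℝ) = ∫⁻ ξ, ‖f ξ‖ₑ ^ (2 : ℝ) := by
  have := eLpNorm_nnreal_pow_eq_lintegral (f := f) (p := 2) (μ := (volume : Measure Plane)) (by norm_num)
  simpa using this

-- The transform of the product is the convolution of the transforms p and q. B is defined on the
-- Fourier side by removing the weight from p ⋆ q, and its norm is bounded by
-- `lintegral_convolution_le`.
open scoped Convolution in
theorem exists_product {a : ℝ} (ha : 1 < a) (F G : L2) :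
    ∃ B : L2, (fun x => (J a F : L2) x * (J a G : L2) x) =ᵐ[volume] (J a B : L2) ∧
      ‖B‖ ≤ (algConst a).toReal ^ (1 / 2 : ℝ) * (‖F‖ * ‖G‖) := by
  have ha0 : 0 ≤ a := by linarith
  have hs := isSymbol_jSymbol ha0
  let P : Plane → ℂ := (𝓕 F : L2)
  let Q : Plane → ℂ := (𝓕 G : L2)
  have hP : StronglyMeasurable P := Lp.stronglyMeasurable _
  have hQ : StronglyMeasurable Q := Lp.stronglyMeasurable _
  let p : Plane → ℂ := fun ξ => jSymbol a ξ * P ξ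
  let q : Plane → ℂ := fun ξ => jSymbol a ξ * Q ξ
  have hp : Integrable p := (memLp_jSymbol ha).integrable_mul (Lp.memLp (𝓕 F : L2))
  have hq : Integrable q := (memLp_jSymbol ha).integrable_mul (Lp.memLp (𝓕 G : L2))
  let c : Plane → ℂ := p ⋆[ContinuousLinearMap.mul ℂ ℂ] q
  have hc : Integrable c := hp.integrable_convolution (ContinuousLinearMap.mul ℂ ℂ) hq
  let b : Plane → ℂ := fun ζ => jSymbol (-a) ζ * c ζ
  have hbm : AEStronglyMeasurable b volume :=
    (measurable_jSymbol (-a)).aestronglyMeasurable.mul hc.1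
  have hpt : ∀ ζ, ‖b ζ‖ₑ ≤ ∫⁻ η : Plane, ENNReal.ofReal ((1 + ‖ζ‖ ^ 2) ^ (a / 2) *
        ((1 + ‖η‖ ^ 2) ^ (-a / 2) * (1 + ‖ζ - η‖ ^ 2) ^ (-a / 2))) * (‖P η‖ₑ * ‖Q (ζ - η)‖ₑ) := by
    intro ζ
    have h1 : ‖c ζ‖ₑ ≤ ∫⁻ η, ‖p η * q (ζ - η)‖ₑ := enorm_integral_le_lintegral_enorm _
    have h2 : ∀ (r : ℝ) (ξ : Plane), ‖jSymbol r ξ‖ₑ = ENNReal.ofReal ((1 + ‖ξ‖ ^ 2) ^ (-r / 2)) := by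
      intro r ξ
      rw [← ofReal_norm, norm_jSymbol]
    rw [enorm_mul, h2, neg_neg]
    refine (mul_le_mul_right h1 _).trans_eq ?_
    rw [← lintegral_const_mul' _ _ ENNReal.ofReal_ne_top]
    refine lintegral_congr fun η => ?_
    rw [ENNReal.ofReal_mul (by positivity), ENNReal.ofReal_mul (by positivity), ← h2 a, ← h2 a,
      enorm_mul, enorm_mul, enorm_mul]
    ring
  have hbound : eLpNorm b 2 volume ^ (2 : ℝ) ≤
      algConst a * (eLpNorm P 2 volume ^ (2 : ℝ) * eLpNorm Q 2 volume ^ (2 : ℝ)) := by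
    rw [eLpNorm_two_rpow, eLpNorm_two_rpow, eLpNorm_two_rpow]
    refine le_trans (lintegral_mono fun ζ => ENNReal.rpow_le_rpow (hpt ζ) (by norm_num)) ?_
    exact lintegral_convolution_le ha0 hP.measurable.enorm hQ.measurable.enorm
  have hbound2 : eLpNorm b 2 volume ≤
      algConst a ^ (1 / 2 : ℝ) * (eLpNorm P 2 volume * eLpNorm Q 2 volume) := by
    have := ENNReal.rpow_le_rpow hbound (by norm_num : (0:ℝ) ≤ 1 / 2)
    rw [ENNReal.mul_rpow_of_nonneg _ _ (by norm_num), ENNReal.mul_rpow_of_nonneg _ _ (by norm_num),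
      ← ENNReal.rpow_mul, ← ENNReal.rpow_mul, ← ENNReal.rpow_mul] at this
    norm_num only [ENNReal.rpow_one] at this
    simpa only [ENNReal.rpow_one] using this
  have hPtop : eLpNorm P 2 volume ≠ ⊤ := Lp.eLpNorm_ne_top _
  have hQtop : eLpNorm Q 2 volume ≠ ⊤ := Lp.eLpNorm_ne_top _
  have hctop : algConst a ^ (1 / 2 : ℝ) ≠ ⊤ :=
    ENNReal.rpow_ne_top_of_nonneg (by norm_num) (algConst_ne_top ha)
  have htop : algConst a ^ (1 / 2 : ℝ) * (eLpNorm P 2 volume * eLpNorm Q 2 volume) ≠ ⊤ :=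
    ENNReal.mul_ne_top hctop (ENNReal.mul_ne_top hPtop hQtop)
  have hb : MemLp b 2 volume := ⟨hbm, hbound2.trans_lt htop.lt_top⟩
  let B : L2 := (Lp.fourierTransformₗᵢ Plane ℂ).symm (hb.toLp b)
  have hB : (𝓕 B : L2) = hb.toLp b := (Lp.fourierTransformₗᵢ Plane ℂ).apply_symm_apply _
  refine ⟨B, ?_, ?_⟩
  · have e1 : (𝓕 (J a F) : L2) =ᵐ[volume] p := fourier_mulOp hs F
    have e2 : (𝓕 (J a G) : L2) =ᵐ[volume] q := fourier_mulOp hs G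
    have e3 : (𝓕 (J a B) : L2) =ᵐ[volume] c := by
      refine (fourier_mulOp hs B).trans ?_
      rw [hB]
      filter_upwards [hb.coeFn_toLp] with ζ h
      rw [h]
      simp only [b]
      rw [← mul_assoc, ← jSymbol_add]
      simp [jSymbol]
    filter_upwards [fourierInv_ae hp e1, fourierInv_ae hq e2, fourierInv_ae hc e3] with x h1 h2 h3
    rw [h1, h2, h3, Real.fourierInv_eq_fourier_neg, Real.fourierInv_eq_fourier_neg,
      Real.fourierInv_eq_fourier_neg]
    exact (Real.fourier_mul_convolution_eq hp hq (-x)).symm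
  · rw [← norm_fourier_L2 B, ← norm_fourier_L2 F, ← norm_fourier_L2 G, hB, Lp.norm_toLp,
      Lp.norm_def, Lp.norm_def, ENNReal.toReal_rpow, ← ENNReal.toReal_mul, ← ENNReal.toReal_mul]
    exact ENNReal.toReal_mono htop hbound2

/-- The product on `H^a`, `a > 1`, read on `L²`, as a function. -/
def prodFun (a : ℝ) (ha : 1 < a) (F G : L2) : L2 := (exists_product ha F G).choose

theorem J_prodFun {a : ℝ} (ha : 1 < a) (F G : L2) :
    (J a (prodFun a ha F G) : L2) =ᵐ[volume] fun x => (J a F : L2) x * (J a G : L2) x :=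
  (exists_product ha F G).choose_spec.1.symm

/-- `prodFun` comes from a choice, but its image under the injective `J a` is the pointwise product,
so algebraic identities can be checked almost everywhere. -/
theorem prodFun_add_left {a : ℝ} (ha : 1 < a) (F F' G : L2) :
    prodFun a ha (F + F') G = prodFun a ha F G + prodFun a ha F' G := by
  apply J_injective (a := a) (by linarith)
  apply Lp.ext
  have h1 := J_prodFun ha (F + F') G
  rw [map_add] at h1 ⊢
  filter_upwards [h1, J_prodFun ha F G, J_prodFun ha F' G, Lp.coeFn_add (J a F) (J a F'),
    Lp.coeFn_add (J a (prodFun a ha F G)) (J a (prodFun a ha F' G))] with x h1 h2 h3 h4 h5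
  rw [h1, h5, Pi.add_apply, h2, h3, h4, Pi.add_apply, add_mul]

theorem prodFun_smul_left {a : ℝ} (ha : 1 < a) (c : ℂ) (F G : L2) :
    prodFun a ha (c • F) G = c • prodFun a ha F G := by
  apply J_injective (a := a) (by linarith)
  apply Lp.ext
  have h1 := J_prodFun ha (c • F) G
  rw [map_smul] at h1 ⊢
  filter_upwards [h1, J_prodFun ha F G, Lp.coeFn_smul c (J a F),
    Lp.coeFn_smul c (J a (prodFun a ha F G))] with x h1 h2 h4 h5
  rw [h1, h5, Pi.smul_apply, h2, h4, Pi.smul_apply, smul_mul_assoc]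

theorem prodFun_comm {a : ℝ} (ha : 1 < a) (F G : L2) : prodFun a ha F G = prodFun a ha G F := by
  apply J_injective (a := a) (by linarith)
  apply Lp.ext
  filter_upwards [J_prodFun ha F G, J_prodFun ha G F] with x h1 h2
  rw [h1, h2, mul_comm]

/-- The product on `H^a`, `a > 1`, read on `L²`. -/
def prodOp (a : ℝ) (ha : 1 < a) : L2 →L[ℂ] L2 →L[ℂ] L2 :=
  LinearMap.mkContinuous₂
    (LinearMap.mk₂ ℂ (prodFun a ha) (prodFun_add_left ha) (prodFun_smul_left ha)
      (fun F G G' => by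
        rw [prodFun_comm, prodFun_add_left, prodFun_comm ha G, prodFun_comm ha G'])
      (fun c F G => by rw [prodFun_comm, prodFun_smul_left, prodFun_comm]))
    ((algConst a).toReal ^ (1 / 2 : ℝ))
    (fun F G => by
      rw [mul_assoc]
      exact (exists_product ha F G).choose_spec.2)

theorem J_prodOp {a : ℝ} (ha : 1 < a) (F G : L2) :
    (fun x => (J a F : L2) x * (J a G : L2) x) =ᵐ[volume] (J a (prodOp a ha F G) : L2) :=
  (J_prodFun ha F G).symm

/-- The triple product on `H^a`, `a > 1`, read on `L²`. -/
def tri (a : ℝ) (ha : 1 < a) (F G H : L2) : L2 := prodOp a ha (prodOp a ha F G) H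

/-- In particular the default value 0 of `tripleProd` is not used for factors in H^a with a > 1. -/
theorem tripleProd_J {a : ℝ} (ha : 1 < a) (F G H : L2) :
    tripleProd (J a F) (J a G) (J a H) = J a (tri a ha F G H) := by
  have h : (fun x => (J a F : L2) x * (J a G : L2) x * (J a H : L2) x) =ᵐ[volume]
      (J a (tri a ha F G H) : L2) := by
    filter_upwards [J_prodOp ha F G, J_prodOp ha (prodOp a ha F G) H] with x h1 h2
    rw [tri, ← h2, h1]
  have hm : MemLp (fun x => (J a F : L2) x * (J a G : L2) x * (J a H : L2) x) 2 volume :=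
    (memLp_congr_ae h).2 (Lp.memLp _)
  rw [tripleProd, dif_pos hm]
  exact Lp.ext (hm.coeFn_toLp.trans h)

/-- No integrability is needed: conjugation preserves membership in L², so both sides fall into the
same branch of the definition. -/
theorem star_tripleProd (f g h : L2) :
    star (tripleProd f g h) = tripleProd (star f) (star g) (star h) := by
  have hae : (fun x => star (f x * g x * h x)) =ᵐ[volume]
      fun x => (star f : L2) x * (star g : L2) x * (star h : L2) x := by
    filter_upwards [Lp.coeFn_star f, Lp.coeFn_star g, Lp.coeFn_star h] with x h1 h2 h3
    simp [h1, h2, h3]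
  by_cases H : MemLp (fun x => f x * g x * h x) 2 volume
  · have H' : MemLp (fun x => (star f : L2) x * (star g : L2) x * (star h : L2) x) 2 volume :=
      (memLp_congr_ae hae).1 H.star
    rw [tripleProd, dif_pos H, tripleProd, dif_pos H']
    apply Lp.ext
    filter_upwards [Lp.coeFn_star (H.toLp _), H.coeFn_toLp, H'.coeFn_toLp, hae] with x h1 h2 h3 h4
    rw [h1, h3, Pi.star_apply, h2, h4]
  · have H' : ¬ MemLp (fun x => (star f : L2) x * (star g : L2) x * (star h : L2) x) 2 volume := by
      intro H'
      apply H
      have := ((memLp_congr_ae hae).2 H').star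
      refine (memLp_congr_ae (ae_of_all _ fun x => ?_)).1 this
      simp
    rw [tripleProd, dif_neg H, tripleProd, dif_neg H', star_zero]

end KleinGordon

end

/-! ### Regularity in time with values in the Sobolev scale. -/

noncomputable section

open FourierTransform

namespace KleinGordon

/-! ### Functions of time with values in Sobolev spaces -/

theorem timeIco_subset_Ici (T : ℝ≥0∞) : timeIco T ⊆ Set.Ici 0 := fun _ h => h.1

theorem timeIoo_subset_timeIco (T : ℝ≥0∞) : timeIoo T ⊆ timeIco T := fun _ h => ⟨h.1.le, h.2⟩

theorem eventually_mem_timeIco {T : ℝ≥0∞} {t : ℝ} (ht : t ∈ timeIco T) :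
    ∀ᶠ r in 𝓝[Set.Ici 0] t, r ∈ timeIco T := by
  have h : IsOpen {r : ℝ | ENNReal.ofReal r < T} := isOpen_lt ENNReal.continuous_ofReal continuous_const
  filter_upwards [self_mem_nhdsWithin, mem_nhdsWithin_of_mem_nhds (h.mem_nhds ht.2)] with r h1 h2
  exact ⟨h1, h2⟩

theorem mem_timeIco_of_le {T : ℝ≥0∞} {t r : ℝ} (ht : t ∈ timeIco T) (hr : 0 ≤ r) (h : r ≤ t) :
    r ∈ timeIco T := ⟨hr, (ENNReal.ofReal_le_ofReal h).trans_lt ht.2⟩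

theorem Icc_subset_timeIco {T : ℝ≥0∞} {t : ℝ} (ht : t ∈ timeIco T) :
    Set.Icc 0 t ⊆ timeIco T := fun _ h => mem_timeIco_of_le ht h.1 h.2

theorem Ici_mem_nhds_of_timeIoo {T : ℝ≥0∞} {t : ℝ} (ht : t ∈ timeIoo T) : Set.Ici (0 : ℝ) ∈ 𝓝 t :=
  Ici_mem_nhds ht.1

theorem zero_mem_timeIco {T : ℝ≥0∞} (hT : 0 < T) : (0 : ℝ) ∈ timeIco T := ⟨le_rfl, by simpa using hT⟩

/-- `u ∈ C([0, T); H^a)`. -/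
def CS (T : ℝ≥0∞) (a : ℝ) (u : ℝ → L2) : Prop :=
  ∃ G : ℝ → L2, ContinuousOn G (timeIco T) ∧ ∀ t ∈ timeIco T, u t = J a (G t)

/-- `u` is differentiable in `H^a` on `[0, T)`, with derivative `u'`. -/
def DS (T : ℝ≥0∞) (a : ℝ) (u u' : ℝ → L2) : Prop :=
  ∃ G G' : ℝ → L2, ∀ t ∈ timeIco T, u t = J a (G t) ∧ u' t = J a (G' t) ∧
    HasDerivWithinAt G (G' t) (Set.Ici 0) t

/-- `u ∈ ⋂_{j ≤ l} C^j([0, T); H^{a - 2 * j})`. -/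
def Reg (T : ℝ≥0∞) : ℕ → ℝ → (ℝ → L2) → Prop
  | 0, a, u => CS T a u
  | l + 1, a, u => CS T a u ∧ ∃ u', DS T (a - 2) u u' ∧ Reg T l (a - 2) u'

variable {T : ℝ≥0∞} {a b : ℝ} {l : ℕ} {u v w u' v' w' : ℝ → L2}

theorem cs_iff_continuousSobolev (ha : 0 ≤ a) : CS T a u ↔ ContinuousSobolev a T u := by
  simp only [CS, ContinuousSobolev, besselPotential_toDist_iff ha]

theorem CS.congr (h : CS T a u) (huv : ∀ t ∈ timeIco T, u t = v t) : CS T a v := by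
  obtain ⟨G, h1, h2⟩ := h
  exact ⟨G, h1, fun t ht => (huv t ht).symm.trans (h2 t ht)⟩

theorem CS.mono (h : CS T a u) (hb : 0 ≤ b) (hba : b ≤ a) : CS T b u := by
  obtain ⟨G, h1, h2⟩ := h
  refine ⟨fun t => J (a - b) (G t), (J (a - b)).continuous.comp_continuousOn h1, fun t ht => ?_⟩
  rw [h2 t ht, J_comp hb (by linarith)]
  congr 2
  ring

theorem CS.add (hu : CS T a u) (hv : CS T a v) : CS T a (fun t => u t + v t) := by
  obtain ⟨G, h1, h2⟩ := hu
  obtain ⟨H, h3, h4⟩ := hv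
  exact ⟨fun t => G t + H t, h1.add h3, fun t ht => by
    beta_reduce
    rw [h2 t ht, h4 t ht, map_add]⟩

theorem CS.smul (c : ℂ) (hu : CS T a u) : CS T a (fun t => c • u t) := by
  obtain ⟨G, h1, h2⟩ := hu
  exact ⟨fun t => c • G t, h1.const_smul c, fun t ht => by
    beta_reduce
    rw [h2 t ht, map_smul]⟩

theorem CS.star (ha : 0 ≤ a) (hu : CS T a u) : CS T a (fun t => star (u t)) := by
  obtain ⟨G, h1, h2⟩ := hu
  exact ⟨fun t => Star.star (G t), continuous_star.comp_continuousOn h1,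
    fun t ht => by
    beta_reduce
    rw [h2 t ht, star_J ha]⟩

theorem CS.zero : CS T a (fun _ => 0) :=
  ⟨fun _ => 0, continuousOn_const, fun t _ => by
    beta_reduce
    rw [map_zero]⟩

theorem continuousOn_tri (ha : 1 < a) {F G H : ℝ → L2} {s : Set ℝ} (hF : ContinuousOn F s)
    (hG : ContinuousOn G s) (hH : ContinuousOn H s) :
    ContinuousOn (fun t => tri a ha (F t) (G t) (H t)) s := by
  unfold tri
  fun_prop

theorem CS.tripleProd (ha : 1 < a) (hu : CS T a u) (hv : CS T a v) (hw : CS T a w) :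
    CS T a (fun t => tripleProd (u t) (v t) (w t)) := by
  obtain ⟨F, h1, h2⟩ := hu
  obtain ⟨G, h3, h4⟩ := hv
  obtain ⟨H, h5, h6⟩ := hw
  refine ⟨fun t => tri a ha (F t) (G t) (H t), continuousOn_tri ha h1 h3 h5, fun t ht => ?_⟩
  beta_reduce
  rw [h2 t ht, h4 t ht, h6 t ht, tripleProd_J ha]

theorem DS.congr (h : DS T a u u') (huv : ∀ t ∈ timeIco T, u t = v t)
    (huv' : ∀ t ∈ timeIco T, u' t = v' t) : DS T a v v' := by
  obtain ⟨G, G', h⟩ := h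
  exact ⟨G, G', fun t ht => ⟨(huv t ht).symm.trans (h t ht).1,
    (huv' t ht).symm.trans (h t ht).2.1, (h t ht).2.2⟩⟩

/-- Continuous real-linear maps preserve one-sided derivatives. -/
theorem hasDerivWithinAt_clm (A : L2 →L[ℂ] L2) {G : ℝ → L2} {g : L2} {s : Set ℝ} {t : ℝ}
    (h : HasDerivWithinAt G g s t) : HasDerivWithinAt (fun r => A (G r)) (A g) s t :=
  (A.restrictScalars ℝ).hasFDerivAt.comp_hasDerivWithinAt t h

theorem DS.mono (h : DS T a u u') (hb : 0 ≤ b) (hba : b ≤ a) : DS T b u u' := by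
  obtain ⟨G, G', h⟩ := h
  refine ⟨fun t => J (a - b) (G t), fun t => J (a - b) (G' t), fun t ht => ?_⟩
  obtain ⟨h1, h2, h3⟩ := h t ht
  beta_reduce
  rw [J_comp hb (by linarith), J_comp hb (by linarith), add_sub_cancel]
  exact ⟨h1, h2, hasDerivWithinAt_clm _ h3⟩

theorem DS.add (hu : DS T a u u') (hv : DS T a v v') :
    DS T a (fun t => u t + v t) (fun t => u' t + v' t) := by
  obtain ⟨G, G', h⟩ := hu
  obtain ⟨H, H', k⟩ := hv
  refine ⟨fun t => G t + H t, fun t => G' t + H' t, fun t ht => ?_⟩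
  obtain ⟨h1, h2, h3⟩ := h t ht
  obtain ⟨k1, k2, k3⟩ := k t ht
  exact ⟨by
    beta_reduce
    rw [h1, k1, map_add], by
    beta_reduce
    rw [h2, k2, map_add], h3.add k3⟩

theorem DS.smul (c : ℂ) (hu : DS T a u u') : DS T a (fun t => c • u t) (fun t => c • u' t) := by
  obtain ⟨G, G', h⟩ := hu
  refine ⟨fun t => c • G t, fun t => c • G' t, fun t ht => ?_⟩
  obtain ⟨h1, h2, h3⟩ := h t ht
  exact ⟨by
    beta_reduce
    rw [h1, map_smul], by
    beta_reduce
    rw [h2, map_smul], h3.const_smul c⟩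

theorem hasDerivWithinAt_star {G : ℝ → L2} {g : L2} {s : Set ℝ} {t : ℝ}
    (h : HasDerivWithinAt G g s t) : HasDerivWithinAt (fun r => star (G r)) (star g) s t :=
  h.star

theorem DS.star (ha : 0 ≤ a) (hu : DS T a u u') :
    DS T a (fun t => star (u t)) (fun t => star (u' t)) := by
  obtain ⟨G, G', h⟩ := hu
  refine ⟨fun t => Star.star (G t), fun t => Star.star (G' t), fun t ht => ?_⟩
  obtain ⟨h1, h2, h3⟩ := h t ht
  exact ⟨by
    beta_reduce
    rw [h1, star_J ha], by
    beta_reduce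
    rw [h2, star_J ha], hasDerivWithinAt_star h3⟩

theorem DS.zero : DS T a (fun _ => 0) (fun _ => 0) :=
  ⟨fun _ => 0, fun _ => 0, fun t _ => ⟨by
    beta_reduce
    rw [map_zero], by
    beta_reduce
    rw [map_zero],
    hasDerivWithinAt_const t _ 0⟩⟩

theorem hasDerivWithinAt_prodOp (ha : 1 < a) {F G : ℝ → L2} {f g : L2} {s : Set ℝ} {t : ℝ}
    (hF : HasDerivWithinAt F f s t) (hG : HasDerivWithinAt G g s t) :
    HasDerivWithinAt (fun r => prodOp a ha (F r) (G r))
      (prodOp a ha (F t) g + prodOp a ha f (G t)) s t := by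
  have := ((prodOp a ha).bilinearRestrictScalars ℝ).hasFDerivWithinAt_of_bilinear
    hF.hasFDerivWithinAt hG.hasFDerivWithinAt
  have h2 := this.hasDerivWithinAt
  simpa using h2

theorem DS.tripleProd (ha : 1 < a) (hu : DS T a u u') (hv : DS T a v v') (hw : DS T a w w') :
    DS T a (fun t => tripleProd (u t) (v t) (w t))
      (fun t => tripleProd (u t) (v t) (w' t) + (tripleProd (u t) (v' t) (w t) +
        tripleProd (u' t) (v t) (w t))) := by
  obtain ⟨F, F', hF⟩ := hu
  obtain ⟨G, G', hG⟩ := hv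
  obtain ⟨H, H', hH⟩ := hw
  refine ⟨fun t => tri a ha (F t) (G t) (H t), fun t => tri a ha (F t) (G t) (H' t) +
    (tri a ha (F t) (G' t) (H t) + tri a ha (F' t) (G t) (H t)), fun t ht => ?_⟩
  obtain ⟨f1, f2, f3⟩ := hF t ht
  obtain ⟨g1, g2, g3⟩ := hG t ht
  obtain ⟨h1, h2, h3⟩ := hH t ht
  refine ⟨by
    beta_reduce
    rw [f1, g1, h1, tripleProd_J], ?_, ?_⟩
  · beta_reduce
    rw [f1, f2, g1, g2, h1, h2, tripleProd_J ha, tripleProd_J ha, tripleProd_J ha, map_add, map_add]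
  · have := hasDerivWithinAt_prodOp ha (hasDerivWithinAt_prodOp ha f3 g3) h3
    simpa [tri] using this

theorem DS.hasDerivWithinAt (hu : DS T a u u') {t : ℝ} (ht : t ∈ timeIco T) :
    HasDerivWithinAt u (u' t) (Set.Ici 0) t := by
  obtain ⟨G, G', h⟩ := hu
  have h2 := hasDerivWithinAt_clm (J a) (h t ht).2.2
  rw [← (h t ht).2.1] at h2
  refine h2.congr_of_eventuallyEq ?_ (h t ht).1
  filter_upwards [eventually_mem_timeIco ht] with r hr using (h r hr).1

theorem DS.hasDerivAt (hu : DS T a u u') {t : ℝ} (ht : t ∈ timeIoo T) :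
    HasDerivAt u (u' t) t :=
  (hu.hasDerivWithinAt (timeIoo_subset_timeIco T ht)).hasDerivAt (Ici_mem_nhds_of_timeIoo ht)

/-- The time derivative (one-sided at `0`). -/
def dt (u : ℝ → L2) (t : ℝ) : L2 := derivWithin u (Set.Ici 0) t

/-- A derivative in a Sobolev space is also the one-sided L² derivative. By uniqueness, the
existential derivatives in `Reg` can be replaced by the canonical `dt`. -/
theorem DS.dt_eq (hu : DS T a u u') {t : ℝ} (ht : t ∈ timeIco T) : dt u t = u' t :=
  (hu.hasDerivWithinAt ht).derivWithin (uniqueDiffOn_Ici 0 t ht.1)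

theorem Reg.cs (h : Reg T l a u) : CS T a u := by
  cases l with
  | zero => exact h
  | succ l => exact h.1

theorem Reg.congr (h : Reg T l a u) (huv : ∀ t ∈ timeIco T, u t = v t) : Reg T l a v := by
  cases l with
  | zero => exact CS.congr h huv
  | succ l =>
    obtain ⟨h1, u', h2, h3⟩ := h
    exact ⟨h1.congr huv, u', h2.congr huv fun _ _ => rfl, h3⟩

theorem Reg.ds_dt (h : Reg T (l + 1) a u) : DS T (a - 2) u (dt u) := by
  obtain ⟨-, u', h2, -⟩ := h
  exact h2.congr (fun _ _ => rfl) fun t ht => (h2.dt_eq ht).symm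

theorem Reg.dt (h : Reg T (l + 1) a u) : Reg T l (a - 2) (dt u) := by
  obtain ⟨-, u', h2, h3⟩ := h
  exact h3.congr fun t ht => (h2.dt_eq ht).symm

/-- The bound 2l ≤ b keeps every index b - 2j with j ≤ l nonnegative, as `J_comp` requires. -/
theorem Reg.mono_index (h : Reg T l a u) (hb : 2 * l ≤ b) (hba : b ≤ a) : Reg T l b u := by
  induction l generalizing a b u with
  | zero => exact CS.mono h (by simpa using hb) hba
  | succ l ih =>
    obtain ⟨h1, u', h2, h3⟩ := h
    push_cast at hb
    have : (0 : ℝ) ≤ l := Nat.cast_nonneg l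
    exact ⟨h1.mono (by linarith) hba, u', h2.mono (by linarith) (by linarith),
      ih h3 (by linarith) (by linarith)⟩

theorem Reg.of_succ (h : Reg T (l + 1) a u) : Reg T l a u := by
  induction l generalizing a u with
  | zero => exact h.1
  | succ l ih =>
    obtain ⟨h1, u', h2, h3⟩ := h
    exact ⟨h1, u', h2, ih h3⟩

theorem Reg.add (hu : Reg T l a u) (hv : Reg T l a v) : Reg T l a (fun t => u t + v t) := by
  induction l generalizing a u v with
  | zero => exact CS.add hu hv
  | succ l ih =>
    obtain ⟨h1, u', h2, h3⟩ := hu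
    obtain ⟨k1, v', k2, k3⟩ := hv
    exact ⟨h1.add k1, _, h2.add k2, ih h3 k3⟩

theorem Reg.smul (c : ℂ) (hu : Reg T l a u) : Reg T l a (fun t => c • u t) := by
  induction l generalizing a u with
  | zero => exact CS.smul c hu
  | succ l ih =>
    obtain ⟨h1, u', h2, h3⟩ := hu
    exact ⟨h1.smul c, _, h2.smul c, ih h3⟩

theorem Reg.neg (hu : Reg T l a u) : Reg T l a (fun t => -u t) := by
  simpa using hu.smul (-1)

theorem Reg.sub (hu : Reg T l a u) (hv : Reg T l a v) : Reg T l a (fun t => u t - v t) := by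
  simpa [sub_eq_add_neg] using hu.add hv.neg

theorem Reg.zero : Reg T l a (fun _ => 0) := by
  induction l generalizing a with
  | zero => exact CS.zero
  | succ l ih => exact ⟨CS.zero, _, DS.zero, ih⟩

theorem Reg.sum {ι : Type*} (s : Finset ι) {f : ι → ℝ → L2} (h : ∀ i ∈ s, Reg T l a (f i)) :
    Reg T l a (fun t => ∑ i ∈ s, f i t) := by
  classical
  induction s using Finset.induction_on with
  | empty => simpa using Reg.zero
  | insert i s hi ih =>
    simp_rw [Finset.sum_insert hi]
    exact (h i (Finset.mem_insert_self i s)).add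
      (ih fun j hj => h j (Finset.mem_insert_of_mem hj))

theorem Reg.star (ha : 2 * l ≤ a) (hu : Reg T l a u) : Reg T l a (fun t => star (u t)) := by
  induction l generalizing a u with
  | zero => exact CS.star (by simpa using ha) hu
  | succ l ih =>
    obtain ⟨h1, u', h2, h3⟩ := hu
    push_cast at ha
    have : (0 : ℝ) ≤ l := Nat.cast_nonneg l
    exact ⟨h1.star (by linarith), _, h2.star (by linarith), ih (by linarith) h3⟩

/-- Leibniz' rule, with each derivative lowering the index by two; after l of them it must still
exceed 1. -/
theorem Reg.tripleProd (ha : 1 + 2 * l < a) (hu : Reg T l a u) (hv : Reg T l a v)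
    (hw : Reg T l a w) : Reg T l a (fun t => tripleProd (u t) (v t) (w t)) := by
  induction l generalizing a u v w with
  | zero => exact CS.tripleProd (by simpa using ha) hu hv hw
  | succ l ih =>
    push_cast at ha
    have : (0 : ℝ) ≤ l := Nat.cast_nonneg l
    have hu0 := hu.of_succ.mono_index (b := a - 2) (by linarith) (by linarith)
    have hv0 := hv.of_succ.mono_index (b := a - 2) (by linarith) (by linarith)
    have hw0 := hw.of_succ.mono_index (b := a - 2) (by linarith) (by linarith)
    obtain ⟨h1, u', h2, h3⟩ := hu
    obtain ⟨k1, v', k2, k3⟩ := hv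
    obtain ⟨m1, w', m2, m3⟩ := hw
    have ha2 : 1 + 2 * (l : ℝ) < a - 2 := by linarith
    exact ⟨h1.tripleProd (by linarith) k1 m1, _, h2.tripleProd (by linarith) k2 m2,
      (ih ha2 hu0 hv0 m3).add ((ih ha2 hu0 k3 hw0).add (ih ha2 h3 hv0 hw0))⟩

/-- Covers `lap` and `dx` at once: an operator of order d is known only through its conjugation by
`J`, and the bounded operator A commutes with time derivatives. -/
theorem Reg.map {d : ℝ} {op : L2 → L2} {A : L2 →L[ℂ] L2}
    (hop : ∀ b f, d ≤ b → op (J b f) = J (b - d) (A f)) (ha : d + 2 * l ≤ a) (hu : Reg T l a u) :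
    Reg T l (a - d) (fun t => op (u t)) := by
  induction l generalizing a u with
  | zero =>
    obtain ⟨G, h1, h2⟩ := hu
    exact ⟨fun t => A (G t), A.continuous.comp_continuousOn h1, fun t ht => by
      beta_reduce
      rw [h2 t ht, hop a _ (by simpa using ha)]⟩
  | succ l ih =>
    push_cast at ha
    have : (0 : ℝ) ≤ l := Nat.cast_nonneg l
    obtain ⟨⟨G, h1, h2⟩, u', ⟨H, H', h3⟩, h4⟩ := hu
    refine ⟨⟨fun t => A (G t), A.continuous.comp_continuousOn h1, fun t ht => by
      beta_reduce
      rw [h2 t ht, hop a _ (by linarith)]⟩, fun t => op (u' t),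
      ⟨fun t => A (H t), fun t => A (H' t), fun t ht => ?_⟩, ?_⟩
    · obtain ⟨e1, e2, e3⟩ := h3 t ht
      beta_reduce
      rw [e1, e2, hop _ _ (by linarith), hop _ _ (by linarith), sub_right_comm]
      exact ⟨rfl, rfl, hasDerivWithinAt_clm A e3⟩
    · rw [sub_right_comm]
      exact ih (by linarith) h4

/-! ### The Laplacian and the partial derivatives on `L²` -/

open Classical in
/-- The Laplacian of an `L²` function, if it is an `L²` function. -/
def lap (f : L2) : L2 := if h : ∃ g : L2, Δ (toDist f) = toDist g then h.choose else 0

theorem lap_J (ha : 2 ≤ a) (f : L2) : lap (J a f) = J (a - 2) (Lap f) := by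
  have h : ∃ g : L2, Δ (toDist (J a f)) = toDist g := ⟨_, laplacian_J ha f⟩
  rw [lap, dif_pos h]
  exact toDist_injective (h.choose_spec.symm.trans (laplacian_J ha f))

theorem laplacian_toDist_J (ha : 2 ≤ a) (f : L2) : Δ (toDist (J a f)) = toDist (lap (J a f)) := by
  rw [lap_J ha, laplacian_J ha]

open Classical in
/-- The partial derivative of an `L²` function, if it is an `L²` function. -/
def dx (j : Fin 2) (f : L2) : L2 :=
  if h : ∃ g : L2, partialX j (toDist f) = toDist g then h.choose else 0

theorem dx_J (j : Fin 2) (ha : 1 ≤ a) (f : L2) : dx j (J a f) = J (a - 1) (Dx j f) := by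
  have h : ∃ g : L2, partialX j (toDist (J a f)) = toDist g := ⟨_, partialX_J ha j f⟩
  rw [dx, dif_pos h]
  exact toDist_injective (h.choose_spec.symm.trans (partialX_J ha j f))

theorem partialX_toDist_J (j : Fin 2) (ha : 1 ≤ a) (f : L2) :
    partialX j (toDist (J a f)) = toDist (dx j (J a f)) := by
  rw [dx_J j ha, partialX_J ha]

theorem Reg.lap (ha : 2 + 2 * l ≤ a) (hu : Reg T l a u) : Reg T l (a - 2) (fun t => lap (u t)) :=
  hu.map (fun _ f hb => lap_J hb f) ha

theorem Reg.dx (j : Fin 2) (ha : 1 + 2 * l ≤ a) (hu : Reg T l a u) :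
    Reg T l (a - 1) (fun t => dx j (u t)) :=
  hu.map (fun _ f hb => dx_J j hb f) ha

end KleinGordon

end

/-! ### Ordinary differential equations and strongly differentiable families. -/

noncomputable section

open FourierTransform
open scoped NNReal

namespace KleinGordon

/-! ### Ordinary differential equations in Banach spaces -/

section ODE

variable {E : Type*} [NormedAddCommGroup E] {F : ℝ → E → E} {T T' : ℝ≥0∞}

theorem timeIco_mono (h : T' ≤ T) : timeIco T' ⊆ timeIco T := fun _ ht => ⟨ht.1, ht.2.trans_le h⟩

/-- Local Lipschitz condition, locally uniform in time. -/
def LocLip (F : ℝ → E → E) (T : ℝ≥0∞) : Prop :=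
  ∀ t ∈ timeIco T, ∀ R : ℝ, ∃ K : ℝ≥0, ∀ r ∈ Set.Icc 0 t, LipschitzOnWith K (F r) (Metric.ball 0 R)

theorem LocLip.mono (hF : LocLip F T) (h : T' ≤ T) : LocLip F T' :=
  fun t ht => hF t (timeIco_mono h ht)

variable [NormedSpace ℝ E]

/-- `y` solves `y' = F(t, y)`, `y(0) = y₀` on `[0, T)`. -/
def IsODESol (F : ℝ → E → E) (y₀ : E) (T : ℝ≥0∞) (y : ℝ → E) : Prop :=
  y 0 = y₀ ∧ ∀ t ∈ timeIco T, HasDerivWithinAt y (F t (y t)) (Set.Ici 0) t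

variable {y₀ : E} {y z : ℝ → E}

theorem IsODESol.continuousOn (hy : IsODESol F y₀ T y) : ContinuousOn y (timeIco T) := fun t ht =>
  ((hy.2 t ht).continuousWithinAt).mono (timeIco_subset_Ici T)

theorem IsODESol.mono (hy : IsODESol F y₀ T y) (h : T' ≤ T) : IsODESol F y₀ T' y :=
  ⟨hy.1, fun t ht => hy.2 t (timeIco_mono h ht)⟩

/-- Both solutions are bounded on the compact interval [0, t], so one ball and one Lipschitz
constant suffice there. -/
theorem IsODESol.unique (hF : LocLip F T) (hy : IsODESol F y₀ T y) (hz : IsODESol F y₀ T z) :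
    ∀ t ∈ timeIco T, y t = z t := by
  intro t ht
  have hsub := Icc_subset_timeIco ht
  have hyc := hy.continuousOn.mono hsub
  have hzc := hz.continuousOn.mono hsub
  obtain ⟨A, hA⟩ := isCompact_Icc.exists_bound_of_continuousOn hyc
  obtain ⟨B, hB⟩ := isCompact_Icc.exists_bound_of_continuousOn hzc
  obtain ⟨K, hK⟩ := hF t ht (max A B + 1)
  refine ODE_solution_unique_of_mem_Icc_right (v := F) (s := fun _ => Metric.ball 0 (max A B + 1))
    (fun r hr => hK r ⟨hr.1, hr.2.le⟩) hyc (fun r hr => ?_) (fun r hr => ?_) hzc (fun r hr => ?_)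
    (fun r hr => ?_) (hy.1.trans hz.1.symm) ⟨ht.1, le_rfl⟩
  · exact (hy.2 r (hsub ⟨hr.1, hr.2.le⟩)).mono (Set.Ici_subset_Ici.2 hr.1)
  · rw [mem_ball_zero_iff]
    linarith [hA r ⟨hr.1, hr.2.le⟩, le_max_left A B]
  · exact (hz.2 r (hsub ⟨hr.1, hr.2.le⟩)).mono (Set.Ici_subset_Ici.2 hr.1)
  · rw [mem_ball_zero_iff]
    linarith [hB r ⟨hr.1, hr.2.le⟩, le_max_right A B]

/-- Solutions on shorter intervals glue together. -/
theorem exists_isODESol_of_forall (hT : 0 < T) (hF : LocLip F T)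
    (h : ∀ t ∈ timeIco T, ∃ T' : ℝ≥0∞, ENNReal.ofReal t < T' ∧ ∃ y, IsODESol F y₀ T' y) :
    ∃ y, IsODESol F y₀ T y := by
  classical
  choose! τ hτ Y hY using h
  have key : ∀ t ∈ timeIco T, ∀ r ∈ timeIco T, ENNReal.ofReal r < τ t → Y r r = Y t r := by
    intro t ht r hr hrt
    have hm : min T (min (τ t) (τ r)) ≤ T := min_le_left _ _
    refine IsODESol.unique (T := min T (min (τ t) (τ r))) (hF.mono hm)
      ((hY r hr).mono ((min_le_right _ _).trans (min_le_right _ _)))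
      ((hY t ht).mono ((min_le_right _ _).trans (min_le_left _ _))) r
      ⟨hr.1, lt_min hr.2 (lt_min hrt (hτ r hr))⟩
  -- Diagonal choice: for r near t, uniqueness gives Y r r = Y t r, so the derivative is that of the
  -- fixed solution Y t.
  refine ⟨fun t => Y t t, ?_, fun t ht => ?_⟩
  · exact (hY 0 (zero_mem_timeIco hT)).1
  · have ht' : t ∈ timeIco (τ t) := ⟨ht.1, hτ t ht⟩
    refine ((hY t ht).2 t ht').congr_of_eventuallyEq ?_ rfl
    filter_upwards [eventually_mem_timeIco ht, eventually_mem_timeIco ht'] with r h1 h2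
    exact key t ht r h1 h2.2

variable [CompleteSpace E]

/-- Global existence for globally Lipschitz vector fields. -/
theorem exists_isODESol_of_lipschitz (hF : Continuous fun p : ℝ × E => F p.1 p.2) {K : ℝ≥0}
    (hK : ∀ t, LipschitzWith K (F t)) (y₀ : E) {τ : ℝ} (hτ : 0 ≤ τ) :
    ∃ y : ℝ → E, y 0 = y₀ ∧ ∀ t ∈ Set.Icc 0 τ, HasDerivAt y (F t (y t)) t := by
  let I := Set.Icc (0 : ℝ) τ
  have : CompactSpace I := isCompact_iff_compactSpace.mp isCompact_Icc
  -- Exponentially weighted sup norm: z stands for e^{-lam t} y(t). The Picard map then contracts by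
  -- K/lam ≤ 1/2 on all of [0, τ] at once.
  let lam : ℝ := 2 * K + 1
  have hlam : 0 < lam := by positivity
  let ext : C(I, E) → ℝ → E := fun z r => Real.exp (lam * r) • z (Set.projIcc 0 τ hτ r)
  have hext : ∀ z, Continuous (ext z) := fun z =>
    (by fun_prop : Continuous fun r : ℝ => Real.exp (lam * r)).smul
      (z.continuous.comp continuous_projIcc)
  have hFext : ∀ z, Continuous fun r => F r (ext z r) := fun z =>
    hF.comp (continuous_id.prodMk (hext z))
  let Y : C(I, E) → ℝ → E := fun z t => y₀ + ∫ r in (0:ℝ)..t, F r (ext z r)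
  have hYd : ∀ z t, HasDerivAt (Y z) (F t (ext z t)) t := fun z t =>
    ((hFext z).integral_hasStrictDerivAt 0 t).hasDerivAt.const_add y₀
  have hYc : ∀ z, Continuous (Y z) := fun z =>
    continuous_iff_continuousAt.2 fun t => (hYd z t).continuousAt
  let Φ : C(I, E) → C(I, E) := fun z =>
    ⟨fun t => Real.exp (-(lam * t)) • Y z t, by
      have := hYc z
      fun_prop⟩
  have hΦ : ContractingWith (1 / 2) Φ := by
    refine ⟨by norm_num, LipschitzWith.of_dist_le_mul fun z z' => ?_⟩
    rw [ContinuousMap.dist_le (by positivity)]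
    rintro ⟨t, ht0, htτ⟩
    have e1 : dist (Φ z ⟨t, ht0, htτ⟩) (Φ z' ⟨t, ht0, htτ⟩) =
        Real.exp (-(lam * t)) * ‖∫ r in (0:ℝ)..t, (F r (ext z r) - F r (ext z' r))‖ := by
      rw [intervalIntegral.integral_sub ((hFext z).intervalIntegrable _ _)
        ((hFext z').intervalIntegrable _ _), dist_eq_norm]
      simp only [Φ, Y, ContinuousMap.coe_mk]
      rw [← smul_sub, norm_smul, Real.norm_of_nonneg (Real.exp_pos _).le, add_sub_add_left_eq_sub]
    have e2 : ‖∫ r in (0:ℝ)..t, (F r (ext z r) - F r (ext z' r))‖ ≤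
        ∫ r in (0:ℝ)..t, K * dist z z' * Real.exp (lam * r) := by
      refine intervalIntegral.norm_integral_le_of_norm_le ht0 (ae_of_all _ fun r _ => ?_)
        ((by fun_prop : Continuous fun r : ℝ =>
          K * dist z z' * Real.exp (lam * r)).intervalIntegrable _ _)
      have h1 := (hK r).dist_le_mul (ext z r) (ext z' r)
      rw [dist_eq_norm] at h1
      refine h1.trans ?_
      have h2 : dist (ext z r) (ext z' r) ≤ Real.exp (lam * r) * dist z z' := by
        simp only [ext]
        rw [dist_eq_norm, ← smul_sub, norm_smul, Real.norm_of_nonneg (Real.exp_pos _).le,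
          ← dist_eq_norm]
        gcongr
        exact ContinuousMap.dist_apply_le_dist _
      calc (K : ℝ) * dist (ext z r) (ext z' r) ≤ K * (Real.exp (lam * r) * dist z z') := by gcongr
        _ = _ := by ring
    have e3 : ∫ r in (0:ℝ)..t, K * dist z z' * Real.exp (lam * r) =
        K * dist z z' * (lam⁻¹ * (Real.exp (lam * t) - 1)) := by
      rw [intervalIntegral.integral_const_mul, intervalIntegral.integral_comp_mul_left _ hlam.ne']
      simp
    rw [e1]
    rw [e3] at e2
    have hd := dist_nonneg (x := z) (y := z')
    calc Real.exp (-(lam * t)) * ‖∫ r in (0:ℝ)..t, (F r (ext z r) - F r (ext z' r))‖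
        ≤ Real.exp (-(lam * t)) * (K * dist z z' * (lam⁻¹ * Real.exp (lam * t))) := by
          refine mul_le_mul_of_nonneg_left (e2.trans ?_) (Real.exp_pos _).le
          gcongr
          linarith
      _ = (Real.exp (-(lam * t)) * Real.exp (lam * t)) * (K * lam⁻¹) * dist z z' := by ring
      _ ≤ _ := by
          rw [← Real.exp_add, neg_add_cancel, Real.exp_zero, one_mul]
          refine mul_le_mul_of_nonneg_right ?_ hd
          rw [← div_eq_mul_inv, div_le_iff₀ hlam]
          simp only [lam]
          push_cast
          linarith [K.2]
  obtain ⟨z, hz, -⟩ := hΦ.exists_fixedPoint (0 : C(I, E)) (edist_ne_top _ _)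
  refine ⟨Y z, by simp [Y], fun t ht => ?_⟩
  have h1 : ext z t = Y z t := by
    have h2 : Φ z ⟨t, ht⟩ = z ⟨t, ht⟩ := by rw [hz.eq]
    simp only [ext, Set.projIcc_of_mem hτ ht, ← h2, Φ, ContinuousMap.coe_mk]
    rw [smul_smul, ← Real.exp_add, add_neg_cancel, Real.exp_zero, one_smul]
  have := hYd z t
  rwa [h1] at this

/-- Local existence for locally Lipschitz vector fields. -/
theorem exists_local_isODESol (hF : Continuous fun p : ℝ × E => F p.1 p.2) {K L : ℝ≥0} {y₀ : E}
    (hK : ∀ t, LipschitzOnWith K (F t) (Metric.closedBall y₀ 1))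
    (hL : ∀ t, ∀ x ∈ Metric.closedBall y₀ 1, ‖F t x‖ ≤ L) :
    ∃ T : ℝ≥0∞, 0 < T ∧ ∃ y, IsODESol F y₀ T y := by
  -- With speed at most L, the solution stays in the unit ball around y₀ for this time; the added 1
  -- avoids division by zero.
  have hpos : (0 : ℝ) < 1 / (L + 1) := by positivity
  have hP : IsPicardLindelof F (tmin := 0) (tmax := 1 / (L + 1))
      ⟨0, le_rfl, hpos.le⟩ y₀ 1 0 L K :=
    { lipschitzOnWith := fun t _ => hK t
      continuousOn := fun x _ => (hF.comp (continuous_id.prodMk continuous_const)).continuousOn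
      norm_le := fun t _ x hx => hL t x hx
      mul_max_le := by
        simp only [sub_zero, NNReal.coe_one, NNReal.coe_zero, sub_self]
        rw [max_eq_left hpos.le, mul_one_div, div_le_one (by positivity)]
        linarith }
  obtain ⟨y, hy0, hy⟩ := hP.exists_eq_forall_mem_Icc_hasDerivWithinAt₀
  refine ⟨ENNReal.ofReal (1 / (L + 1)), by simpa using hpos, y, hy0, fun t ht => ?_⟩
  have ht2 : t < 1 / (L + 1) := (ENNReal.ofReal_lt_ofReal_iff hpos).1 ht.2
  refine (hy t ⟨ht.1, ht2.le⟩).mono_of_mem_nhdsWithin ?_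
  filter_upwards [self_mem_nhdsWithin, mem_nhdsWithin_of_mem_nhds (Iio_mem_nhds ht2)] with r h1 h2
  exact ⟨h1, le_of_lt h2⟩

end ODE

/-! ### Strongly differentiable families of operators -/

/-- Product rule without norm continuity of P. The quotient splits into P_r applied to the quotient
of X, controlled by the uniform bound, and the quotient of P_r at the frozen vector X t. -/
theorem hasDerivWithinAt_family {P : ℝ → L2 →L[ℂ] L2} {C : ℝ} (hP : ∀ r f, ‖P r f‖ ≤ C * ‖f‖)
    {X : ℝ → L2} {x' d : L2} {s : Set ℝ} {t : ℝ} (hX : HasDerivWithinAt X x' s t)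
    (hc : Tendsto (fun r => P r x') (𝓝 t) (𝓝 (P t x')))
    (hd : HasDerivAt (fun r => P r (X t)) d t) :
    HasDerivWithinAt (fun r => P r (X r)) (d + P t x') s t := by
  have hd' := hd.hasDerivWithinAt (s := s)
  rw [hasDerivWithinAt_iff_tendsto_slope] at hX hd' ⊢
  have h1 : Tendsto (fun r => P r (slope X t r - x')) (𝓝[s \ {t}] t) (𝓝 0) := by
    refine squeeze_zero_norm (fun r => hP r _) ?_
    simpa using ((hX.sub_const x').norm.const_mul C)
  have h2 : Tendsto (fun r => P r x') (𝓝[s \ {t}] t) (𝓝 (P t x')) := hc.mono_left nhdsWithin_le_nhds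
  have h3 := hd'.add (h1.add h2)
  rw [zero_add] at h3
  refine h3.congr fun r => ?_
  rw [← map_add, sub_add_cancel, slope_def_module, slope_def_module, slope_def_module,
    (P r).map_smul_of_tower, map_sub, ← smul_add]
  congr 1
  abel

end KleinGordon

end

/-! ### Forced, cubic and linear Schrödinger equations. -/

noncomputable section

open FourierTransform
open scoped NNReal

namespace KleinGordon

variable {T : ℝ≥0∞} {a : ℝ} {u : ℝ → L2}

/-! ### Forced Schrödinger equations -/

theorem exists_gt_mem_timeIco {t : ℝ} (ht : t ∈ timeIco T) : ∃ τ ∈ timeIco T, t < τ := by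
  obtain ⟨r, h1, h2⟩ := ENNReal.lt_iff_exists_nnreal_btwn.1 ht.2
  refine ⟨r, ⟨r.2, by simpa using h2⟩, ?_⟩
  rw [← ENNReal.ofReal_coe_nnreal] at h1
  exact (ENNReal.ofReal_lt_ofReal_iff_of_nonneg ht.1).1 h1

/-- In the unknown Z = S(-t)u the unbounded Laplacian is absent from the vector field. It returns
here at the price of two indices, since the group is differentiable on H². -/
theorem ds_of_interaction (ha : 2 ≤ a) {Z N : ℝ → L2}
    (hZ : ∀ t ∈ timeIco T, HasDerivWithinAt Z (S (-t) (N t)) (Set.Ici 0) t) :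
    DS T (a - 2) (fun t => J a (S t (Z t)))
      (fun t => (-Complex.I / 2) • lap (J a (S t (Z t))) + J a (N t)) := by
  have hJ : ∀ f, J (a - 2) (J 2 f) = J a f := fun f => by
    rw [J_comp (by linarith) (by norm_num), sub_add_cancel]
  refine ⟨fun t => S t (J 2 (Z t)),
    fun t => (-Complex.I / 2) • Lap (S t (Z t)) + J 2 (N t), fun t ht => ⟨?_, ?_, ?_⟩⟩
  · beta_reduce
    rw [S_J (by norm_num), hJ]
  · beta_reduce
    rw [map_add, map_smul, hJ, lap_J ha]
  · have h1 := hasDerivWithinAt_family (P := fun t => S t ∘L J 2) (C := 1)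
      (fun r f => by
        rw [one_mul]
        exact (norm_S_le r _).trans (norm_J_le (by norm_num) f))
      (hZ t ht) ((continuous_S _).tendsto t) (hasDerivAt_S_J (Z t) t)
    have h2 : S t (J 2 (S (-t) (N t))) = J 2 (N t) := by
      rw [S_J (by norm_num), S_S_neg]
    rw [S_Lap] at h1
    simpa only [ContinuousLinearMap.comp_apply, h2] using h1

theorem hasDerivWithinAt_integral {M : ℝ → L2} (hM : ContinuousOn M (timeIco T)) {t : ℝ}
    (ht : t ∈ timeIco T) :
    HasDerivWithinAt (fun t => ∫ r in (0:ℝ)..t, M r) (M t) (Set.Ici 0) t := by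
  obtain ⟨τ, hτ, htτ⟩ := exists_gt_mem_timeIco ht
  have h0 : (0:ℝ) ≤ τ := hτ.1
  -- M is continuous only on [0, T), so it is extended by constants from a compact interval reaching
  -- past t.
  let M' : ℝ → L2 := Set.IccExtend h0 ((Set.Icc 0 τ).domRestrict M)
  have hM' : Continuous M' :=
    (continuousOn_iff_continuous_domRestrict.1 (hM.mono (Icc_subset_timeIco hτ))).Icc_extend'
  have heq : ∀ r ∈ Set.Icc 0 τ, M' r = M r := fun r hr => Set.IccExtend_of_mem h0 _ hr
  have h1 := (hM'.integral_hasStrictDerivAt 0 t).hasDerivAt.hasDerivWithinAt (s := Set.Ici 0)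
  rw [heq t ⟨ht.1, htτ.le⟩] at h1
  have key : ∀ r ∈ Set.Icc 0 τ, ∫ x in (0:ℝ)..r, M x = ∫ x in (0:ℝ)..r, M' x := by
    intro r hr
    refine intervalIntegral.integral_congr fun x hx => ?_
    rw [Set.uIcc_of_le hr.1] at hx
    exact (heq x ⟨hx.1, hx.2.trans hr.2⟩).symm
  refine h1.congr_of_eventuallyEq ?_ (key t ⟨ht.1, htτ.le⟩)
  filter_upwards [self_mem_nhdsWithin, mem_nhdsWithin_of_mem_nhds (Iio_mem_nhds htτ)] with r h2 h3
  exact key r ⟨h2, le_of_lt h3⟩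

theorem tendsto_S {α : Type*} {l : Filter α} {f : α → ℝ} {G : α → L2} {r : ℝ} {g : L2}
    (hf : Tendsto f l (𝓝 r)) (hG : Tendsto G l (𝓝 g)) :
    Tendsto (fun x => S (f x) (G x)) l (𝓝 (S r g)) := by
  have h1 : Tendsto (fun x => S (f x) (G x - g)) l (𝓝 0) := by
    refine squeeze_zero_norm (fun _ => norm_S_le _ _) ?_
    simpa using (hG.sub_const g).norm
  have h2 : Tendsto (fun x => S (f x) g) l (𝓝 (S r g)) := ((continuous_S g).tendsto r).comp hf
  have h3 := h1.add h2
  rw [zero_add] at h3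
  refine h3.congr fun x => ?_
  rw [← map_add, sub_add_cancel]

theorem continuousOn_S {α : Type*} [TopologicalSpace α] {f : α → ℝ} {G : α → L2} {s : Set α}
    (hf : ContinuousOn f s) (hG : ContinuousOn G s) : ContinuousOn (fun t => S (f t) (G t)) s :=
  fun x hx => tendsto_S (hf x hx) (hG x hx)

theorem continuous_S_comp {α : Type*} [TopologicalSpace α] {f : α → ℝ} {G : α → L2}
    (hf : Continuous f) (hG : Continuous G) : Continuous (fun t => S (f t) (G t)) :=
  continuous_iff_continuousAt.2 fun _ => tendsto_S hf.continuousAt hG.continuousAt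

/-- Converse to `ds_of_interaction`, assuming differentiability only in L² and only for t > 0.
Duhamel's formula is proved in L²; cancelling the injective `J a` lifts it to H^a and yields the
derivative at t = 0 as well. -/
theorem interaction_of_hasDerivAt (ha : 2 ≤ a) {G N : ℝ → L2} (hG : ContinuousOn G (timeIco T))
    (hN : ContinuousOn N (timeIco T)) (hu : ∀ t ∈ timeIco T, u t = J a (G t))
    (hd : ∀ t ∈ timeIoo T, HasDerivAt u ((-Complex.I / 2) • lap (u t) + J a (N t)) t) :
    ∀ t ∈ timeIco T, HasDerivWithinAt (fun r => S (-r) (G r)) (S (-t) (N t)) (Set.Ici 0) t := by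
  have ha0 : 0 ≤ a := by linarith
  have hJ : ∀ f, J 2 (J (a - 2) f) = J a f := fun f => by
    rw [J_comp (by norm_num) (by linarith), add_sub_cancel]
  have hM : ContinuousOn (fun r => S (-r) (N r)) (timeIco T) :=
    continuousOn_S continuous_neg.continuousOn hN
  have huc : ContinuousOn u (timeIco T) := ((J a).continuous.comp_continuousOn hG).congr hu
  have hz : ∀ t ∈ timeIoo T, HasDerivAt (fun r => S (-r) (u r)) (J a (S (-t) (N t))) t := by
    intro t ht
    have hut := hu t (timeIoo_subset_timeIco T ht)
    have hS : HasDerivAt (fun r => S (-r) (u t)) ((Complex.I / 2) • S (-t) (lap (u t))) t := by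
      have h1 := (hasDerivAt_S_J (J (a - 2) (G t)) (-t)).scomp t (hasDerivAt_neg t)
      rw [hJ, ← hut] at h1
      have h2 : Lap (J (a - 2) (G t)) = lap (u t) := by
        rw [hut, lap_J ha]
        exact mulOp_comm isSymbol_lapSymbol (isSymbol_jSymbol (by linarith)) _
      rw [h2] at h1
      refine h1.congr_deriv ?_
      rw [neg_one_smul, ← neg_smul]
      congr 1
      ring
    have h3 := hasDerivWithinAt_family (P := fun r => S (-r)) (C := 1) (s := Set.univ)
      (fun r f => by rw [one_mul]; exact norm_S_le _ f) (hd t ht).hasDerivWithinAt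
      (((continuous_S _).comp continuous_neg).tendsto t) hS
    rw [hasDerivWithinAt_univ] at h3
    refine h3.congr_deriv ?_
    rw [map_add, map_smul, S_J ha0, ← add_assoc, ← add_smul]
    simp [neg_div]
  have key : ∀ t ∈ timeIco T, S (-t) (G t) = S (-0) (G 0) + ∫ r in (0:ℝ)..t, S (-r) (N r) := by
    intro t ht
    have hsub := Icc_subset_timeIco ht
    have h1 : ∫ r in (0:ℝ)..t, J a (S (-r) (N r)) = S (-t) (u t) - S (-0) (u 0) := by
      refine intervalIntegral.integral_eq_sub_of_hasDeriv_right_of_le ht.1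
        ((continuousOn_S continuous_neg.continuousOn huc).mono hsub)
        (fun r hr => (hz r ⟨hr.1, (hsub ⟨hr.1.le, hr.2.le⟩).2⟩).hasDerivWithinAt) ?_
      refine ContinuousOn.intervalIntegrable ?_
      rw [Set.uIcc_of_le ht.1]
      exact (J a).continuous.comp_continuousOn (hM.mono hsub)
    have h2 : ∫ r in (0:ℝ)..t, J a (S (-r) (N r)) = J a (∫ r in (0:ℝ)..t, S (-r) (N r)) := by
      refine (J a).intervalIntegral_comp_comm ?_
      refine ContinuousOn.intervalIntegrable ?_
      rw [Set.uIcc_of_le ht.1]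
      exact hM.mono hsub
    apply J_injective ha0
    rw [map_add, ← h2, h1, hu t ht, hu 0 (hsub ⟨le_rfl, ht.1⟩), S_J ha0, S_J ha0]
    abel
  intro t ht
  refine ((hasDerivWithinAt_integral hM ht).const_add (S (-0) (G 0))).congr_of_eventuallyEq ?_
    (key t ht)
  filter_upwards [eventually_mem_timeIco ht] with r hr using key r hr

/-- Bootstrap: time derivatives of solutions of a forced Schrödinger equation. -/
theorem reg_of_schrodinger {f : ℝ → L2} {L : ℕ} (hL : 2 * (L : ℝ) ≤ a) (hu : CS T a u)
    (hd : DS T (a - 2) u (fun t => (-Complex.I / 2) • lap (u t) + f t))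
    (hf : ∀ l < L, Reg T l a u → Reg T l (a - 2) f) : Reg T L a u := by
  have key : ∀ l ≤ L, Reg T l a u := by
    intro l
    induction l with
    | zero => exact fun _ => hu
    | succ l ih =>
      intro hl
      have h1 := ih (by omega)
      have h2 : (l : ℝ) + 1 ≤ L := by exact_mod_cast hl
      exact ⟨hu, _, hd, ((h1.lap (by linarith)).smul _).add (hf l (by omega) h1)⟩
  exact key L le_rfl

/-! ### The trilinear term -/

theorem norm_tri_le (ha : 1 < a) (F G H : L2) :
    ‖tri a ha F G H‖ ≤ ‖prodOp a ha‖ ^ 2 * (‖F‖ * ‖G‖ * ‖H‖) := by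
  rw [tri]
  refine ((prodOp a ha).le_opNorm₂ _ _).trans ?_
  have h := (prodOp a ha).le_opNorm₂ F G
  calc _ ≤ ‖prodOp a ha‖ * (‖prodOp a ha‖ * ‖F‖ * ‖G‖) * ‖H‖ := by gcongr
    _ = _ := by ring

theorem continuous_tri_comp {α : Type*} [TopologicalSpace α] (ha : 1 < a) {F G H : α → L2}
    (hF : Continuous F) (hG : Continuous G) (hH : Continuous H) :
    Continuous (fun t => tri a ha (F t) (G t) (H t)) := by
  unfold tri
  fun_prop

/-- The cubic nonlinearity read on `L²`. -/
def cubic (a : ℝ) (ha : 1 < a) (X : L2) : L2 := tri a ha X X (star X)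

theorem norm_cubic_sub_le (ha : 1 < a) {R : ℝ} {X Y : L2} (hX : ‖X‖ ≤ R) (hY : ‖Y‖ ≤ R) :
    ‖cubic a ha X - cubic a ha Y‖ ≤ (‖prodOp a ha‖ ^ 2 * (3 * R ^ 2)) * ‖X - Y‖ := by
  have hR : 0 ≤ R := (norm_nonneg _).trans hX
  have e : cubic a ha X - cubic a ha Y = tri a ha (X - Y) X (star X) +
      tri a ha Y (X - Y) (star X) + tri a ha Y Y (star (X - Y)) := by
    simp only [cubic, tri, map_sub, sub_apply, star_sub]
    abel
  have hX' : ‖star X‖ ≤ R := by rwa [norm_star]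
  have h1 := norm_tri_le ha (X - Y) X (star X)
  have h2 := norm_tri_le ha Y (X - Y) (star X)
  have h3 := norm_tri_le ha Y Y (star (X - Y))
  rw [norm_star] at h3
  rw [e]
  refine (norm_add₃_le).trans ?_
  have k1 : ‖X - Y‖ * ‖X‖ * ‖star X‖ ≤ ‖X - Y‖ * R * R := by gcongr
  have k2 : ‖Y‖ * ‖X - Y‖ * ‖star X‖ ≤ R * ‖X - Y‖ * R := by gcongr
  have k3 : ‖Y‖ * ‖Y‖ * ‖X - Y‖ ≤ R * R * ‖X - Y‖ := by gcongr
  have hM : 0 ≤ ‖prodOp a ha‖ ^ 2 := by positivity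
  nlinarith [mul_le_mul_of_nonneg_left k1 hM, mul_le_mul_of_nonneg_left k2 hM,
    mul_le_mul_of_nonneg_left k3 hM]

/-! ### The cubic Schrödinger equation -/

/-- The cubic Schrödinger vector field in the interaction picture. -/
def nlsField (lam a : ℝ) (ha : 1 < a) (t : ℝ) (y : L2) : L2 :=
  S (-t) ((Complex.I / 2 * (3 * lam)) • cubic a ha (S t y))

theorem continuous_nlsField (lam : ℝ) (ha : 1 < a) :
    Continuous fun p : ℝ × L2 => nlsField lam a ha p.1 p.2 := by
  have h1 := continuous_S_apply
  have h2 := continuous_tri_comp ha h1 h1 (continuous_star.comp h1)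
  exact continuous_S_comp continuous_fst.neg (h2.const_smul (Complex.I / 2 * (3 * (lam : ℂ))))

theorem nlsField_lip (lam : ℝ) (ha : 1 < a) (R : ℝ) : ∃ K : ℝ≥0, ∀ t,
    LipschitzOnWith K (nlsField lam a ha t) (Metric.ball 0 R) := by
  have hpos : 0 ≤ ‖(Complex.I / 2 * (3 * lam) : ℂ)‖ * (‖prodOp a ha‖ ^ 2 * (3 * R ^ 2)) := by
    positivity
  refine ⟨Real.toNNReal (‖(Complex.I / 2 * (3 * lam) : ℂ)‖ * (‖prodOp a ha‖ ^ 2 * (3 * R ^ 2))),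
    fun t => LipschitzOnWith.of_dist_le_mul fun x hx y hy => ?_⟩
  rw [mem_ball_zero_iff] at hx hy
  rw [dist_eq_norm, dist_eq_norm, nlsField, nlsField, ← map_sub, ← smul_sub, Real.coe_toNNReal _ hpos]
  refine (norm_S_le _ _).trans ?_
  rw [norm_smul, mul_assoc]
  refine mul_le_mul_of_nonneg_left ?_ (norm_nonneg _)
  refine (norm_cubic_sub_le ha ((norm_S_le _ _).trans hx.le) ((norm_S_le _ _).trans hy.le)).trans ?_
  rw [← map_sub]
  exact mul_le_mul_of_nonneg_left (norm_S_le _ _) (by positivity)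

theorem locLip_nlsField (lam : ℝ) (ha : 1 < a) : LocLip (nlsField lam a ha) T := by
  intro t _ R
  obtain ⟨K, hK⟩ := nlsField_lip lam ha R
  exact ⟨K, fun r _ => hK r⟩

theorem exists_local_nls (lam : ℝ) (ha : 1 < a) (y₀ : L2) :
    ∃ T : ℝ≥0∞, 0 < T ∧ ∃ y, IsODESol (nlsField lam a ha) y₀ T y := by
  obtain ⟨K, hK⟩ := nlsField_lip lam ha (‖y₀‖ + 2)
  have hsub : Metric.closedBall y₀ 1 ⊆ Metric.ball 0 (‖y₀‖ + 2) := by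
    intro x hx
    rw [mem_closedBall_iff_norm] at hx
    rw [mem_ball_zero_iff]
    have := norm_add_le (x - y₀) y₀
    rw [sub_add_cancel] at this
    linarith
  have hK' : ∀ t, LipschitzOnWith K (nlsField lam a ha t) (Metric.closedBall y₀ 1) :=
    fun t => (hK t).mono hsub
  refine exists_local_isODESol (K := K) (L := K * (‖y₀‖₊ + 2)) (continuous_nlsField lam ha) hK'
    fun t x hx => ?_
  have h0 : nlsField lam a ha t 0 = 0 := by simp [nlsField, cubic, tri]
  have h1 := (hK t).dist_le_mul x (hsub hx) 0 (by simp; positivity)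
  rw [h0, dist_zero_right, dist_zero_right] at h1
  refine h1.trans ?_
  have h2 := mem_ball_zero_iff.1 (hsub hx)
  push_cast
  gcongr

/-- Every solution admitted in the supremum `existenceTime` thus solves one and the same ODE, so
uniqueness can glue them together. -/
theorem isODESol_of_isNLSSolution {lam s : ℝ} (hs : 2 ≤ s) (hs1 : 1 < s)
    {φ ψ : Lp ℝ 2 (volume : Measure Plane)} {y₀ : L2}
    (hy₀ : J s y₀ = (1 / 2 : ℂ) • (complexify φ - Complex.I • complexify ψ)) (hT : 0 < T)
    {g : ℝ → L2} (hg : IsNLSSolution lam s φ ψ T g) :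
    ∃ Z, IsODESol (nlsField lam s hs1) y₀ T Z := by
  obtain ⟨hc, h0, hd⟩ := hg
  have hs0 : 0 ≤ s := by linarith
  rw [← cs_iff_continuousSobolev hs0] at hc
  obtain ⟨G, hG, hgG⟩ := hc
  have hN : ContinuousOn (fun t => (Complex.I / 2 * (3 * lam)) • cubic s hs1 (G t)) (timeIco T) :=
    (continuousOn_tri hs1 hG hG (continuous_star.comp_continuousOn hG)).const_smul
      (Complex.I / 2 * (3 * (lam : ℂ)))
  have h1 := interaction_of_hasDerivAt hs hG hN hgG fun t ht => by
    obtain ⟨g', h2, h3⟩ := hd t ht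
    have hgt := hgG t (timeIoo_subset_timeIco T ht)
    refine h2.congr_deriv ?_
    apply toDist_injective
    have h4 : (2 * Complex.I) • toDist g' =
        toDist (lap (g t) - (3 * (lam : ℂ)) • tripleProd (g t) (g t) (star (g t))) := by
      have h5 : Δ (toDist (g t)) = toDist (lap (g t)) := by
        rw [hgt, laplacian_toDist_J hs]
      rw [h5] at h3
      rw [toDist_sub, toDist_smul, ← sub_eq_zero, ← h3]
      abel
    have h6 : toDist g' = toDist ((2 * Complex.I)⁻¹ •
        (lap (g t) - (3 * (lam : ℂ)) • tripleProd (g t) (g t) (star (g t)))) := by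
      rw [toDist_smul, ← h4, smul_smul, inv_mul_cancel₀ (by simp), one_smul]
    rw [h6]
    congr 1
    rw [smul_sub, smul_smul, map_smul, cubic, ← tripleProd_J hs1, ← star_J hs0, ← hgt,
      sub_eq_add_neg, ← neg_smul]
    have h7 : (2 * Complex.I)⁻¹ = -Complex.I / 2 := by
      rw [mul_inv, Complex.inv_I]; ring
    rw [h7]
    congr 2
    ring
  refine ⟨fun r => S (-r) (G r), ?_, fun t ht => ?_⟩
  · beta_reduce
    rw [neg_zero, S_zero]
    apply J_injective hs0
    rw [hy₀, ← h0, hgG 0 (zero_mem_timeIco hT)]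
  · refine (h1 t ht).congr_deriv ?_
    rw [nlsField, S_S_neg]

theorem isNLSSolution_of_isODESol {lam s : ℝ} (hs : 2 ≤ s) (hs1 : 1 < s)
    {φ ψ : Lp ℝ 2 (volume : Measure Plane)} {y₀ : L2}
    (hy₀ : J s y₀ = (1 / 2 : ℂ) • (complexify φ - Complex.I • complexify ψ))
    {Z : ℝ → L2} (hZ : IsODESol (nlsField lam s hs1) y₀ T Z) :
    IsNLSSolution lam s φ ψ T (fun t => J s (S t (Z t))) ∧
      DS T (s - 2) (fun t => J s (S t (Z t))) (fun t => (-Complex.I / 2) • lap (J s (S t (Z t))) +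
        (Complex.I / 2 * (3 * lam)) • tripleProd (J s (S t (Z t))) (J s (S t (Z t)))
          (star (J s (S t (Z t))))) := by
  have hs0 : 0 ≤ s := by linarith
  have hDS := ds_of_interaction hs (N := fun t => (Complex.I / 2 * (3 * lam)) •
    cubic s hs1 (S t (Z t))) hZ.2
  have hDS' : DS T (s - 2) (fun t => J s (S t (Z t))) (fun t =>
      (-Complex.I / 2) • lap (J s (S t (Z t))) +
        (Complex.I / 2 * (3 * lam)) • tripleProd (J s (S t (Z t))) (J s (S t (Z t)))
          (star (J s (S t (Z t))))) := by
    refine hDS.congr (fun _ _ => rfl) fun t _ => ?_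
    rw [star_J hs0, tripleProd_J hs1, map_smul]
    rfl
  refine ⟨⟨?_, ?_, fun t ht => ⟨_, hDS'.hasDerivAt ht, ?_⟩⟩, hDS'⟩
  · rw [← cs_iff_continuousSobolev hs0]
    exact ⟨fun t => S t (Z t), continuousOn_S continuousOn_id hZ.continuousOn, fun _ _ => rfl⟩
  · beta_reduce
    rw [S_zero, hZ.1, hy₀]
  · beta_reduce
    rw [laplacian_toDist_J hs, ← toDist_smul, ← toDist_smul, ← toDist_sub, ← toDist_add,
      ← toDist_zero]
    congr 1
    rw [smul_add, smul_smul, smul_smul]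
    have e1 : 2 * Complex.I * (-Complex.I / 2) = 1 := by
      ring_nf; simp
    have e2 : 2 * Complex.I * (Complex.I / 2 * (3 * (lam : ℂ))) = -(3 * lam) := by
      ring_nf; simp
    rw [e1, e2, one_smul, neg_smul]
    abel

/-- The maximal solution of the cubic Schrödinger equation. -/
theorem exists_maximal_nls {lam s : ℝ} (hs : 2 ≤ s) {φ ψ : Lp ℝ 2 (volume : Measure Plane)}
    (hφ : MemSobolev s 2 (toDist (complexify φ))) (hψ : MemSobolev s 2 (toDist (complexify ψ))) :
    0 < existenceTime lam s φ ψ ∧ ∃ g : ℝ → L2,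
      IsNLSSolution lam s φ ψ (existenceTime lam s φ ψ) g ∧
      DS (existenceTime lam s φ ψ) (s - 2) g (fun t => (-Complex.I / 2) • lap (g t) +
        (Complex.I / 2 * (3 * lam)) • tripleProd (g t) (g t) (star (g t))) := by
  have hs1 : 1 < s := by linarith
  have hs0 : 0 ≤ s := by linarith
  obtain ⟨Φ, hΦ⟩ := hφ
  obtain ⟨Ψ, hΨ⟩ := hψ
  have hΦ' := (besselPotential_toDist_iff hs0 _ _).1 hΦ
  have hΨ' := (besselPotential_toDist_iff hs0 _ _).1 hΨ
  have hy₀ : J s ((1 / 2 : ℂ) • (Φ - Complex.I • Ψ)) =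
      (1 / 2 : ℂ) • (complexify φ - Complex.I • complexify ψ) := by
    rw [hΦ', hΨ', map_smul, map_sub, map_smul]
  have hpos : 0 < existenceTime lam s φ ψ := by
    obtain ⟨T, hT, y, hy⟩ := exists_local_nls lam hs1 ((1 / 2 : ℂ) • (Φ - Complex.I • Ψ))
    exact hT.trans_le (le_sSup ⟨_, (isNLSSolution_of_isODESol hs hs1 hy₀ hy).1⟩)
  refine ⟨hpos, ?_⟩
  -- For t below the supremum some solution lives beyond t, so gluing reaches the supremum itself,
  -- finite or not.
  obtain ⟨Z, hZ⟩ := exists_isODESol_of_forall (F := nlsField lam s hs1) hpos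
    (locLip_nlsField lam hs1) (y₀ := (1 / 2 : ℂ) • (Φ - Complex.I • Ψ)) fun t ht => by
      obtain ⟨T', ⟨g, hg⟩, hT'⟩ := lt_sSup_iff.1 ht.2
      exact ⟨T', hT', isODESol_of_isNLSSolution hs hs1 hy₀ (bot_le.trans_lt hT') hg⟩
  exact ⟨_, isNLSSolution_of_isODESol hs hs1 hy₀ hZ⟩

theorem reg_nls {lam : ℝ} {g : ℝ → L2} {L : ℕ} (hL : 2 * (L : ℝ) ≤ a) (hg : CS T a g)
    (hd : DS T (a - 2) g (fun t => (-Complex.I / 2) • lap (g t) +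
      (Complex.I / 2 * (3 * lam)) • tripleProd (g t) (g t) (star (g t)))) : Reg T L a g := by
  refine reg_of_schrodinger hL hg hd fun l hl h => ?_
  have h2 : (l : ℝ) + 1 ≤ L := by exact_mod_cast hl
  exact ((h.tripleProd (by linarith) h (h.star (by linarith))).smul _).mono_index (by linarith)
    (by linarith)

/-! ### Linear Schrödinger equations -/

/-- Λ is the forcing Ψ read on `L2` through `J a`. Being globally Lipschitz on compact time
intervals, it allows no blow-up before T. -/
theorem exists_linear_schrodinger (ha : 2 ≤ a) (hT : 0 < T) {Λ Ψ : ℝ → L2 → L2}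
    (hΛc : ContinuousOn (fun p : ℝ × L2 => Λ p.1 p.2) (timeIco T ×ˢ Set.univ))
    (hΛ : ∀ t ∈ timeIco T, ∃ K : ℝ≥0, ∀ r ∈ Set.Icc 0 t, LipschitzWith K (Λ r))
    (hΨ : ∀ t ∈ timeIco T, ∀ X, Ψ t (J a X) = J a (Λ t X)) (Z₀ : L2) :
    ∃ u : ℝ → L2, u 0 = J a Z₀ ∧ CS T a u ∧
      DS T (a - 2) u (fun t => (-Complex.I / 2) • lap (u t) + Ψ t (u t)) := by
  let F : ℝ → L2 → L2 := fun t y => S (-t) (Λ t (S t y))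
  have hFlip : ∀ t ∈ timeIco T, ∃ K : ℝ≥0, ∀ r ∈ Set.Icc 0 t, LipschitzWith K (F r) := by
    intro t ht
    obtain ⟨K, hK⟩ := hΛ t ht
    refine ⟨K, fun r hr => LipschitzWith.of_dist_le_mul fun x y => ?_⟩
    simp only [F]
    rw [dist_eq_norm, ← map_sub]
    refine (norm_S_le _ _).trans ?_
    rw [← dist_eq_norm]
    refine ((hK r hr).dist_le_mul _ _).trans ?_
    gcongr
    rw [dist_eq_norm, ← map_sub, dist_eq_norm]
    exact norm_S_le _ _
  have hFc : ContinuousOn (fun p : ℝ × L2 => F p.1 p.2) (timeIco T ×ˢ Set.univ) := by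
    have h1 : ContinuousOn (fun p : ℝ × L2 => Λ p.1 (S p.1 p.2)) (timeIco T ×ˢ Set.univ) :=
      hΛc.comp (continuous_fst.prodMk continuous_S_apply).continuousOn fun p hp => ⟨hp.1, trivial⟩
    exact continuousOn_S continuous_fst.neg.continuousOn h1
  have hLL : LocLip F T := fun t ht R => by
    obtain ⟨K, hK⟩ := hFlip t ht
    exact ⟨K, fun r hr => (hK r hr).lipschitzOnWith⟩
  obtain ⟨Z, hZ⟩ := exists_isODESol_of_forall (y₀ := Z₀) hT hLL fun t ht => by
    obtain ⟨τ, hτ, htτ⟩ := exists_gt_mem_timeIco ht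
    have h0 : (0:ℝ) ≤ τ := hτ.1
    obtain ⟨K, hK⟩ := hFlip τ hτ
    have hproj : ∀ r, (Set.projIcc 0 τ h0 r : ℝ) ∈ Set.Icc 0 τ := fun r => (Set.projIcc 0 τ h0 r).2
    -- The field is controlled only on [0, T); time is clamped to [0, τ] to get one that is globally
    -- continuous and Lipschitz.
    have hc : Continuous fun p : ℝ × L2 => F (Set.projIcc 0 τ h0 p.1) p.2 := by
      refine hFc.comp_continuous (f := fun p : ℝ × L2 => ((Set.projIcc 0 τ h0 p.1 : ℝ), p.2)) ?_ ?_
      · exact ((continuous_subtype_val.comp continuous_projIcc).comp continuous_fst).prodMk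
          continuous_snd
      · exact fun p => ⟨Icc_subset_timeIco hτ (hproj p.1), trivial⟩
    obtain ⟨y, hy0, hy⟩ := exists_isODESol_of_lipschitz
      (F := fun r => F (Set.projIcc 0 τ h0 r)) hc (fun r => hK _ (hproj r)) Z₀ h0
    refine ⟨ENNReal.ofReal τ, (ENNReal.ofReal_lt_ofReal_iff_of_nonneg ht.1).2 htτ, y, hy0,
      fun r hr => ?_⟩
    have hr' : r ∈ Set.Icc 0 τ := ⟨hr.1, ((ENNReal.ofReal_lt_ofReal_iff_of_nonneg hr.1).1 hr.2).le⟩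
    have := (hy r hr').hasDerivWithinAt (s := Set.Ici 0)
    simpa only [Set.projIcc_of_mem h0 hr'] using this
  refine ⟨fun t => J a (S t (Z t)), by simp only [S_zero, hZ.1],
    ⟨fun t => S t (Z t), continuousOn_S continuousOn_id hZ.continuousOn, fun _ _ => rfl⟩, ?_⟩
  refine (ds_of_interaction ha (N := fun t => Λ t (S t (Z t))) hZ.2).congr (fun _ _ => rfl)
    fun t ht => ?_
  rw [hΨ t ht]

end KleinGordon

end

/-! ### Combinatorics of harmonics and cubic sums; Lipschitz forcing terms. -/

noncomputable section

open FourierTransform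
open scoped NNReal

namespace KleinGordon

variable {T : ℝ≥0∞} {a : ℝ} {K : ℕ} {n p : ℤ}

/-! ### Harmonics and cubic coefficients -/

theorem mem_harmonics : p ∈ harmonics n ↔ |p| ≤ maxHarmonic n ∧ Odd p := by
  rw [harmonics, Finset.mem_filter, Finset.mem_Icc, abs_le]

theorem mem_harmonics_even (hn : Even n) : p ∈ harmonics n ↔ |p| ≤ n + 1 ∧ Odd p := by
  rw [mem_harmonics, maxHarmonic, if_pos hn]

theorem neg_mem_harmonics : -p ∈ harmonics n ↔ p ∈ harmonics n := by
  rw [mem_harmonics, mem_harmonics, abs_neg, odd_neg]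

theorem sum_harmonics_neg {M : Type*} [AddCommMonoid M] (f : ℤ → M) :
    ∑ p ∈ harmonics n, f (-p) = ∑ p ∈ harmonics n, f p :=
  Finset.sum_nbij' (fun p => -p) (fun p => -p) (fun _ h => neg_mem_harmonics.2 h)
    (fun _ h => neg_mem_harmonics.2 h) (fun _ _ => neg_neg _) (fun _ _ => neg_neg _)
    (fun _ _ => rfl)

/-- The set of all pairs `(n, p)` with `0 ≤ n ≤ K + 2` and `p ∈ H_n`. -/
def indices (K : ℕ) : Finset (ℤ × ℤ) :=
  (Finset.Icc (0 : ℤ) (K + 2)).biUnion fun n => (harmonics n).image (Prod.mk n)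

theorem mem_indices {x : ℤ × ℤ} :
    x ∈ indices K ↔ x.1 ∈ Finset.Icc (0 : ℤ) (K + 2) ∧ x.2 ∈ harmonics x.1 := by
  obtain ⟨n, p⟩ := x
  simp only [indices, Finset.mem_biUnion, Finset.mem_image, Prod.mk.injEq]
  constructor
  · rintro ⟨m, hm, q, hq, rfl, rfl⟩
    exact ⟨hm, hq⟩
  · rintro ⟨hn, hp⟩
    exact ⟨n, hn, p, hp, rfl, rfl⟩

/-- The triples of indices that contribute to the `(n, p)` coefficient of a cubic expression. -/
def triples (K : ℕ) (n p : ℤ) : Finset ((ℤ × ℤ) × (ℤ × ℤ) × (ℤ × ℤ)) :=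
  (indices K ×ˢ indices K ×ˢ indices K).filter fun x =>
    x.1.1 + x.2.1.1 + x.2.2.1 = n ∧ x.1.2 + x.2.1.2 + x.2.2.2 = p

theorem mem_triples {x : (ℤ × ℤ) × (ℤ × ℤ) × (ℤ × ℤ)} : x ∈ triples K n p ↔
    (x.1 ∈ indices K ∧ x.2.1 ∈ indices K ∧ x.2.2 ∈ indices K) ∧
      x.1.1 + x.2.1.1 + x.2.2.1 = n ∧ x.1.2 + x.2.1.2 + x.2.2.2 = p := by
  rw [triples, Finset.mem_filter, Finset.mem_product, Finset.mem_product]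

theorem mem_triples_le {x : (ℤ × ℤ) × (ℤ × ℤ) × (ℤ × ℤ)} (hx : x ∈ triples K n p) :
    (0 ≤ x.1.1 ∧ x.1.1 ≤ n) ∧ (0 ≤ x.2.1.1 ∧ x.2.1.1 ≤ n) ∧ (0 ≤ x.2.2.1 ∧ x.2.2.1 ≤ n) := by
  simp only [mem_triples, mem_indices, Finset.mem_Icc] at hx
  omega

/-- Three harmonics add up to at most n + 3 in modulus. If n is odd, one of the three orders is odd
and contributes one less, giving n + 2. Hence a cubic term of order n creates only harmonics allowed
at order n + 2. -/
theorem mem_harmonics_of_mem_triples {x : (ℤ × ℤ) × (ℤ × ℤ) × (ℤ × ℤ)}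
    (hx : x ∈ triples K n p) : p ∈ harmonics (n + 2) := by
  simp only [mem_triples, mem_indices, mem_harmonics, maxHarmonic, Int.even_iff, Int.odd_iff,
    abs_le] at hx ⊢
  obtain ⟨⟨⟨-, ⟨h1, h2⟩, h3⟩, ⟨-, ⟨k1, k2⟩, k3⟩, ⟨-, ⟨l1, l2⟩, l3⟩⟩, rfl, rfl⟩ := hx
  split_ifs at * <;> omega

/-- The `(n, p)` coefficient of the cubic expression `τ(v, v, v)`. -/
def cubSum (τ : L2 → L2 → L2 → L2) (K : ℕ) (v : ℤ → ℤ → L2) (n p : ℤ) : L2 :=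
  ∑ x ∈ triples K n p, τ (v x.1.1 x.1.2) (v x.2.1.1 x.2.1.2) (v x.2.2.1 x.2.2.2)

theorem sum_indices {M : Type*} [AddCommMonoid M] (f : ℤ × ℤ → M) :
    ∑ x ∈ indices K, f x = ∑ n ∈ Finset.Icc (0 : ℤ) (K + 2), ∑ p ∈ harmonics n, f (n, p) :=
  Finset.sum_finset_product _ _ _ fun _ => mem_indices

/-- Flattening the six nested sums into one sum over triples makes reindexing and vanishing
arguments possible. -/
theorem fCoeff_eq (lam : ℝ) (U : Amplitudes) (t : ℝ) : fCoeff lam K U n p t =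
    (lam : ℂ) • cubSum tripleProd K (fun m q => U m q t 3) n p := by
  rw [fCoeff, cubSum, triples, Finset.sum_filter, Finset.sum_product]
  simp_rw [Finset.sum_product, sum_indices]
  congr 1
  refine Finset.sum_congr rfl fun n₁ _ => ?_
  rw [Finset.sum_comm (s := harmonics n₁)]
  refine Finset.sum_congr rfl fun n₂ _ => ?_
  simp_rw [Finset.sum_comm (s := harmonics n₂) (t := Finset.Icc (0 : ℤ) (K + 2))]
  rw [Finset.sum_comm (s := harmonics n₁)]
  refine Finset.sum_congr rfl fun n₃ _ => ?_
  split_ifs with h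
  · simp [h]
  · simp [h]

theorem cubSum_congr {τ : L2 → L2 → L2 → L2} {v w : ℤ → ℤ → L2}
    (h : ∀ m q, 0 ≤ m → m ≤ n → v m q = w m q) : cubSum τ K v n p = cubSum τ K w n p := by
  refine Finset.sum_congr rfl fun x hx => ?_
  obtain ⟨⟨h1, h2⟩, ⟨h3, h4⟩, h5, h6⟩ := mem_triples_le hx
  rw [h _ _ h1 h2, h _ _ h3 h4, h _ _ h5 h6]

theorem cubSum_eq_zero {τ : L2 → L2 → L2 → L2} {v : ℤ → ℤ → L2} (hp : p ∉ harmonics (n + 2)) :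
    cubSum τ K v n p = 0 :=
  Finset.sum_eq_zero fun _ hx => absurd (mem_harmonics_of_mem_triples hx) hp

theorem tripleProd_eq_zero {f g h : L2} (H : f = 0 ∨ g = 0 ∨ h = 0) : tripleProd f g h = 0 := by
  rw [tripleProd]
  split_ifs with hm
  · rw [Lp.ext_iff]
    filter_upwards [hm.coeFn_toLp, Lp.coeFn_zero ℂ 2 (volume : Measure Plane)] with x h1 h2
    rw [h1, h2]
    rcases H with rfl | rfl | rfl <;> simp
  · rfl

theorem cubSum_odd {v : ℤ → ℤ → L2} (hn : Odd n) (hv : ∀ m q, Odd m → v m q = 0) :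
    cubSum tripleProd K v n p = 0 := by
  refine Finset.sum_eq_zero fun x hx => tripleProd_eq_zero ?_
  have h := (mem_triples.1 hx).2.1
  have h2 : Odd x.1.1 ∨ Odd x.2.1.1 ∨ Odd x.2.2.1 := by
    simp only [Int.odd_iff] at hn ⊢
    omega
  exact h2.imp (hv _ _) (Or.imp (hv _ _) (hv _ _))

theorem cubSum_neg {v : ℤ → ℤ → L2}
    (hv : ∀ m q, 0 ≤ m → m ≤ n → v m (-q) = star (v m q)) :
    cubSum tripleProd K v n (-p) = star (cubSum tripleProd K v n p) := by
  have hmem : ∀ p, ∀ x ∈ triples K n p,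
      (((x.1.1, -x.1.2), (x.2.1.1, -x.2.1.2), (x.2.2.1, -x.2.2.2)) :
        (ℤ × ℤ) × (ℤ × ℤ) × (ℤ × ℤ)) ∈ triples K n (-p) := by
    intro p x hx
    simp only [mem_triples, mem_indices, neg_mem_harmonics] at hx ⊢
    refine ⟨hx.1, hx.2.1, ?_⟩
    rw [← hx.2.2]
    ring
  rw [cubSum, cubSum, star_sum]
  refine Finset.sum_nbij' (fun x => ((x.1.1, -x.1.2), (x.2.1.1, -x.2.1.2), (x.2.2.1, -x.2.2.2)))
    (fun x => ((x.1.1, -x.1.2), (x.2.1.1, -x.2.1.2), (x.2.2.1, -x.2.2.2)))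
    (fun x hx => by simpa using hmem _ x hx) (hmem p) (fun x _ => by simp) (fun x _ => by simp)
    fun x hx => ?_
  obtain ⟨⟨h1, h2⟩, ⟨h3, h4⟩, h5, h6⟩ := mem_triples_le hx
  rw [star_tripleProd, ← hv _ _ h1 h2, ← hv _ _ h3 h4, ← hv _ _ h5 h6, neg_neg, neg_neg, neg_neg]

theorem cubSum_J (ha : 1 < a) (v : ℤ → ℤ → L2) :
    cubSum tripleProd K (fun m q => J a (v m q)) n p = J a (cubSum (tri a ha) K v n p) := by
  simp only [cubSum, tripleProd_J ha, map_sum]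

theorem Reg.cubSum {l : ℕ} (ha : 1 + 2 * l < a) {u : ℤ → ℤ → ℝ → L2}
    (hu : ∀ m q, 0 ≤ m → m ≤ n → Reg T l a (u m q)) :
    Reg T l a (fun t => cubSum KleinGordon.tripleProd K (fun m q => u m q t) n p) := by
  refine Reg.sum _ fun x hx => ?_
  obtain ⟨⟨h1, h2⟩, ⟨h3, h4⟩, h5, h6⟩ := mem_triples_le hx
  exact (hu _ _ h1 h2).tripleProd ha (hu _ _ h3 h4) (hu _ _ h5 h6)

/-! ### Forcing terms with at most linear growth -/

/-- `Λ(t, X)` is continuous, and globally Lipschitz in `X` locally uniformly in `t`. -/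
def LipForcing (T : ℝ≥0∞) (Λ : ℝ → L2 → L2) : Prop :=
  ContinuousOn (fun p : ℝ × L2 => Λ p.1 p.2) (timeIco T ×ˢ Set.univ) ∧
    ∀ t ∈ timeIco T, ∃ K : ℝ≥0, ∀ r ∈ Set.Icc 0 t, LipschitzWith K (Λ r)

theorem continuousOn_fst_timeIco {G : ℝ → L2} (hG : ContinuousOn G (timeIco T)) :
    ContinuousOn (fun p : ℝ × L2 => G p.1) (timeIco T ×ˢ Set.univ) :=
  hG.comp continuousOn_fst fun _ hp => hp.1

theorem LipForcing.const {G : ℝ → L2} (hG : ContinuousOn G (timeIco T)) :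
    LipForcing T (fun t _ => G t) :=
  ⟨continuousOn_fst_timeIco hG, fun _ _ => ⟨0, fun _ _ => LipschitzWith.const _⟩⟩

theorem LipForcing.id : LipForcing T (fun _ X => X) :=
  ⟨continuousOn_snd, fun _ _ => ⟨1, fun _ _ => LipschitzWith.id⟩⟩

theorem LipForcing.star : LipForcing T (fun _ X => Star.star X) :=
  ⟨continuous_star.comp_continuousOn continuousOn_snd, fun _ _ => ⟨1, fun _ _ =>
    LipschitzWith.of_dist_le_mul fun x y => by
      rw [dist_eq_norm, ← star_sub, norm_star, NNReal.coe_one, one_mul, dist_eq_norm]⟩⟩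

variable {Λ Λ' : ℝ → L2 → L2}

theorem LipForcing.add (h : LipForcing T Λ) (h' : LipForcing T Λ') :
    LipForcing T (fun t X => Λ t X + Λ' t X) := by
  refine ⟨h.1.add h'.1, fun t ht => ?_⟩
  obtain ⟨K, hK⟩ := h.2 t ht
  obtain ⟨K', hK'⟩ := h'.2 t ht
  exact ⟨K + K', fun r hr => (hK r hr).add (hK' r hr)⟩

theorem LipForcing.sum {ι : Type*} (s : Finset ι) {Λ : ι → ℝ → L2 → L2}
    (h : ∀ i ∈ s, LipForcing T (Λ i)) : LipForcing T (fun t X => ∑ i ∈ s, Λ i t X) := by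
  classical
  induction s using Finset.induction_on with
  | empty => simpa using LipForcing.const continuousOn_const
  | insert i s hi ih =>
    simp_rw [Finset.sum_insert hi]
    exact (h i (Finset.mem_insert_self i s)).add
      (ih fun j hj => h j (Finset.mem_insert_of_mem hj))

theorem LipForcing.bilinear (B : L2 →L[ℂ] L2 →L[ℂ] L2) (h : LipForcing T Λ) {G : ℝ → L2}
    (hG : ContinuousOn G (timeIco T)) : LipForcing T (fun t X => B (Λ t X) (G t)) := by
  refine ⟨?_, fun t ht => ?_⟩
  · exact (B.continuous.comp_continuousOn h.1).clm_apply (continuousOn_fst_timeIco hG)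
  · obtain ⟨K, hK⟩ := h.2 t ht
    obtain ⟨A, hA⟩ := isCompact_Icc.exists_bound_of_continuousOn (hG.mono (Icc_subset_timeIco ht))
    refine ⟨‖B‖₊ * K * A.toNNReal, fun r hr => LipschitzWith.of_dist_le_mul fun x y => ?_⟩
    rw [dist_eq_norm, ← sub_apply, ← map_sub]
    refine (B.le_opNorm₂ _ _).trans ?_
    have h1 := (hK r hr).dist_le_mul x y
    rw [dist_eq_norm] at h1
    have h2 := (hA r hr).trans (Real.le_coe_toNNReal A)
    calc ‖B‖ * ‖Λ r x - Λ r y‖ * ‖G r‖ ≤ ‖B‖ * (K * dist x y) * A.toNNReal := by gcongr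
      _ = _ := by push_cast; ring

theorem LipForcing.bilinear' (B : L2 →L[ℂ] L2 →L[ℂ] L2) (h : LipForcing T Λ) {G : ℝ → L2}
    (hG : ContinuousOn G (timeIco T)) : LipForcing T (fun t X => B (G t) (Λ t X)) :=
  h.bilinear B.flip hG

theorem LipForcing.smul (c : ℂ) (h : LipForcing T Λ) : LipForcing T (fun t X => c • Λ t X) := by
  refine ⟨h.1.const_smul c, fun t ht => ?_⟩
  obtain ⟨K, hK⟩ := h.2 t ht
  refine ⟨‖c‖₊ * K, fun r hr => LipschitzWith.of_dist_le_mul fun x y => ?_⟩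
  rw [dist_smul₀, NNReal.coe_mul, mul_assoc]
  exact mul_le_mul_of_nonneg_left ((hK r hr).dist_le_mul x y) (norm_nonneg c)

/-- In a cubic coefficient of order `n > 0`, the amplitudes of order `n` occur linearly. -/
theorem LipForcing.cubSum (ha : 1 < a) (hn : 0 < n) {V : ℤ → ℤ → ℝ → L2 → L2}
    (hV : ∀ q, LipForcing T (V n q)) {G : ℤ → ℤ → ℝ → L2}
    (hG : ∀ m q, 0 ≤ m → m < n → ContinuousOn (G m q) (timeIco T))
    (hVG : ∀ m q t X, m < n → V m q t X = G m q t) :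
    LipForcing T (fun t X => cubSum (tri a ha) K (fun m q => V m q t X) n p) := by
  refine LipForcing.sum _ fun x hx => ?_
  have hle := mem_triples_le hx
  have hsum := (mem_triples.1 hx).2.1
  obtain ⟨⟨n₁, p₁⟩, ⟨n₂, p₂⟩, ⟨n₃, p₃⟩⟩ := x
  dsimp only at hle hsum ⊢
  obtain ⟨⟨h1, h1'⟩, ⟨h2, h2'⟩, h3, h3'⟩ := hle
  have hlip : ∀ m q, 0 ≤ m → m ≤ n → LipForcing T (V m q) := fun m q hm hm' => by
    rcases hm'.lt_or_eq with h | rfl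
    · have : V m q = fun t _ => G m q t := by
        funext t X
        exact hVG m q t X h
      rw [this]
      exact .const (hG m q hm h)
    · exact hV q
  unfold tri
  -- As n > 0, at most one of the three orders equals n; the other two factors are fixed continuous
  -- coefficients.
  by_cases c1 : n₁ = n
  · have e2 : n₂ < n := by omega
    have e3 : n₃ < n := by omega
    simp_rw [hVG _ _ _ _ e2, hVG _ _ _ _ e3]
    exact ((hlip _ _ h1 h1').bilinear _ (hG _ _ h2 e2)).bilinear _ (hG _ _ h3 e3)
  · have e1 : n₁ < n := by omega
    simp_rw [hVG _ _ _ _ e1]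
    by_cases c2 : n₂ = n
    · have e3 : n₃ < n := by omega
      simp_rw [hVG _ _ _ _ e3]
      exact ((hlip _ _ h2 h2').bilinear' _ (hG _ _ h1 e1)).bilinear _ (hG _ _ h3 e3)
    · have e2 : n₂ < n := by omega
      simp_rw [hVG _ _ _ _ e2]
      refine (hlip _ _ h3 h3').bilinear' _ ?_
      have k1 := hG _ p₁ h1 e1
      have k2 := hG _ p₂ h2 e2
      fun_prop

end KleinGordon

end

/-! ### The scalar equation and partial expansions. -/

noncomputable section

open FourierTransform
open scoped NNReal

namespace KleinGordon

variable {T : ℝ≥0∞} {a lam s : ℝ} {K l : ℕ} {n p : ℤ} {u u' : ℤ → ℤ → ℝ → L2}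

/-! ### The residual operator of the expansion -/

theorem star_Lap (f : L2) : star (Lap f) = Lap (star f) := by
  rw [Lap, star_mulOp isSymbol_lapSymbol]
  congr 2
  ext ξ
  simp [lapSymbol, jSymbol]

theorem star_Dx (j : Fin 2) (f : L2) : star (Dx j f) = Dx j (star f) := by
  rw [Dx, star_mulOp (isSymbol_dxSymbol j)]
  congr 2
  ext ξ
  simp [dxSymbol, jSymbol, inner_neg_left]

theorem star_lap {u : ℝ → L2} (ha : 2 ≤ a) (hu : CS T a u) {t : ℝ} (ht : t ∈ timeIco T) :
    star (lap (u t)) = lap (star (u t)) := by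
  obtain ⟨G, -, h⟩ := hu
  rw [h t ht, lap_J ha, star_J (by linarith), star_J (by linarith), lap_J ha, star_Lap]

theorem star_dx {u : ℝ → L2} (j : Fin 2) (ha : 1 ≤ a) (hu : CS T a u) {t : ℝ}
    (ht : t ∈ timeIco T) : star (dx j (u t)) = dx j (star (u t)) := by
  obtain ⟨G, -, h⟩ := hu
  rw [h t ht, dx_J j ha, star_J (by linarith), star_J (by linarith), dx_J j ha, star_Dx]

theorem lap_zero : lap 0 = 0 := by
  have := lap_J le_rfl 0
  rwa [map_zero, map_zero, map_zero] at this

theorem dx_zero (j : Fin 2) : dx j 0 = 0 := by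
  have := dx_J j le_rfl 0
  rwa [map_zero, map_zero, map_zero] at this

theorem dt_zero : dt (fun _ => 0) = fun _ => 0 := by
  funext t
  simp [dt]

theorem dt_star {u v : ℝ → L2} (ha : 2 ≤ a) (hu : Reg T 1 a u)
    (h : ∀ t ∈ timeIco T, v t = star (u t)) {t : ℝ} (ht : t ∈ timeIco T) :
    dt v t = star (dt u t) :=
  ((hu.ds_dt.star (by linarith)).congr (fun t ht => (h t ht).symm) fun _ _ => rfl).dt_eq ht

/-- The terms of order `n` that the amplitude `u_{n+2,p}` has to balance. -/
def src (lam : ℝ) (K : ℕ) (u : ℤ → ℤ → ℝ → L2) (n p : ℤ) (t : ℝ) : L2 :=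
  (2 * Complex.I * p) • dt (u n p) t - lap (u n p t) + dt (dt (u (n - 2) p)) t +
    (lam : ℂ) • cubSum tripleProd K (fun m q => u m q t) n p

theorem src_congr (h : ∀ m q, m ≤ n → u m q = u' m q) :
    src lam K u n p = src lam K u' n p := by
  funext t
  rw [src, src, h n p le_rfl, h (n - 2) p (by omega),
    cubSum_congr (w := fun m q => u' m q t) fun m q _ hm => by rw [h m q hm]]

theorem src_eq_zero (h1 : u n p = fun _ => 0) (h2 : u (n - 2) p = fun _ => 0)
    (hp : p ∉ harmonics (n + 2)) (t : ℝ) : src lam K u n p t = 0 := by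
  rw [src, h1, h2, dt_zero, dt_zero, lap_zero, cubSum_eq_zero hp]
  simp

/-- The regularity of the amplitudes of order `n`. -/
def RegFamily (T : ℝ≥0∞) (K : ℕ) (s : ℝ) (u : ℤ → ℤ → ℝ → L2) : Prop :=
  ∀ n p, 0 ≤ n → ∀ l : ℕ, (l : ℤ) + n ≤ K + 2 → Reg T l (s - 2 * n) (u n p)

theorem RegFamily.of_le (hu : RegFamily T K s u) (hn : 0 ≤ n) {α : ℝ} (hl : (l : ℤ) + n ≤ K + 2)
    (h1 : 2 * l ≤ α) (h2 : α ≤ s - 2 * n) : Reg T l α (u n p) :=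
  (hu n p hn l hl).mono_index h1 h2

theorem RegFamily.cubSum (hu : RegFamily T K s u) {α : ℝ}
    (h1 : 1 + 2 * l < α) (h2 : α ≤ s - 2 * n) (hl : (l : ℤ) + n ≤ K + 2) :
    Reg T l α (fun t => cubSum tripleProd K (fun m q => u m q t) n p) := by
  refine Reg.cubSum h1 fun m q hm hmn => hu.of_le hm (by omega) (by linarith) ?_
  have : (m : ℝ) ≤ n := by exact_mod_cast hmn
  linarith

/-- ∂_t u_n and Δu_n each cost two indices, while ∂_t² u_{n-2} still has index s - 2n. The cubic
term needs s - 2n - 2 > 1 + 2l, which for l + n ≤ K + 1 is supplied by s > 2K + 5. -/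
theorem reg_src (hs : 2 * (K : ℝ) + 5 < s) (hu : RegFamily T K s u) (hn : 0 ≤ n)
    (h0 : ∀ m q, m < 0 → u m q = fun _ => 0) (hl : (l : ℤ) + n ≤ K + 1) :
    Reg T l (s - 2 * n - 2) (src lam K u n p) := by
  have hl' : (l : ℝ) + n ≤ K + 1 := by exact_mod_cast hl
  have hl0 : (0 : ℝ) ≤ l := Nat.cast_nonneg l
  have hn' : (0 : ℝ) ≤ n := by exact_mod_cast hn
  have h1 := (hu n p hn (l + 1) (by push_cast; omega)).dt
  have h2 := (hu n p hn l (by omega)).lap (by linarith)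
  have h3 : Reg T l (s - 2 * n - 2) (dt (dt (u (n - 2) p))) := by
    by_cases hn2 : n - 2 < 0
    · rw [h0 _ _ hn2, dt_zero, dt_zero]
      exact .zero
    · have := (hu (n - 2) p (by omega) (l + 2) (by push_cast; omega)).dt.dt
      refine this.mono_index (by linarith) ?_
      push_cast
      linarith
  have h4 := hu.cubSum (n := n) (p := p) (α := s - 2 * n - 2) (l := l) (by linarith)
    (by linarith) (by omega)
  exact (((h1.smul _).sub h2).add h3).add (h4.smul _)

theorem src_neg (hs : 2 * (K : ℝ) + 5 < s) (hu : RegFamily T K s u) (hn : 0 ≤ n)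
    (hnK : n ≤ K) (h0 : ∀ m q, m < 0 → u m q = fun _ => 0)
    (hc : ∀ m q, m ≤ n → ∀ t ∈ timeIco T, u m (-q) t = star (u m q t)) {t : ℝ}
    (ht : t ∈ timeIco T) : src lam K u n (-p) t = star (src lam K u n p t) := by
  have hn' : (0 : ℝ) ≤ n := by exact_mod_cast hn
  have hnK' : (n : ℝ) ≤ K := by exact_mod_cast hnK
  have h1 := dt_star (by linarith) (hu n p hn 1 (by push_cast; omega)) (hc n p le_rfl) ht
  have h2 := star_lap (a := s - 2 * n) (by linarith) (hu n p hn 0 (by push_cast; omega)).cs ht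
  have h3 : dt (dt (u (n - 2) (-p))) t = star (dt (dt (u (n - 2) p)) t) := by
    by_cases hn2 : n - 2 < 0
    · rw [h0 _ _ hn2, h0 _ _ hn2, dt_zero, dt_zero, star_zero]
    · have hr := hu (n - 2) p (by omega) 2 (by push_cast; omega)
      refine dt_star (a := s - 2 * (n - 2 : ℤ) - 2) (by push_cast; linarith) hr.dt
        (fun r hr' => ?_) ht
      exact dt_star (by push_cast; linarith) hr.of_succ (hc _ p (by omega)) hr'
  have h4 := cubSum_neg (K := K) (n := n) (p := p) (v := fun m q => u m q t)
    fun m q _ hm => hc m q hm t ht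
  rw [src, src, h1, hc n p le_rfl t ht, ← h2, h3, h4]
  simp only [star_add, star_sub, star_smul]
  simp

/-! ### Partial expansions -/

/-- Amplitudes `u_{n,p}` of an approximate solution, constructed up to the order `n = N`. -/
structure IsExpansion (lam : ℝ) (K : ℕ) (T : ℝ≥0∞) (s : ℝ) (g : ℝ → L2) (N : ℤ)
    (u : ℤ → ℤ → ℝ → L2) : Prop where
  zero : ∀ n p, ¬ (0 ≤ n ∧ n ≤ N ∧ Even n ∧ p ∈ harmonics n) → u n p = fun _ => 0
  conj : ∀ n p, ∀ t ∈ timeIco T, u n (-p) t = star (u n p t)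
  reg : RegFamily T K s u
  lead : ∀ t ∈ timeIco T, u 0 1 t = g t
  -- While u_{N+2} is not yet available, order N contributes only the solvability condition at p =
  -- ±1, where 1 - p² vanishes.
  eqn : ∀ n p : ℤ, 0 ≤ n → n ≤ N → n ≤ K → Even n → (n + 2 ≤ N ∨ p = 1 ∨ p = -1) →
    ∀ t ∈ timeIco T, (1 - (p : ℂ) ^ 2) • u (n + 2) p t + src lam K u n p t = 0
  init : ∀ n, 2 ≤ n → n ≤ N → n ≤ K → Even n → ∑ p ∈ harmonics n, u n p 0 = 0 ∧
    ∑ p ∈ harmonics n, ((Complex.I * p) • u n p 0 + dt (u (n - 2) p) 0) = 0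
  -- At the last order the resonant amplitudes are unconstrained; choosing zero makes that order
  -- more regular.
  top : ∀ p, p = 1 ∨ p = -1 → u (K + 2) p = fun _ => 0

/-- A resonant pair of amplitudes `u_{±1}`. -/
def resonant (p : ℤ) (X : L2) : L2 := (if p = 1 then X else 0) + if p = -1 then star X else 0

theorem resonant_one (X : L2) : resonant 1 X = X := by simp [resonant]

theorem resonant_zero (p : ℤ) : resonant p 0 = 0 := by simp [resonant]

theorem resonant_of_ne (h1 : p ≠ 1) (h2 : p ≠ -1) (X : L2) : resonant p X = 0 := by
  simp [resonant, h1, h2]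

theorem resonant_neg (p : ℤ) (X : L2) : resonant (-p) X = star (resonant p X) := by
  rw [resonant, resonant, star_add, apply_ite star, apply_ite star, star_star, star_zero, add_comm]
  simp only [neg_neg, neg_eq_iff_eq_neg]

theorem resonant_J (ha : 0 ≤ a) (p : ℤ) (X : L2) : resonant p (J a X) = J a (resonant p X) := by
  rw [resonant, resonant, map_add, apply_ite (J a), apply_ite (J a), star_J ha, map_zero]

theorem sum_smul_resonant (hn : 0 ≤ n) (hne : Even n) (c : ℤ → ℂ) (X : L2) :
    ∑ p ∈ harmonics n, c p • resonant p X = c 1 • X + c (-1) • star X := by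
  have h1 : (1 : ℤ) ∈ harmonics n := by
    rw [mem_harmonics_even hne]
    exact ⟨by simpa using hn, odd_one⟩
  have h2 : (-1 : ℤ) ∈ harmonics n := neg_mem_harmonics.2 h1
  simp only [resonant, smul_add, Finset.sum_add_distrib, smul_ite, smul_zero,
    Finset.sum_ite_eq', h1, h2, if_true]

theorem Reg.resonant (ha : 2 * l ≤ a) {X : ℝ → L2} (hX : Reg T l a X) (p : ℤ) :
    Reg T l a (fun t => resonant p (X t)) := by
  unfold KleinGordon.resonant
  refine Reg.add ?_ ?_
  · split_ifs
    · exact hX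
    · exact .zero
  · split_ifs
    · exact hX.star ha
    · exact .zero

theorem LipForcing.resonant (p : ℤ) : LipForcing T (fun _ X => resonant p X) := by
  unfold KleinGordon.resonant
  refine LipForcing.add ?_ ?_
  · split_ifs
    · exact .id
    · exact .const continuousOn_const
  · split_ifs
    · exact .star
    · exact .const continuousOn_const

/-- The nonresonant amplitudes of order `n + 2`. -/
def nonresonant (lam : ℝ) (K : ℕ) (u : ℤ → ℤ → ℝ → L2) (n p : ℤ) (t : ℝ) : L2 :=
  ((p : ℂ) ^ 2 - 1)⁻¹ • src lam K u n p t

/-- Adjoining amplitudes of order `N + 2`. -/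
def extend (lam : ℝ) (K : ℕ) (N : ℤ) (u : ℤ → ℤ → ℝ → L2) (X : ℝ → L2) (n p : ℤ) (t : ℝ) : L2 :=
  if n = N + 2 then nonresonant lam K u N p t + resonant p (X t) else u n p t

theorem sq_sub_one_ne_zero (h1 : p ≠ 1) (h2 : p ≠ -1) : (p : ℂ) ^ 2 - 1 ≠ 0 := by
  intro h
  have h3 : (p : ℂ) ^ 2 = 1 := by linear_combination h
  rcases mul_self_eq_one_iff.1 ((sq _).symm.trans h3) with h | h
  · exact h1 (by exact_mod_cast h)
  · exact h2 (by exact_mod_cast h)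

end KleinGordon

end

/-! ### The induction step for expansions. -/

noncomputable section

open FourierTransform
open scoped NNReal

namespace KleinGordon

variable {T : ℝ≥0∞} {a lam s : ℝ} {K l : ℕ} {n p N : ℤ} {u u' : ℤ → ℤ → ℝ → L2} {g X : ℝ → L2}

/-! ### Extension of an expansion by one order -/

theorem extend_of_le (hn : n ≤ N) : extend lam K N u X n p = u n p := by
  funext t
  rw [extend, if_neg (by omega)]

theorem extend_self (t : ℝ) : extend lam K N u X (N + 2) p t =
    nonresonant lam K u N p t + resonant p (X t) := by
  rw [extend, if_pos rfl]

theorem extend_of_ne (hn : n ≠ N + 2) : extend lam K N u X n p = u n p := by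
  funext t
  rw [extend, if_neg hn]

theorem src_extend (hn : n ≤ N) : src lam K (extend lam K N u X) n p = src lam K u n p :=
  src_congr fun _ _ hm => extend_of_le (hm.trans hn)

/-- The convention 0⁻¹ = 0 removes the resonant harmonics, so `extend` can add the two parts without
case distinction. -/
theorem nonresonant_one (hp : p = 1 ∨ p = -1) : nonresonant lam K u n p = fun _ => 0 := by
  funext t
  rw [nonresonant]
  rcases hp with rfl | rfl <;> simp

theorem IsExpansion.zero_of_neg (h : IsExpansion lam K T s g N u) (m q : ℤ) (hm : m < 0) :
    u m q = fun _ => 0 := h.zero m q (by omega)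

theorem IsExpansion.nonresonant_zero (h : IsExpansion lam K T s g N u)
    (hNe : Even N) (hp : p ∉ harmonics (N + 2)) : nonresonant lam K u N p = fun _ => 0 := by
  funext t
  have hk : ∀ m, m ≤ N → u m p = fun _ => 0 := fun m hm => h.zero m p fun h1 => hp <| by
    rw [mem_harmonics_even (hNe.add even_two)]
    have h2 := (mem_harmonics_even h1.2.2.1).1 h1.2.2.2
    exact ⟨by linarith [h2.1], h2.2⟩
  rw [nonresonant, src_eq_zero (hk _ le_rfl) (hk _ (by omega)) hp, smul_zero]

theorem IsExpansion.nonresonant_neg (hs : 2 * (K : ℝ) + 5 < s) (h : IsExpansion lam K T s g N u)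
    (hN : 0 ≤ N) (hNK : N ≤ K) (p : ℤ) {t : ℝ} (ht : t ∈ timeIco T) :
    nonresonant lam K u N (-p) t = star (nonresonant lam K u N p t) := by
  rw [nonresonant, nonresonant,
    src_neg hs h.reg hN hNK h.zero_of_neg (fun m q _ => h.conj m q) ht, star_smul]
  simp

theorem IsExpansion.reg_nonresonant (hs : 2 * (K : ℝ) + 5 < s) (h : IsExpansion lam K T s g N u)
    (hN : 0 ≤ N) (hl : (l : ℤ) + N ≤ K + 1) :
    Reg T l (s - 2 * N - 2) (nonresonant lam K u N p) :=
  (reg_src hs h.reg hN h.zero_of_neg hl).smul _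

/-- `heq` is the solvability condition at order N + 2. `hinit` solves X + X̄ = -A, i(X - X̄) = -B,
where A and B are the initial values of u and v produced by the nonresonant part and by ∂_t u_N.
Both are required only for N + 2 ≤ K; the closing step N = K takes X = 0. -/
theorem IsExpansion.extend (hs : 2 * (K : ℝ) + 5 < s) (hT : 0 < T) (hN : 0 ≤ N) (hNe : Even N)
    (hNK : N ≤ K) (h : IsExpansion lam K T s g N u)
    (hX : ∀ l : ℕ, (l : ℤ) + (N + 2) ≤ K + 2 → Reg T l (s - 2 * (N + 2)) X)
    (heq : N + 2 ≤ K → ∀ t ∈ timeIco T, src lam K (extend lam K N u X) (N + 2) 1 t = 0)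
    (hinit : N + 2 ≤ K → X 0 = (1 / 2 : ℂ) • (-(∑ p ∈ harmonics (N + 2), nonresonant lam K u N p 0) +
      Complex.I • ∑ p ∈ harmonics (N + 2),
        ((Complex.I * p) • nonresonant lam K u N p 0 + dt (u N p) 0)))
    (htop : N = K → X = fun _ => 0) :
    IsExpansion lam K T s g (N + 2) (extend lam K N u X) := by
  have hN2e : Even (N + 2) := hNe.add even_two
  have hone : (1 : ℤ) ∈ harmonics (N + 2) := by
    rw [mem_harmonics_even hN2e, abs_one]
    exact ⟨by omega, odd_one⟩
  have hzero : ∀ n p, ¬ (0 ≤ n ∧ n ≤ N + 2 ∧ Even n ∧ p ∈ harmonics n) →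
      KleinGordon.extend lam K N u X n p = fun _ => 0 := by
    intro n p hnp
    by_cases hn : n = N + 2
    · subst hn
      have hp : p ∉ harmonics (N + 2) := fun hp => hnp ⟨by omega, le_rfl, hN2e, hp⟩
      funext t
      rw [extend_self, h.nonresonant_zero hNe hp, resonant_of_ne, add_zero]
      · rintro rfl
        exact hp hone
      · rintro rfl
        exact hp (neg_mem_harmonics.2 hone)
    · rw [extend_of_ne hn]
      exact h.zero n p fun h1 => hnp ⟨h1.1, by omega, h1.2.2⟩
  have hconj : ∀ n p, ∀ t ∈ timeIco T, KleinGordon.extend lam K N u X n (-p) t =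
      star (KleinGordon.extend lam K N u X n p t) := by
    intro n p t ht
    by_cases hn : n = N + 2
    · subst hn
      rw [extend_self, extend_self, h.nonresonant_neg hs hN hNK p ht, resonant_neg, star_add]
    · rw [extend_of_ne hn, extend_of_ne hn, h.conj n p t ht]
  have hreg : RegFamily T K s (KleinGordon.extend lam K N u X) := by
    intro n p hn0 l hl
    by_cases hn : n = N + 2
    · subst hn
      have hl' : (l : ℝ) + (N + 2) ≤ K + 2 := by exact_mod_cast hl
      have hN' : (0 : ℝ) ≤ N := by exact_mod_cast hN
      have hb : 2 * (l : ℝ) ≤ s - 2 * ((N + 2 : ℤ) : ℝ) := by push_cast; linarith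
      have h1 := (h.reg_nonresonant (p := p) hs hN (l := l) (by omega)).mono_index hb
        (by push_cast; linarith)
      have h2 := hX l hl
      push_cast at hb h1 ⊢
      exact (h1.add (h2.resonant hb p)).congr fun t _ => (extend_self t).symm
    · rw [extend_of_ne hn]
      exact h.reg n p hn0 l hl
  refine ⟨hzero, hconj, hreg, ?_, ?_, ?_, ?_⟩
  · intro t ht
    rw [extend_of_le hN]
    exact h.lead t ht
  · intro n p hn hnN hnK hne hor t ht
    have hsq : p = 1 ∨ p = -1 → (1 - (p : ℂ) ^ 2) = 0 := by rintro (rfl | rfl) <;> simp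
    by_cases hn2 : n = N + 2
    · subst hn2
      have hor' : p = 1 ∨ p = -1 := hor.resolve_left (by omega)
      rw [hsq hor', zero_smul, zero_add]
      rcases hor' with rfl | rfl
      · exact heq hnK t ht
      · rw [src_neg hs hreg hn hnK (fun m q hm => hzero m q (by omega)) (fun m q _ => hconj m q) ht,
          heq hnK t ht, star_zero]
    · have hnN' : n ≤ N := by
        obtain ⟨i, hi⟩ := hne
        obtain ⟨j, hj⟩ := hNe
        omega
      rw [src_extend hnN']
      by_cases hp : p = 1 ∨ p = -1
      · have := h.eqn n p hn hnN' hnK hne (Or.inr hp) t ht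
        rw [hsq hp, zero_smul] at this ⊢
        exact this
      · have hp' := not_or.1 hp
        rcases eq_or_ne n N with rfl | hnN2
        · have hne0 := sq_sub_one_ne_zero hp'.1 hp'.2
          have hm1 : (1 - (p : ℂ) ^ 2) * ((p : ℂ) ^ 2 - 1)⁻¹ = -1 := by
            rw [← neg_sub, neg_mul, mul_inv_cancel₀ hne0]
          rw [extend_self, resonant_of_ne hp'.1 hp'.2, add_zero, nonresonant, smul_smul, hm1,
            neg_one_smul, neg_add_cancel]
        · have hnN3 : n + 2 ≤ N := by
            obtain ⟨i, hi⟩ := hne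
            obtain ⟨j, hj⟩ := hNe
            omega
          rw [extend_of_le hnN3]
          exact h.eqn n p hn hnN' hnK hne (Or.inl hnN3) t ht
  · intro n hn hnN hnK hne
    by_cases hn2 : n = N + 2
    · subst hn2
      have h0 := zero_mem_timeIco hT
      have hX0 := hinit hnK
      set A := ∑ p ∈ harmonics (N + 2), nonresonant lam K u N p 0
      set B := ∑ p ∈ harmonics (N + 2),
        ((Complex.I * p) • nonresonant lam K u N p 0 + dt (u N p) 0)
      -- A and B are real because p ↦ -p permutes the harmonics and conjugates the summands; so -A/2
      -- and B/2 are the real and imaginary parts of X 0.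
      have hA : star A = A := by
        rw [star_sum, ← sum_harmonics_neg]
        exact Finset.sum_congr rfl fun p _ => by
          rw [h.nonresonant_neg hs hN hNK p h0, star_star]
      have hN' : (0 : ℝ) ≤ N := by exact_mod_cast hN
      have hNK' : (N : ℝ) ≤ K := by exact_mod_cast hNK
      have hB : star B = B := by
        rw [star_sum, ← sum_harmonics_neg]
        refine Finset.sum_congr rfl fun p _ => ?_
        rw [h.nonresonant_neg hs hN hNK p h0, dt_star (a := s - 2 * N) (by linarith)
          (h.reg N p hN 1 (by push_cast; omega)) (h.conj N p) h0, star_add, star_smul, star_star,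
          star_star]
        simp
      have hX0' : star (X 0) = (1 / 2 : ℂ) • (-A - Complex.I • B) := by
        rw [hX0, star_smul, star_add, star_neg, star_smul, hA, hB]
        simp [sub_eq_add_neg]
      have e1 : ∀ p, KleinGordon.extend lam K N u X (N + 2) p 0 =
          nonresonant lam K u N p 0 + resonant p (X 0) := fun p => extend_self 0
      have e2 : ∀ p, KleinGordon.extend lam K N u X (N + 2 - 2) p = u N p := fun p => by
        rw [add_sub_cancel_right, extend_of_le le_rfl]
      constructor
      · simp_rw [e1]
        have := sum_smul_resonant (by omega) hN2e (fun _ => 1) (X 0)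
        simp only [one_smul] at this
        rw [Finset.sum_add_distrib, this, hX0', hX0]
        module
      · simp_rw [e1, e2, smul_add, add_right_comm]
        rw [Finset.sum_add_distrib, sum_smul_resonant (by omega) hN2e (fun p => Complex.I * p),
          hX0', hX0]
        have hI : Complex.I * Complex.I = -1 := Complex.I_mul_I
        simp only [smul_add, smul_sub, smul_neg, smul_smul]
        push_cast
        have c1 : Complex.I * 1 * (1 / 2 * Complex.I) = -(1 / 2) := by linear_combination hI / 2
        have c2 : Complex.I * -1 * (1 / 2 * Complex.I) = 1 / 2 := by linear_combination -hI / 2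
        rw [c1, c2]
        change B + _ = 0
        module
    · have hnN' : n ≤ N := by
        obtain ⟨i, hi⟩ := hne
        obtain ⟨j, hj⟩ := hNe
        omega
      simp_rw [extend_of_le hnN', extend_of_le (show n - 2 ≤ N by omega)]
      exact h.init n hn hnN' hnK hne
  · intro p hp
    by_cases hNK2 : N = K
    · funext t
      rw [← hNK2, extend_self, nonresonant_one hp, htop hNK2, resonant_zero, add_zero]
    · rw [extend_of_ne (by omega)]
      exact h.top p hp

end KleinGordon

end

/-! ### Resonant amplitudes, and the induction. -/

noncomputable section

open FourierTransform
open scoped NNReal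

namespace KleinGordon

variable {T : ℝ≥0∞} {a lam s : ℝ} {K l : ℕ} {n p N : ℤ} {u u' : ℤ → ℤ → ℝ → L2} {g X : ℝ → L2}

/-! ### Existence of expansions -/

theorem CS.exists_eq {v : ℝ → L2} (h : CS T a v) {t : ℝ} (ht : t ∈ timeIco T) :
    ∃ Z, v t = J a Z := ⟨_, h.choose_spec.2 t ht⟩

/-- At p = 1, `src` = 0 is a Schrödinger equation for X with forcing affine in X and X̄. The worst
forcing term is ∂_t² u_{N,1}, in H^{s-2(N+2)}, which dictates the index a. -/
theorem IsExpansion.exists_resonant (hs : 2 * (K : ℝ) + 5 < s) (hT : 0 < T) (hN : 0 ≤ N)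
    (hNK : N + 2 ≤ K) (h : IsExpansion lam K T s g N u) :
    ∃ X : ℝ → L2, (∀ l : ℕ, (l : ℤ) + (N + 2) ≤ K + 2 → Reg T l (s - 2 * (N + 2)) X) ∧
      (∀ t ∈ timeIco T, src lam K (KleinGordon.extend lam K N u X) (N + 2) 1 t = 0) ∧
      X 0 = (1 / 2 : ℂ) • (-(∑ p ∈ harmonics (N + 2), nonresonant lam K u N p 0) +
        Complex.I • ∑ p ∈ harmonics (N + 2),
          ((Complex.I * p) • nonresonant lam K u N p 0 + dt (u N p) 0)) := by
  have hN' : (0 : ℝ) ≤ N := by exact_mod_cast hN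
  have hNK' : (N : ℝ) + 2 ≤ K := by exact_mod_cast hNK
  obtain ⟨a, ha⟩ : ∃ a : ℝ, a = s - 2 * (N + 2) := ⟨_, rfl⟩
  have ha5 : 5 < a := by linarith
  have ha1 : 1 < a := by linarith
  have ha0 : 0 ≤ a := by linarith
  rw [← ha]
  have hu : ∀ l : ℕ, (l : ℤ) + (N + 2) ≤ K + 2 → ∀ m q, Reg T l a (u m q) := by
    intro l hl m q
    have hl' : (l : ℝ) + (N + 2) ≤ K + 2 := by exact_mod_cast hl
    by_cases hm : 0 ≤ m ∧ m ≤ N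
    · have hm' : (m : ℝ) ≤ N := by exact_mod_cast hm.2
      exact h.reg.of_le hm.1 (by omega) (by linarith) (by linarith)
    · rw [h.zero m q (by tauto)]
      exact .zero
  have hw : ∀ l : ℕ, (l : ℤ) + (N + 2) ≤ K + 2 → ∀ q, Reg T l a (nonresonant lam K u N q) := by
    intro l hl q
    have hl' : (l : ℝ) + (N + 2) ≤ K + 2 := by exact_mod_cast hl
    exact (h.reg_nonresonant hs hN (by omega)).mono_index (by linarith) (by linarith)
  have hdd : ∀ l : ℕ, (l : ℤ) + (N + 2) ≤ K + 2 → Reg T l a (dt (dt (u N 1))) := by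
    intro l hl
    have hl' : (l : ℝ) + (N + 2) ≤ K + 2 := by exact_mod_cast hl
    exact (h.reg N 1 hN (l + 2) (by push_cast; omega)).dt.dt.mono_index (by linarith) (by linarith)
  obtain ⟨Z₀, hZ₀⟩ : ∃ Z₀, (1 / 2 : ℂ) • (-(∑ p ∈ harmonics (N + 2), nonresonant lam K u N p 0) +
        Complex.I • ∑ p ∈ harmonics (N + 2),
          ((Complex.I * p) • nonresonant lam K u N p 0 + dt (u N p) 0)) = J a Z₀ := by
    have hl : ((0 : ℕ) : ℤ) + (N + 2) ≤ K + 2 := by push_cast; omega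
    have h1 : Reg T 0 a (fun t => (1 / 2 : ℂ) •
        (-(∑ p ∈ harmonics (N + 2), nonresonant lam K u N p t) +
        Complex.I • ∑ p ∈ harmonics (N + 2),
          ((Complex.I * p) • nonresonant lam K u N p t + dt (u N p) t))) :=
      (((Reg.sum _ fun q _ => hw 0 hl q).neg.add ((Reg.sum _ fun q _ =>
        ((hw 0 hl q).smul _).add ((h.reg N q hN 1 (by push_cast; omega)).dt.mono_index
          (by push_cast; linarith) (by linarith))).smul _)).smul _)
    exact h1.cs.exists_eq (zero_mem_timeIco hT)
  rw [hZ₀]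
  have hl0 : ((0 : ℕ) : ℤ) + (N + 2) ≤ K + 2 := by push_cast; omega
  choose Gu hGuc hGu using fun m q => (hu 0 hl0 m q).cs
  choose Gw hGwc hGw using fun q => (hw 0 hl0 q).cs
  obtain ⟨Gd, hGdc, hGd⟩ := (hdd 0 hl0).cs
  -- The amplitudes with the unknown Y inserted at the resonant places of order N + 2: `V` in H^a,
  -- and `VG` the same read on `L2`.
  let V : ℤ → ℤ → ℝ → L2 → L2 := fun m q t Y =>
    if m = N + 2 then nonresonant lam K u N q t + resonant q Y else u m q t
  let VG : ℤ → ℤ → ℝ → L2 → L2 := fun m q t Y =>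
    if m = N + 2 then Gw q t + resonant q Y else Gu m q t
  let Ψ : ℝ → L2 → L2 := fun t Y => (Complex.I / 2) •
    (dt (dt (u N 1)) t + (lam : ℂ) • cubSum tripleProd K (fun m q => V m q t Y) (N + 2) 1)
  let Λ : ℝ → L2 → L2 := fun t Y => (Complex.I / 2) •
    (Gd t + (lam : ℂ) • cubSum (tri a ha1) K (fun m q => VG m q t Y) (N + 2) 1)
  have hΛ : LipForcing T Λ := by
    refine LipForcing.smul _ ((LipForcing.const hGdc).add (LipForcing.smul _ ?_))
    refine LipForcing.cubSum ha1 (by omega) (G := Gu) (fun q => ?_) (fun m q _ _ => hGuc m q)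
      fun m q t Y hm => if_neg hm.ne
    simp only [VG, if_true]
    exact (LipForcing.const (hGwc q)).add (.resonant q)
  have hΨ : ∀ t ∈ timeIco T, ∀ Y, Ψ t (J a Y) = J a (Λ t Y) := by
    intro t ht Y
    have hV : (fun m q => V m q t (J a Y)) = fun m q => J a (VG m q t Y) := by
      funext m q
      simp only [V, VG]
      split_ifs
      · rw [hGw q t ht, resonant_J ha0, map_add]
      · exact hGu m q t ht
    simp only [Ψ, Λ]
    rw [hV, cubSum_J ha1, hGd t ht, ← map_smul, ← map_add, ← map_smul]
  obtain ⟨X, hX0, hXc, hXd⟩ := exists_linear_schrodinger (by linarith) hT hΛ.1 hΛ.2 hΨ Z₀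
  have hVX : ∀ t, (fun m q => V m q t (X t)) = fun m q => KleinGordon.extend lam K N u X m q t :=
    fun _ => rfl
  have hreg : ∀ l : ℕ, (l : ℤ) + (N + 2) ≤ K + 2 → Reg T l a X := by
    intro l hl
    have hl' : (l : ℝ) + (N + 2) ≤ K + 2 := by exact_mod_cast hl
    -- The forcing contains X itself, so its k time derivatives are available once X has k of them.
    refine reg_of_schrodinger (by linarith) hXc hXd fun k hk hXk => ?_
    have hk1 : (k : ℝ) + 1 ≤ l := by exact_mod_cast hk
    have hkl : (k : ℤ) + (N + 2) ≤ K + 2 := by omega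
    have h1 : Reg T k a (fun t =>
        cubSum tripleProd K (fun m q => KleinGordon.extend lam K N u X m q t) (N + 2) 1) := by
      refine Reg.cubSum (by linarith) fun m q _ _ => ?_
      by_cases hm : m = N + 2
      · subst hm
        exact ((hw k hkl q).add (hXk.resonant (by linarith) q)).congr
          fun t _ => (extend_self t).symm
      · rw [extend_of_ne hm]
        exact hu k hkl m q
    exact ((((hdd k hkl).add (h1.smul _)).smul _).mono_index (by linarith) (by linarith))
  refine ⟨X, hreg, fun t ht => ?_, hX0⟩
  have hX1 : KleinGordon.extend lam K N u X (N + 2) 1 = X := by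
    funext t
    rw [extend_self, nonresonant_one (Or.inl rfl), resonant_one, zero_add]
  rw [src, hX1, add_sub_cancel_right, extend_of_le le_rfl, hXd.dt_eq ht]
  simp only [Ψ, hVX, smul_add, smul_smul]
  have e1 : 2 * Complex.I * (1 : ℤ) * (-Complex.I / 2) = 1 := by
    push_cast
    linear_combination -Complex.I_mul_I
  have e2 : 2 * Complex.I * (1 : ℤ) * (Complex.I / 2) = -1 := by
    push_cast
    linear_combination Complex.I_mul_I
  have e3 : 2 * Complex.I * (1 : ℤ) * (Complex.I / 2 * lam) = -lam := by
    push_cast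
    linear_combination lam * Complex.I_mul_I
  rw [e1, e2, e3]
  module

open Classical in
theorem tripleProd_congr {f g h f' g' h' : L2}
    (H : ∀ x : Plane, f x * g x * h x = f' x * g' x * h' x) :
    tripleProd f g h = tripleProd f' g' h' := by
  have key : ∀ F G : Plane → ℂ, F = G → (if H : MemLp F 2 volume then H.toLp F else 0 : L2) =
      if H : MemLp G 2 volume then H.toLp G else 0 := by
    rintro F _ rfl
    rfl
  exact key _ _ (funext H)

theorem tripleProd_comm₁₂ (f g h : L2) : tripleProd f g h = tripleProd g f h :=
  tripleProd_congr fun _ => by ring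

theorem tripleProd_comm₂₃ (f g h : L2) : tripleProd f g h = tripleProd f h g :=
  tripleProd_congr fun _ => by ring

/-- Three signs with sum 1 contain exactly one -1; its three positions give the factor 3 of the
cubic equation. -/
theorem triples_zero_one : triples K 0 1 =
    {((0, 1), (0, 1), (0, -1)), ((0, 1), (0, -1), (0, 1)), ((0, -1), (0, 1), (0, 1))} := by
  ext ⟨⟨n₁, p₁⟩, ⟨n₂, p₂⟩, ⟨n₃, p₃⟩⟩
  simp only [mem_triples, mem_indices, Finset.mem_Icc, mem_harmonics, maxHarmonic, Finset.mem_insert,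
    Finset.mem_singleton, Prod.mk.injEq, abs_le]
  constructor
  · rintro ⟨⟨⟨⟨h1, -⟩, h2, h3⟩, ⟨⟨k1, -⟩, k2, k3⟩, ⟨⟨l1, -⟩, l2, l3⟩⟩, e1, e2⟩
    obtain rfl : n₁ = 0 := by omega
    obtain rfl : n₂ = 0 := by omega
    obtain rfl : n₃ = 0 := by omega
    simp only [Even.zero, if_true, Int.odd_iff] at h2 h3 k2 k3 l2 l3
    obtain rfl | rfl : p₁ = 1 ∨ p₁ = -1 := by omega
    all_goals obtain rfl | rfl : p₂ = 1 ∨ p₂ = -1 := by omega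
    all_goals obtain rfl | rfl : p₃ = 1 ∨ p₃ = -1 := by omega
    all_goals simp at e2 ⊢
  · rintro (⟨⟨rfl, rfl⟩, ⟨rfl, rfl⟩, rfl, rfl⟩ | ⟨⟨rfl, rfl⟩, ⟨rfl, rfl⟩, rfl, rfl⟩ |
      ⟨⟨rfl, rfl⟩, ⟨rfl, rfl⟩, rfl, rfl⟩) <;> simp <;> omega

theorem cubSum_zero_one (v : ℤ → ℤ → L2) : cubSum tripleProd K v 0 1 =
    (3 : ℂ) • tripleProd (v 0 1) (v 0 1) (v 0 (-1)) := by
  rw [cubSum, triples_zero_one, Finset.sum_insert (by simp), Finset.sum_insert (by simp),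
    Finset.sum_singleton]
  dsimp only
  rw [tripleProd_comm₂₃ (v 0 1) (v 0 (-1)), tripleProd_comm₁₂ (v 0 (-1)),
    tripleProd_comm₂₃ (v 0 1) (v 0 (-1))]
  module

/-- The leading amplitudes. -/
def leading (g : ℝ → L2) (n p : ℤ) (t : ℝ) : L2 := if n = 0 then resonant p (g t) else 0

/-- At order 0 the solvability condition for p = 1 is exactly the Schrödinger equation for g, and p
= -1 is its conjugate. -/
theorem isExpansion_zero (hs : 2 * (K : ℝ) + 5 < s)
    (hg : CS T s g) (hd : DS T (s - 2) g (fun t => (-Complex.I / 2) • lap (g t) +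
      (Complex.I / 2 * (3 * lam)) • tripleProd (g t) (g t) (star (g t)))) :
    IsExpansion lam K T s g 0 (leading g) := by
  have hK0 : (0 : ℝ) ≤ K := Nat.cast_nonneg K
  have hne : ∀ n p, n ≠ 0 → leading g n p = fun _ => 0 := fun n p hn => by
    funext t
    exact if_neg hn
  have hz : ∀ p, leading g 0 p = fun t => resonant p (g t) := fun p => by
    funext t
    exact if_pos rfl
  have hz' : ∀ p t, leading g 0 p t = resonant p (g t) := fun p t => if_pos rfl
  have hzero : ∀ n p, ¬ (0 ≤ n ∧ n ≤ 0 ∧ Even n ∧ p ∈ harmonics n) →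
      leading g n p = fun _ => 0 := by
    intro n p h
    by_cases hn : n = 0
    · subst hn
      have h1 : (1 : ℤ) ∈ harmonics 0 := by
        rw [mem_harmonics_even Even.zero]
        exact ⟨by simp, odd_one⟩
      have hp : p ∉ harmonics 0 := fun hp => h ⟨le_rfl, le_rfl, Even.zero, hp⟩
      rw [hz]
      funext t
      refine resonant_of_ne ?_ ?_ _
      · rintro rfl
        exact hp h1
      · rintro rfl
        exact hp (neg_mem_harmonics.2 h1)
    · exact hne n p hn
  have hconj : ∀ n p, ∀ t ∈ timeIco T, leading g n (-p) t = star (leading g n p t) := by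
    intro n p t _
    by_cases hn : n = 0
    · subst hn
      rw [hz', hz', resonant_neg]
    · rw [hne n _ hn, hne n _ hn, star_zero]
  have hreg : RegFamily T K s (leading g) := by
    intro n p hn l hl
    by_cases hn : n = 0
    · subst hn
      have hl' : (l : ℝ) ≤ K + 2 := by exact_mod_cast (by simpa using hl : (l : ℤ) ≤ K + 2)
      rw [hz]
      have := (reg_nls (L := l) (by linarith) hg hd).resonant (by linarith) p
      simpa using this
    · rw [hne n p hn]
      exact .zero
  refine ⟨hzero, hconj, hreg, fun t _ => by rw [hz', resonant_one], ?_, fun n hn hn0 => by omega,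
    fun p _ => hne _ _ (by omega)⟩
  intro n p hn hn0 hnK _ hor t ht
  obtain rfl : n = 0 := by omega
  have h1 : src lam K (leading g) 0 1 t = 0 := by
    have hg1 : leading g 0 1 = g := by
      funext t
      rw [hz', resonant_one]
    rw [src, cubSum_zero_one, hne _ _ (by omega : (0 - 2 : ℤ) ≠ 0), dt_zero, dt_zero,
      show (-1 : ℤ) = -(1 : ℤ) from rfl, hconj 0 1 t ht, hg1, hd.dt_eq ht, smul_add, smul_smul,
      smul_smul, smul_smul]
    have e1 : 2 * Complex.I * (1 : ℤ) * (-Complex.I / 2) = 1 := by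
      push_cast
      linear_combination -Complex.I_mul_I
    have e2 : 2 * Complex.I * (1 : ℤ) * (Complex.I / 2 * (3 * lam)) = -(lam * 3) := by
      push_cast
      linear_combination 3 * lam * Complex.I_mul_I
    rw [e1, e2]
    module
  rcases hor.resolve_left (by omega) with rfl | rfl
  · rw [h1]
    simp
  · rw [src_neg hs hreg le_rfl hnK (fun m q hm => hne m q hm.ne) (fun m q _ => hconj m q) ht, h1]
    simp

/-- Induction over even N up to K with the resonant amplitudes solved for, then one closing step
from K to K + 2 with zero resonant part. -/
theorem exists_isExpansion (hs : 2 * (K : ℝ) + 5 < s) (hT : 0 < T) (hK : Even K)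
    (hg : CS T s g) (hd : DS T (s - 2) g (fun t => (-Complex.I / 2) • lap (g t) +
      (Complex.I / 2 * (3 * lam)) • tripleProd (g t) (g t) (star (g t)))) :
    ∃ u, IsExpansion lam K T s g (K + 2) u := by
  have key : ∀ m : ℕ, 2 * m ≤ K → ∃ u, IsExpansion lam K T s g ((2 * m : ℕ) : ℤ) u := by
    intro m
    induction m with
    | zero => exact fun _ => ⟨_, isExpansion_zero hs hg hd⟩
    | succ m ih =>
      intro hm
      obtain ⟨u, hu⟩ := ih (by omega)
      have he : Even ((2 * m : ℕ) : ℤ) := ⟨m, by push_cast; ring⟩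
      obtain ⟨X, h1, h2, h3⟩ := hu.exists_resonant hs hT (by omega) (by omega)
      refine ⟨_, (hu.extend hs hT (by omega) he (by omega) h1 (fun _ => h2) (fun _ => h3)
        (fun h => by omega) :)⟩
  obtain ⟨m, rfl⟩ := hK
  obtain ⟨u, hu⟩ := key m (by omega)
  rw [two_mul] at hu
  exact ⟨_, hu.extend (X := fun _ => 0) hs hT (by omega) ⟨m, by push_cast; ring⟩ le_rfl
    (fun _ _ => .zero) (fun h => by omega) (fun h => by omega) fun _ => rfl⟩

end KleinGordon

end

/-! ### Vector amplitudes and their regularity. -/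

noncomputable section

open FourierTransform
open scoped NNReal

namespace KleinGordon

variable {T : ℝ≥0∞} {a lam s : ℝ} {K l : ℕ} {n p N : ℤ} {u : ℤ → ℤ → ℝ → L2} {g : ℝ → L2}

/-! ### Linear operators on vectors of distributions -/

theorem partialX_add (j : Fin 2) (f h : 𝓢'(Plane, ℂ)) :
    partialX j (f + h) = partialX j f + partialX j h := LineDeriv.lineDerivOp_add _ f h

theorem partialX_smul (j : Fin 2) (c : ℂ) (f : 𝓢'(Plane, ℂ)) :
    partialX j (c • f) = c • partialX j f := LineDeriv.lineDerivOp_smul _ c f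

theorem partialX_zero (j : Fin 2) : partialX j 0 = 0 :=
  LineDeriv.lineDerivOp_zero _

theorem partialX_sum {ι : Type*} (j : Fin 2) (s : Finset ι) (f : ι → 𝓢'(Plane, ℂ)) :
    partialX j (∑ i ∈ s, f i) = ∑ i ∈ s, partialX j (f i) := LineDeriv.lineDerivOp_sum _ f s

theorem partialX_partialX (f : 𝓢'(Plane, ℂ)) :
    partialX 0 (partialX 0 f) + partialX 1 (partialX 1 f) = Δ f := by
  rw [TemperedDistribution.laplacian_eq_sum (EuclideanSpace.basisFun (Fin 2) ℝ), Fin.sum_univ_two]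
  simp [partialX]

/-- `A(∂_x)` as a linear map. -/
def opAₗ : (Fin 4 → 𝓢'(Plane, ℂ)) →ₗ[ℂ] (Fin 4 → 𝓢'(Plane, ℂ)) where
  toFun := opA
  map_add' U V := by
    ext1 i
    fin_cases i <;> simp [opA, partialX_add]
    abel
  map_smul' c U := by
    ext1 i
    fin_cases i <;> simp [opA, partialX_smul]
    exact (smul_zero (A := 𝓢'(Plane, ℂ)) c).symm

/-- `A₀` as a linear map. -/
def opA0ₗ : (Fin 4 → 𝓢'(Plane, ℂ)) →ₗ[ℂ] (Fin 4 → 𝓢'(Plane, ℂ)) where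
  toFun := opA0
  map_add' U V := by
    ext1 i
    fin_cases i <;> simp [opA0]
    abel
  map_smul' c U := by
    ext1 i
    fin_cases i <;> simp [opA0]
    all_goals exact (smul_zero (A := 𝓢'(Plane, ℂ)) c).symm

/-- `vecDist` as a linear map. -/
def vecDistₗ : (Fin 4 → L2) →ₗ[ℂ] (Fin 4 → 𝓢'(Plane, ℂ)) where
  toFun := vecDist
  map_add' U V := by
    ext1 i
    simp [vecDist]
  map_smul' c U := by
    ext1 i
    simp [vecDist]

theorem partialX_toDist {v : ℝ → L2} (j : Fin 2) (ha : 1 ≤ a) (hv : CS T a v) {t : ℝ}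
    (ht : t ∈ timeIco T) : partialX j (toDist (v t)) = toDist (dx j (v t)) := by
  obtain ⟨Z, hZ⟩ := hv.exists_eq ht
  rw [hZ, partialX_toDist_J j ha]

theorem laplacian_toDist {v : ℝ → L2} (ha : 2 ≤ a) (hv : CS T a v) {t : ℝ}
    (ht : t ∈ timeIco T) : Δ (toDist (v t)) = toDist (lap (v t)) := by
  obtain ⟨Z, hZ⟩ := hv.exists_eq ht
  rw [hZ, laplacian_toDist_J ha]

theorem DS.dx {v v' : ℝ → L2} (j : Fin 2) (ha : 1 ≤ a) (hv : DS T a v v') :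
    DS T (a - 1) (fun t => dx j (v t)) (fun t => dx j (v' t)) := by
  obtain ⟨G, G', h⟩ := hv
  refine ⟨fun t => Dx j (G t), fun t => Dx j (G' t), fun t ht => ?_⟩
  obtain ⟨h1, h2, h3⟩ := h t ht
  beta_reduce
  rw [h1, h2, dx_J j ha, dx_J j ha]
  exact ⟨rfl, rfl, hasDerivWithinAt_clm _ h3⟩

theorem dt_dx {v : ℝ → L2} (j : Fin 2) (ha : 3 ≤ a) (hv : Reg T 1 a v) {t : ℝ}
    (ht : t ∈ timeIco T) : dt (fun r => dx j (v r)) t = dx j (dt v t) :=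
  (hv.ds_dt.dx j (by linarith)).dt_eq ht

/-! ### Vector amplitudes -/

/-- The vector amplitudes `U_{n,p}` built from the scalar amplitudes `u_{n,p}`. -/
def amp (K : ℕ) (u : ℤ → ℤ → ℝ → L2) : Amplitudes := fun n p t =>
  -- Without the cutoff, orders K + 3 and K + 4 would still carry ∇u_{K+2} and ∂_t u_{K+2}.
  if n ≤ K + 2 then ![dx 0 (u (n - 1) p t), dx 1 (u (n - 1) p t),
    (Complex.I * p) • u n p t + dt (u (n - 2) p) t, u n p t] else 0

theorem amp_of_le (hn : n ≤ K + 2) (t : ℝ) : amp K u n p t =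
    ![dx 0 (u (n - 1) p t), dx 1 (u (n - 1) p t),
      (Complex.I * p) • u n p t + dt (u (n - 2) p) t, u n p t] := if_pos hn

theorem fCoeff_amp (lam : ℝ) (n p : ℤ) (t : ℝ) : fCoeff lam K (amp K u) n p t =
    (lam : ℂ) • cubSum tripleProd K (fun m q => u m q t) n p := by
  rw [fCoeff_eq]
  congr 1
  refine Finset.sum_congr rfl fun x hx => ?_
  simp only [mem_triples, mem_indices, Finset.mem_Icc] at hx
  beta_reduce
  rw [amp_of_le hx.1.1.1.2, amp_of_le hx.1.2.1.1.2, amp_of_le hx.1.2.2.1.2]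
  rfl

/-- No component leaves H_n: for odd n only w survives, and H_n = H_{n-1}; for even n, v also uses
harmonics from H_{n-2}, a subset of H_n. -/
theorem IsExpansion.amp_eq_zero {N : ℤ} (h : IsExpansion lam K T s g N u)
    (hn : ¬ (0 ≤ n ∧ n ≤ K + 2 ∧ p ∈ harmonics n)) : amp K u n p = fun _ => 0 := by
  funext t
  rw [amp]
  split_ifs with hnK
  · have hz : ∀ m, n - 2 ≤ m → m ≤ n → (m = n - 1 → Odd n) → u m p = fun _ => 0 := by
      intro m h1 h2 h3
      refine h.zero m p fun h4 => hn ⟨by omega, hnK, ?_⟩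
      have h5 := h4.2.2.2
      have h6 := h4.2.2.1
      simp only [mem_harmonics, maxHarmonic, Int.even_iff, Int.odd_iff] at h3 h5 h6 ⊢
      split_ifs at * <;> omega
    have hz1 : u n p = fun _ => 0 := hz n (by omega) le_rfl (by omega)
    have hz2 : u (n - 2) p = fun _ => 0 := hz (n - 2) le_rfl (by omega) (by omega)
    have hz3 : u (n - 1) p = fun _ => 0 := by
      by_cases ho : Odd n
      · exact hz (n - 1) (by omega) (by omega) fun _ => ho
      · refine h.zero (n - 1) p fun h4 => ?_
        have h6 := h4.2.2.1
        simp only [Int.even_iff, Int.odd_iff] at ho h6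
        omega
    rw [hz1, hz2, hz3, dt_zero]
    ext1 i
    fin_cases i <;> simp [dx_zero]
  · rfl

theorem IsExpansion.zero_of_odd {N : ℤ} (h : IsExpansion lam K T s g N u) (hn : Odd n) (p : ℤ) :
    u n p = fun _ => 0 := h.zero n p fun h1 => Int.not_even_iff_odd.2 hn h1.2.2.1

theorem IsExpansion.amp_conj (hs : 2 * (K : ℝ) + 5 < s) (h : IsExpansion lam K T s g (K + 2) u)
    (n p : ℤ) {t : ℝ} (ht : t ∈ timeIco T) (i : Fin 4) :
    amp K u n (-p) t i = star (amp K u n p t i) := by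
  by_cases hn : 0 ≤ n ∧ n ≤ K + 2
  · rw [amp_of_le hn.2, amp_of_le hn.2]
    have hdx : ∀ j, dx j (u (n - 1) (-p) t) = star (dx j (u (n - 1) p t)) := by
      intro j
      by_cases hn1 : n - 1 < 0
      · rw [h.zero_of_neg _ _ hn1, h.zero_of_neg _ _ hn1, dx_zero, star_zero]
      · have hn' : ((n - 1 : ℤ) : ℝ) ≤ K + 1 := by exact_mod_cast (by omega : n - 1 ≤ K + 1)
        rw [h.conj _ _ t ht, star_dx (a := s - 2 * (n - 1 : ℤ)) j (by linarith)
          (h.reg (n - 1) p (by omega) 0 (by push_cast; omega)).cs ht]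
    have hdt : dt (u (n - 2) (-p)) t = star (dt (u (n - 2) p) t) := by
      by_cases hn1 : n - 2 < 0
      · rw [h.zero_of_neg _ _ hn1, h.zero_of_neg _ _ hn1, dt_zero, star_zero]
      · have hn' : ((n - 2 : ℤ) : ℝ) ≤ K := by exact_mod_cast (by omega : n - 2 ≤ K)
        exact dt_star (a := s - 2 * (n - 2 : ℤ)) (by linarith)
          (h.reg (n - 2) p (by omega) 1 (by push_cast; omega)) (h.conj _ _) ht
    have hu := h.conj n p t ht
    fin_cases i
    · exact hdx 0
    · exact hdx 1
    · simp only [Fin.reduceFinMk, Matrix.cons_val]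
      rw [hdt, hu, star_add, star_smul]
      simp
    · exact hu
  · rw [h.amp_eq_zero (by tauto), h.amp_eq_zero (by tauto)]
    simp

theorem IsExpansion.reg_amp (hs : 2 * (K : ℝ) + 5 < s) (h : IsExpansion lam K T s g (K + 2) u)
    (hn : 0 ≤ n) (hl : (l : ℤ) + n ≤ K + 2) (p : ℤ) (i : Fin 4) :
    Reg T l (s - 2 * n) (fun t => amp K u n p t i) := by
  have hl' : (l : ℝ) + n ≤ K + 2 := by exact_mod_cast hl
  have hn' : (0 : ℝ) ≤ n := by exact_mod_cast hn
  have hl0 : (0 : ℝ) ≤ l := Nat.cast_nonneg l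
  simp_rw [amp_of_le (show n ≤ K + 2 by omega)]
  have hdx : ∀ j, Reg T l (s - 2 * n) (fun t => dx j (u (n - 1) p t)) := by
    intro j
    by_cases hn1 : n - 1 < 0
    · rw [h.zero_of_neg _ _ hn1]
      simpa only [dx_zero] using Reg.zero
    · have h1 := h.reg (n - 1) p (by omega) l (by omega)
      push_cast at h1
      exact (h1.dx j (by linarith)).mono_index (by linarith) (by linarith)
  have hdt : Reg T l (s - 2 * n) (dt (u (n - 2) p)) := by
    by_cases hn1 : n - 2 < 0
    · rw [h.zero_of_neg _ _ hn1, dt_zero]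
      exact .zero
    · have h1 := h.reg (n - 2) p (by omega) (l + 1) (by push_cast; omega)
      push_cast at h1
      exact h1.dt.mono_index (by linarith) (by linarith)
  have hu := h.reg n p hn l hl
  fin_cases i
  · exact hdx 0
  · exact hdx 1
  · exact (hu.smul _).add hdt
  · exact hu

/-- The amplitudes of the highest order are better than the generic ones. -/
theorem IsExpansion.reg_top (hs : 2 * (K : ℝ) + 5 < s) (hK : Even K)
    (h : IsExpansion lam K T s g (K + 2) u) (p : ℤ) :
    Reg T 1 (s - 2 * K - 2) (u (K + 2) p) := by
  by_cases hp : p = 1 ∨ p = -1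
  · rw [h.top p hp]
    exact .zero
  -- Having no resonant part, u_{K+2,p} is a multiple of `src` at order K, which has index s - 2K -
  -- 2 instead of s - 2K - 4.
  · have hp' := not_or.1 hp
    have hne := sq_sub_one_ne_zero hp'.1 hp'.2
    have h2 : Reg T 1 (s - 2 * (K : ℤ) - 2) (nonresonant lam K u K p) :=
      (reg_src hs h.reg (by omega) h.zero_of_neg (by push_cast; omega)).smul _
    refine Reg.congr (by simpa using h2) fun t ht => ?_
    have h3 := h.eqn K p (by omega) (by omega) le_rfl (by exact_mod_cast hK) (Or.inl le_rfl) t ht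
    have h4 : src lam K u K p t = ((p : ℂ) ^ 2 - 1) • u (K + 2) p t := by
      rw [← neg_sub, neg_smul]
      exact eq_neg_of_add_eq_zero_right h3
    rw [nonresonant, h4, smul_smul, inv_mul_cancel₀ hne, one_smul]

theorem IsExpansion.reg_amp_top (hs : 2 * (K : ℝ) + 5 < s) (hK : Even K)
    (h : IsExpansion lam K T s g (K + 2) u) (p : ℤ) (i : Fin 4) :
    Reg T 1 (s - 2 * K - 2) (fun t => amp K u (K + 2) p t i) := by
  simp_rw [amp_of_le (le_refl ((K : ℤ) + 2))]
  have hKe : Even (K : ℤ) := by exact_mod_cast hK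
  have hz : u (K + 2 - 1) p = fun _ => 0 := by
    refine h.zero_of_odd ?_ p
    obtain ⟨k, hk⟩ := hKe
    exact ⟨k, by omega⟩
  have h1 := h.reg_top hs hK p
  have h2 := (h.reg K p (by omega) 2 (by push_cast; omega)).dt
  simp only [Int.cast_natCast] at h2
  rw [hz, add_sub_cancel_right]
  fin_cases i
  · simpa [dx_zero] using Reg.zero
  · simpa [dx_zero] using Reg.zero
  · exact (h1.smul _).add h2
  · exact h1

/-- The scalar equations, for all orders and harmonics. -/
theorem IsExpansion.eqn_all (h : IsExpansion lam K T s g (K + 2) u) (hn : n ≤ K) (p : ℤ) {t : ℝ}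
    (ht : t ∈ timeIco T) : (1 - (p : ℂ) ^ 2) • u (n + 2) p t + src lam K u n p t = 0 := by
  rcases Int.even_or_odd n with he | ho
  · by_cases hn0 : 0 ≤ n
    · exact h.eqn n p hn0 (by omega) hn he (Or.inl (by omega)) t ht
    · have hc : cubSum tripleProd K (fun m q => u m q t) n p = 0 :=
        Finset.sum_eq_zero fun x hx => absurd (mem_triples_le hx).1 (by omega)
      rw [src, h.zero_of_neg n p (by omega), h.zero_of_neg (n - 2) p (by omega), dt_zero, dt_zero,
        lap_zero, hc]
      -- For n = -2 the equation reads (1 - p²) u_{0,p} = 0, which holds because u_0 has only the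
      -- harmonics ±1.
      by_cases hn2 : n + 2 = 0
      · by_cases hp : p = 1 ∨ p = -1
        · rcases hp with rfl | rfl <;> simp
        · rw [h.zero (n + 2) p]
          · simp
          · rintro ⟨-, -, h1, h2⟩
            rw [mem_harmonics_even h1, hn2, Int.odd_iff, abs_le] at h2
            omega
      · obtain ⟨k, hk⟩ := he
        rw [h.zero_of_neg (n + 2) p (by omega)]
        simp
  · rw [src, h.zero_of_odd ho, h.zero_of_odd (ho.add_even even_two), h.zero_of_odd (n := n - 2),
      dt_zero, dt_zero, lap_zero, cubSum_odd ho]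
    · simp
    · intro m q hm
      rw [h.zero_of_odd hm]
    · exact ho.sub_even even_two

end KleinGordon

end

/-! ### The WKB equations and the initial datum. -/

noncomputable section

open FourierTransform
open scoped NNReal

namespace KleinGordon

variable {T : ℝ≥0∞} {a lam s : ℝ} {K l : ℕ} {n p N : ℤ} {u : ℤ → ℤ → ℝ → L2} {g : ℝ → L2}

/-! ### The WKB equations -/

theorem IsExpansion.reg_le {N : ℤ} (h : IsExpansion lam K T s g N u) {α : ℝ}
    (hl : (l : ℤ) + n ≤ K + 2) (h1 : 2 * l ≤ α) (h2 : α ≤ s - 2 * n) : Reg T l α (u n p) := by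
  by_cases hn : 0 ≤ n
  · exact h.reg.of_le hn hl h1 h2
  · rw [h.zero_of_neg n p (by omega)]
    exact .zero

/-- The time derivatives of the vector amplitudes. -/
def ampD (K : ℕ) (u : ℤ → ℤ → ℝ → L2) (n p : ℤ) (t : ℝ) : Fin 4 → L2 :=
  fun i => dt (fun r => amp K u n p r i) t

/-- One index for all orders, so that every amplitude has a time derivative in H^{s-2K-4}. At order
K + 2, where `RegFamily` provides no time derivative, `reg_amp_top` is needed. -/
theorem IsExpansion.reg_amp_one (hs : 2 * (K : ℝ) + 5 < s) (hK : Even K)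
    (h : IsExpansion lam K T s g (K + 2) u) (n p : ℤ) (i : Fin 4) :
    Reg T 1 (s - 2 * K - 2) (fun t => amp K u n p t i) := by
  by_cases hn : 0 ≤ n ∧ n ≤ K + 2
  · rcases hn.2.lt_or_eq with h1 | rfl
    · have h2 : (n : ℝ) ≤ K + 1 := by exact_mod_cast (by omega : n ≤ K + 1)
      exact (h.reg_amp hs hn.1 (by push_cast; omega) p i).mono_index
        (by push_cast; linarith) (by linarith)
    · exact h.reg_amp_top hs hK p i
  · rw [h.amp_eq_zero (by tauto)]
    exact .zero

theorem IsExpansion.hasDerivAt_amp (hs : 2 * (K : ℝ) + 5 < s) (hK : Even K)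
    (h : IsExpansion lam K T s g (K + 2) u) (n p : ℤ) {t : ℝ} (ht : t ∈ timeIoo T) :
    HasDerivAt (amp K u n p) (ampD K u n p t) t :=
  hasDerivAt_pi.2 fun i => (h.reg_amp_one hs hK n p i).ds_dt.hasDerivAt ht

theorem IsExpansion.ampD_eq (hs : 2 * (K : ℝ) + 5 < s) (h : IsExpansion lam K T s g (K + 2) u)
    (hn : n ≤ K) {t : ℝ} (ht : t ∈ timeIco T) : ampD K u n p t =
      ![dx 0 (dt (u (n - 1) p) t), dx 1 (dt (u (n - 1) p) t),
        (Complex.I * p) • dt (u n p) t + dt (dt (u (n - 2) p)) t, dt (u n p) t] := by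
  have hn' : (n : ℝ) ≤ K := by exact_mod_cast hn
  have hr1 : Reg T 1 (s - 2 * K) (u (n - 1) p) :=
    h.reg_le (by push_cast; omega) (by push_cast; linarith) (by push_cast; linarith)
  have hr2 : Reg T 2 (s - 2 * K) (u (n - 2) p) :=
    h.reg_le (by push_cast; omega) (by push_cast; linarith) (by push_cast; linarith)
  have hr0 : Reg T 1 (s - 2 * K) (u n p) :=
    h.reg_le (by push_cast; omega) (by push_cast; linarith) (by linarith)
  funext i
  simp only [ampD, amp_of_le (show n ≤ K + 2 by omega)]
  fin_cases i
  · exact dt_dx 0 (by linarith) hr1 ht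
  · exact dt_dx 1 (by linarith) hr1 ht
  · exact (((hr0.ds_dt.mono (b := s - 2 * K - 2 - 2) (by linarith) (by linarith)).smul
      (Complex.I * p)).add hr2.dt.ds_dt).dt_eq ht
  · rfl

/-- Three components are identities built into `amp`; the third is `eqn_all` after ∂₁² + ∂₂² = Δ.
Negative n are included because orders -2 and -1 cancel the singular powers of ε. -/
theorem IsExpansion.phi_eq (hs : 2 * (K : ℝ) + 5 < s) (h : IsExpansion lam K T s g (K + 2) u)
    (hn : n ≤ K) {t : ℝ} (ht : t ∈ timeIco T) :
    vecDist (ampD K u n p t) - opA (vecDist (amp K u (n + 1) p t))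
      + ((Complex.I * (p : ℂ)) • vecDist (amp K u (n + 2) p t) +
        opA0 (vecDist (amp K u (n + 2) p t)))
      = vecDist ![0, 0, -fCoeff lam K (amp K u) n p t, 0] := by
  have hn' : (n : ℝ) ≤ K := by exact_mod_cast hn
  have i1 : n + 1 - 1 = n := by ring
  have i2 : n + 1 - 2 = n - 1 := by ring
  have i3 : n + 2 - 1 = n + 1 := by ring
  have i4 : n + 2 - 2 = n := by ring
  rw [h.ampD_eq hs hn ht, amp_of_le (show n + 1 ≤ K + 2 by omega),
    amp_of_le (show n + 2 ≤ K + 2 by omega), fCoeff_amp, i1, i2, i3, i4]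
  have hd1 : CS T (s - 2 * K - 2) (dt (u (n - 1) p)) :=
    (h.reg_le (l := 1) (α := s - 2 * K) (by push_cast; omega) (by push_cast; linarith)
      (by push_cast; linarith)).dt.cs
  have hu1 : CS T (s - 2 * K - 2) (u (n + 1) p) :=
    (h.reg_le (l := 0) (by push_cast; omega) (by push_cast; linarith)
      (by push_cast; linarith)).cs
  have hu0 : CS T (s - 2 * K) (u n p) :=
    (h.reg_le (l := 0) (by push_cast; omega) (by push_cast; linarith) (by linarith)).cs
  have hx : ∀ j, toDist (dx j (dt (u (n - 1) p) t)) - partialX j (toDist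
      ((Complex.I * p) • u (n + 1) p t + dt (u (n - 1) p) t)) +
      ((Complex.I * (p : ℂ)) • toDist (dx j (u (n + 1) p t)) + 0) = toDist 0 := by
    intro j
    rw [add_zero, toDist_zero, toDist_add, toDist_smul, partialX_add, partialX_smul,
      partialX_toDist j (by linarith) hd1 ht, partialX_toDist j (by linarith) hu1 ht]
    abel
  funext i
  fin_cases i
  · exact hx 0
  · exact hx 1
  · have hl : partialX 0 (toDist (dx 0 (u n p t))) + partialX 1 (toDist (dx 1 (u n p t))) =
        toDist (lap (u n p t)) := by
      rw [← partialX_toDist 0 (by linarith) hu0 ht, ← partialX_toDist 1 (by linarith) hu0 ht,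
        partialX_partialX, laplacian_toDist (by linarith) hu0 ht]
    change toDist ((Complex.I * p) • dt (u n p) t + dt (dt (u (n - 2) p)) t) -
      (partialX 0 (toDist (dx 0 (u n p t))) + partialX 1 (toDist (dx 1 (u n p t)))) +
      ((Complex.I * (p : ℂ)) • toDist ((Complex.I * p) • u (n + 2) p t + dt (u n p) t) +
        toDist (u (n + 2) p t)) =
      toDist (-((lam : ℂ) • cubSum tripleProd K (fun m q => u m q t) n p))
    rw [hl, ← toDist_smul, ← toDist_sub, ← toDist_add, ← toDist_add]
    congr 1
    have he := h.eqn_all hn p ht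
    rw [src] at he
    rw [smul_add, smul_smul, eq_neg_iff_add_eq_zero, ← he]
    have e1 : Complex.I * (p : ℂ) * (Complex.I * p) = -(p : ℂ) ^ 2 := by
      linear_combination (p : ℂ) ^ 2 * Complex.I_mul_I
    rw [e1]
    module
  · change toDist (dt (u n p) t) - 0 + ((Complex.I * (p : ℂ)) • toDist (u (n + 2) p t) +
      -toDist ((Complex.I * p) • u (n + 2) p t + dt (u n p) t)) = toDist 0
    rw [toDist_add, toDist_smul, toDist_zero]
    abel

theorem IsExpansion.isWKB (hs : 2 * (K : ℝ) + 5 < s) (hK : Even K)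
    (h : IsExpansion lam K T s g (K + 2) u) : IsWKB lam K T (amp K u) where
  eq_zero n p hn t := by rw [h.amp_eq_zero hn]
  conj n p t ht i := h.amp_conj hs n p ht i
  phi n p _ hnK t ht := ⟨_, h.hasDerivAt_amp hs hK n p ht,
    h.phi_eq hs hnK (timeIoo_subset_timeIco T ht)⟩

/-! ### The initial datum -/

theorem sum_range_int {M : Type*} [AddCommMonoid M] (f : ℤ → M) :
    ∑ n ∈ Finset.Icc (0 : ℤ) (K + 2), f n = ∑ n ∈ Finset.range (K + 3), f n := by
  symm
  refine Finset.sum_nbij' (fun n : ℕ => (n : ℤ)) (fun n : ℤ => n.toNat) ?_ ?_ ?_ ?_ ?_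
  · intro n hn
    simp only [Finset.mem_range, Finset.mem_Icc] at hn ⊢
    omega
  · intro n hn
    simp only [Finset.mem_range, Finset.mem_Icc] at hn ⊢
    omega
  · intro n _
    simp
  · intro n hn
    exact Int.toNat_of_nonneg (Finset.mem_Icc.1 hn).1
  · intro n _
    rfl

theorem harmonics_zero : harmonics 0 = {1, -1} := by
  ext p
  rw [mem_harmonics_even Even.zero, abs_le, Int.odd_iff, Finset.mem_insert, Finset.mem_singleton]
  omega

theorem harmonics_add_one (hn : Even n) : harmonics (n + 1) = harmonics n := by
  ext p
  rw [mem_harmonics, mem_harmonics, maxHarmonic, maxHarmonic, if_pos hn,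
    if_neg (by rwa [Int.even_add_one, not_not])]

/-- `∑_{p ∈ H_n} U_{n,p}(0)`. -/
def dataCoeff (K : ℕ) (u : ℤ → ℤ → ℝ → L2) (n : ℤ) : Fin 4 → L2 :=
  ∑ p ∈ harmonics n, amp K u n p 0

theorem wkbSum_zero (ε : ℝ) : wkbSum K (amp K u) ε 0 =
    ∑ n ∈ Finset.Icc (0 : ℤ) (K + 2), (ε : ℂ) ^ n • dataCoeff K u n := by
  simp [wkbSum, dataCoeff]

theorem IsExpansion.dataCoeff_even (h : IsExpansion lam K T s g (K + 2) u) (hn : 2 ≤ n)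
    (hnK : n ≤ K) (he : Even n) : dataCoeff K u n = 0 := by
  obtain ⟨h1, h2⟩ := h.init n hn (by omega) hnK he
  have h3 : ∀ p, u (n - 1) p = fun _ => 0 := fun p => h.zero_of_odd (he.sub_odd odd_one) p
  funext i
  simp only [dataCoeff, amp_of_le (show n ≤ K + 2 by omega), Finset.sum_apply, h3, dx_zero]
  fin_cases i
  · simp
  · simp
  · exact h2
  · exact h1

/-- At odd order only w is present, the gradient of the preceding u. So matching u at order n
settles order n + 1: for n = 0 this is ∇φ, and for 2 ≤ n ≤ K it is 0. -/
theorem IsExpansion.dataCoeff_odd (hs : 2 * (K : ℝ) + 5 < s) (hT : 0 < T)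
    (h : IsExpansion lam K T s g (K + 2) u) (hnK : n ≤ K) (he : Even n) : vecDist (dataCoeff K u (n + 1)) =
      ![partialX 0 (toDist (∑ p ∈ harmonics n, u n p 0)),
        partialX 1 (toDist (∑ p ∈ harmonics n, u n p 0)), 0, 0] := by
  have hn' : (n : ℝ) ≤ K := by exact_mod_cast hnK
  have h3 : ∀ p, u (n + 1) p = fun _ => 0 := fun p => h.zero_of_odd he.add_one p
  have h4 : ∀ p, u (n + 1 - 2) p = fun _ => 0 := fun p => by
    refine h.zero_of_odd ?_ p
    rw [show n + 1 - 2 = n - 1 by ring]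
    exact he.sub_odd odd_one
  have hx : ∀ j, ∑ p ∈ harmonics n, toDist (dx j (u n p 0)) =
      partialX j (toDist (∑ p ∈ harmonics n, u n p 0)) := by
    intro j
    rw [toDist_sum, partialX_sum]
    refine Finset.sum_congr rfl fun p _ => ?_
    rw [partialX_toDist (a := s - 2 * K) j (by linarith)
      (h.reg_le (l := 0) (by push_cast; omega) (by push_cast; linarith)
      (by linarith)).cs (zero_mem_timeIco hT)]
  funext i
  simp only [vecDist, dataCoeff, amp_of_le (show n + 1 ≤ K + 2 by omega), Finset.sum_apply, h3, h4,
    harmonics_add_one he, dt_zero, add_sub_cancel_right, toDist_sum]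
  fin_cases i
  · simpa using hx 0
  · simpa using hx 1
  · simp
  · simp

/-- Orders 0 and 1 reproduce (0, 0, ψ, φ) and the gradient of φ, orders 2 to K + 1 vanish by `init`,
and only the unmatched order K + 2 is left. -/
theorem IsExpansion.vecDist_wkbSum_zero (hs : 2 * (K : ℝ) + 5 < s) (hT : 0 < T) (hK : Even K)
    (hK0 : 0 < K) {φ ψ : Lp ℝ 2 (volume : Measure Plane)}
    (h : IsExpansion lam K T s g (K + 2) u)
    (hg : g 0 = (1 / 2 : ℂ) • (complexify φ - Complex.I • complexify ψ)) (ε : ℝ) :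
    vecDist (wkbSum K (amp K u) ε 0) =
      initialU ε φ ψ - (ε : ℂ) ^ (K + 2) • vecDist (-dataCoeff K u (K + 2)) := by
  have h0 := zero_mem_timeIco hT
  have hu1 : u 0 1 0 = (1 / 2 : ℂ) • (complexify φ - Complex.I • complexify ψ) := by
    rw [h.lead 0 h0, hg]
  have hu2 : u 0 (-1) 0 = (1 / 2 : ℂ) • (complexify φ + Complex.I • complexify ψ) := by
    rw [h.conj 0 1 0 h0, hu1, star_smul, star_sub, star_smul, star_complexify, star_complexify]
    simp
  have hsum : ∑ p ∈ harmonics 0, u 0 p 0 = complexify φ := by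
    rw [harmonics_zero, Finset.sum_pair (by norm_num), hu1, hu2]
    module
  have hd0 : vecDist (dataCoeff K u 0) = ![0, 0, toDist (complexify ψ), toDist (complexify φ)] := by
    have e0 : dataCoeff K u 0 = ![0, 0, complexify ψ, complexify φ] := by
      have hz : ∀ m p, m < 0 → u m p = fun _ => 0 := h.zero_of_neg
      funext i
      simp only [dataCoeff, amp_of_le (show (0 : ℤ) ≤ K + 2 by omega), Finset.sum_apply,
        hz (0 - 1) _ (by norm_num), hz (0 - 2) _ (by norm_num), dx_zero, dt_zero]
      fin_cases i
      · simp
      · simp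
      · change ∑ p ∈ harmonics 0, ((Complex.I * (p : ℂ)) • u 0 p 0 + 0) = complexify ψ
        rw [harmonics_zero, Finset.sum_pair (by norm_num), hu1, hu2]
        simp only [smul_smul, smul_sub, smul_add]
        push_cast
        have c1 : Complex.I * 1 * (1 / 2 * Complex.I) = -(1 / 2) := by
          linear_combination Complex.I_mul_I / 2
        have c2 : Complex.I * -1 * (1 / 2 * Complex.I) = 1 / 2 := by
          linear_combination -Complex.I_mul_I / 2
        rw [c1, c2]
        module
      · exact hsum
    rw [e0]
    funext i
    fin_cases i <;> simp [vecDist]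
  have hd1 := h.dataCoeff_odd hs hT (n := 0) (by omega) Even.zero
  rw [hsum, zero_add] at hd1
  have hmid : ∀ n : ℕ, 2 ≤ n → n < K + 2 → vecDist (dataCoeff K u n) = 0 := by
    intro n h2 hnK
    rcases Nat.even_or_odd n with he | ho
    · rw [h.dataCoeff_even (by omega) ?_ (by exact_mod_cast he)]
      · exact map_zero vecDistₗ
      · obtain ⟨i, hi⟩ := he
        obtain ⟨j, hj⟩ := hK
        omega
    · have he : Even ((n : ℤ) - 1) := by
        have : Odd (n : ℤ) := by exact_mod_cast ho
        exact this.sub_odd odd_one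
      have h3 : 2 ≤ (n : ℤ) - 1 := by
        obtain ⟨i, hi⟩ := ho
        omega
      have := h.dataCoeff_odd hs hT (n := n - 1) (by omega) he
      rw [(h.init _ h3 (by omega) (by omega) he).1, sub_add_cancel] at this
      rw [this]
      funext i
      fin_cases i <;> simp [partialX_zero]
  have hlin : vecDist (wkbSum K (amp K u) ε 0) =
      ∑ n ∈ Finset.range (K + 3), (ε : ℂ) ^ n • vecDist (dataCoeff K u n) := by
    rw [wkbSum_zero, sum_range_int]
    simp only [zpow_natCast]
    exact (map_sum vecDistₗ _ _).trans (Finset.sum_congr rfl fun n _ => map_smul vecDistₗ _ _)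
  have hneg : vecDist (-dataCoeff K u (K + 2)) = -vecDist (dataCoeff K u (K + 2)) :=
    map_neg vecDistₗ _
  rw [hlin, Finset.sum_range_succ, hneg, smul_neg, sub_neg_eq_add]
  push_cast
  congr 1
  obtain ⟨k, rfl⟩ : ∃ k, K = k + 1 := ⟨K - 1, by omega⟩
  rw [show k + 1 + 2 = (k + 1) + 1 + 1 by ring, Finset.sum_range_succ', Finset.sum_range_succ',
    Finset.sum_eq_zero]
  · push_cast at hd0 hd1 ⊢
    rw [hd0, hd1]
    funext i
    fin_cases i <;> simp [initialU]
    all_goals exact smul_zero (M := ℂ) (A := 𝓢'(Plane, ℂ)) (ε : ℂ)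
  · intro n hn
    rw [Finset.mem_range] at hn
    rw [hmid (n + 1 + 1) (by omega) (by omega)]
    exact smul_zero (M := ℂ) (A := Fin 4 → 𝓢'(Plane, ℂ)) ((ε : ℂ) ^ (n + 1 + 1))

end KleinGordon

end

/-! ### Linear algebra of the residual and expansion of the cubic term. -/

noncomputable section

open FourierTransform
open scoped NNReal

namespace KleinGordon

/-! ### The algebra of the residual -/

section Algebra

variable {E D : Type*} [AddCommGroup E] [Module ℂ E] [AddCommGroup D] [Module ℂ D] {K : ℕ} {ε : ℂ}

/-- Comparison of powers of ε, with A shifted by one and B by two. The ε⁻² term B 0 vanishes, and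
the ε⁻¹ terms B 1 and A 0 cancel. Orders K + 1 and K + 2 are left incomplete because no higher
amplitudes exist. -/
theorem sum_shift (hε : ε ≠ 0) (a A B : ℕ → D) (hB0 : B 0 = 0) (hB1 : B 1 = A 0) :
    ∑ n ∈ Finset.range (K + 3), ε ^ n • a n - ε⁻¹ • ∑ n ∈ Finset.range (K + 3), ε ^ n • A n +
        (ε ^ 2)⁻¹ • ∑ n ∈ Finset.range (K + 3), ε ^ n • B n =
      ∑ n ∈ Finset.range (K + 1), ε ^ n • (a n - A (n + 1) + B (n + 2)) +
        ε ^ (K + 1) • (a (K + 1) - A (K + 2)) + ε ^ (K + 2) • a (K + 2) := by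
  have h1 : ∑ n ∈ Finset.range (K + 3), ε ^ n • a n = ∑ n ∈ Finset.range (K + 1), ε ^ n • a n +
      ε ^ (K + 1) • a (K + 1) + ε ^ (K + 2) • a (K + 2) := by
    rw [Finset.sum_range_succ, Finset.sum_range_succ]
  have h2 : ε⁻¹ • ∑ n ∈ Finset.range (K + 3), ε ^ n • A n =
      ∑ n ∈ Finset.range (K + 1), ε ^ n • A (n + 1) + ε ^ (K + 1) • A (K + 2) + ε⁻¹ • A 0 := by
    have e : ∀ n, ε⁻¹ * ε ^ (n + 1) = ε ^ n := fun n => by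
      rw [pow_succ', inv_mul_cancel_left₀ hε]
    rw [Finset.sum_range_succ', Finset.sum_range_succ]
    simp only [smul_add, Finset.smul_sum, smul_smul, e, pow_zero, mul_one]
  have h3 : (ε ^ 2)⁻¹ • ∑ n ∈ Finset.range (K + 3), ε ^ n • B n =
      ∑ n ∈ Finset.range (K + 1), ε ^ n • B (n + 2) + ε⁻¹ • A 0 := by
    have e : ∀ n, (ε ^ 2)⁻¹ * ε ^ (n + 1 + 1) = ε ^ n := fun n => by
      rw [add_assoc, pow_add, mul_comm, mul_assoc, mul_inv_cancel₀ (pow_ne_zero 2 hε), mul_one]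
    have e1 : (ε ^ 2)⁻¹ * ε = ε⁻¹ := by field_simp
    rw [Finset.sum_range_succ', Finset.sum_range_succ', hB0, zero_add, hB1]
    simp only [smul_add, Finset.smul_sum, smul_smul, e, e1, pow_one, smul_zero, add_zero]
  rw [h1, h2, h3]
  simp only [smul_add, smul_sub, Finset.sum_add_distrib, Finset.sum_sub_distrib]
  abel

/-- Here e p is the phase; its time derivative contributes c p/ε², which joins A₀ at order ε⁻². Q
represents A(∂_x)U_{K+2} as an element of E, and M counts the cubic orders beyond K. A fixed set P
of harmonics allows the sums over n and p to be exchanged. -/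
theorem residual_identity (V : E →ₗ[ℂ] D) (A A₀ : D →ₗ[ℂ] D) (P : Finset ℤ) (hε : ε ≠ 0)
    (c e : ℤ → ℂ) (U U' F : ℕ → ℤ → E) (Q : ℤ → E) (M : ℕ)
    (hQ : ∀ p, V (Q p) = A (V (U (K + 2) p)))
    (h0 : ∀ p, c p • V (U 0 p) + A₀ (V (U 0 p)) = 0)
    (h1 : ∀ p, c p • V (U 1 p) + A₀ (V (U 1 p)) = A (V (U 0 p)))
    (h : ∀ n ≤ K, ∀ p, V (U' n p) - A (V (U (n + 1) p)) +
      (c p • V (U (n + 2) p) + A₀ (V (U (n + 2) p))) = V (F n p)) :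
    V (∑ n ∈ Finset.range (K + 3), ε ^ n • ∑ p ∈ P, (e p • U' n p + (c p * (ε ^ 2)⁻¹ * e p) • U n p)) -
        ε⁻¹ • A (V (∑ n ∈ Finset.range (K + 3), ε ^ n • ∑ p ∈ P, e p • U n p)) +
        (ε ^ 2)⁻¹ • A₀ (V (∑ n ∈ Finset.range (K + 3), ε ^ n • ∑ p ∈ P, e p • U n p)) =
      V (∑ n ∈ Finset.range (K + 1 + M), ε ^ n • ∑ p ∈ P, e p • F n p) -
        ε ^ (K + 1) • V (∑ i ∈ Finset.range M, ε ^ i • ∑ p ∈ P, e p • F (K + 1 + i) p -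
          ∑ p ∈ P, e p • (U' (K + 1) p - Q p) - ε • ∑ p ∈ P, e p • U' (K + 2) p) := by
  have key : ∀ p, _ := fun p => sum_shift (K := K) hε (fun n => V (U' n p))
    (fun n => A (V (U n p))) (fun n => c p • V (U n p) + A₀ (V (U n p))) (h0 p) (h1 p)
  have key2 := Finset.sum_congr (rfl : P = P) fun p _ => congrArg (fun x => e p • x) (key p)
  have hF : ∀ p, ∑ n ∈ Finset.range (K + 1), ε ^ n • (V (U' n p) - A (V (U (n + 1) p)) +
      (c p • V (U (n + 2) p) + A₀ (V (U (n + 2) p)))) =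
      ∑ n ∈ Finset.range (K + 1), ε ^ n • V (F n p) := fun p =>
    Finset.sum_congr rfl fun n hn => by rw [h n (by rw [Finset.mem_range] at hn; omega) p]
  have swap : ∀ (m : ℕ) (f : ℕ → ℤ → D),
      ∑ n ∈ Finset.range m, ε ^ n • ∑ p ∈ P, e p • f n p =
        ∑ p ∈ P, e p • ∑ n ∈ Finset.range m, ε ^ n • f n p := by
    intro m f
    simp only [Finset.smul_sum]
    rw [Finset.sum_comm]
    simp only [smul_comm (e _)]
  have hL : V (∑ n ∈ Finset.range (K + 3), ε ^ n •
      ∑ p ∈ P, (e p • U' n p + (c p * (ε ^ 2)⁻¹ * e p) • U n p)) =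
      ∑ p ∈ P, e p • (∑ n ∈ Finset.range (K + 3), ε ^ n • V (U' n p) +
        (ε ^ 2)⁻¹ • ∑ n ∈ Finset.range (K + 3), ε ^ n • c p • V (U n p)) := by
    have e1 : ∀ n p, e p • U' n p + (c p * (ε ^ 2)⁻¹ * e p) • U n p =
        e p • (U' n p + ((ε ^ 2)⁻¹ * c p) • U n p) := fun n p => by module
    simp only [e1, map_sum, map_smul, map_add]
    rw [swap]
    refine Finset.sum_congr rfl fun p _ => ?_
    rw [Finset.smul_sum (r := (ε ^ 2)⁻¹), ← Finset.sum_add_distrib]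
    congr 1
    refine Finset.sum_congr rfl fun n _ => ?_
    module
  have hA : ∀ (B : D →ₗ[ℂ] D) (κ : ℂ),
      κ • B (V (∑ n ∈ Finset.range (K + 3), ε ^ n • ∑ p ∈ P, e p • U n p)) =
        ∑ p ∈ P, e p • κ • ∑ n ∈ Finset.range (K + 3), ε ^ n • B (V (U n p)) := by
    intro B κ
    simp only [map_sum, map_smul]
    rw [swap, Finset.smul_sum]
    exact Finset.sum_congr rfl fun p _ => smul_comm _ _ _
  have hR : V (∑ n ∈ Finset.range (K + 1 + M), ε ^ n • ∑ p ∈ P, e p • F n p) =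
      ∑ p ∈ P, e p • ∑ n ∈ Finset.range (K + 1), ε ^ n • V (F n p) +
        ε ^ (K + 1) • V (∑ i ∈ Finset.range M, ε ^ i • ∑ p ∈ P, e p • F (K + 1 + i) p) := by
    rw [Finset.sum_range_add, map_add]
    congr 1
    · simp only [map_sum, map_smul]
      rw [swap]
    · simp only [map_sum, map_smul, pow_add, mul_smul, Finset.smul_sum]
  rw [hL, hA, hA, hR, map_sub, map_sub, smul_sub, smul_sub]
  have hX : ε ^ (K + 1) • V (∑ p ∈ P, e p • (U' (K + 1) p - Q p)) =
      ∑ p ∈ P, e p • ε ^ (K + 1) • (V (U' (K + 1) p) - A (V (U (K + 2) p))) := by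
    simp only [map_sum, map_smul, map_sub, hQ, Finset.smul_sum]
    exact Finset.sum_congr rfl fun p _ => smul_comm _ _ _
  have hY : ε ^ (K + 1) • V (ε • ∑ p ∈ P, e p • U' (K + 2) p) =
      ∑ p ∈ P, e p • ε ^ (K + 2) • V (U' (K + 2) p) := by
    simp only [map_sum, map_smul, Finset.smul_sum]
    exact Finset.sum_congr rfl fun p _ => by module
  rw [hX, hY]
  have e1 : ∀ p, ∑ n ∈ Finset.range (K + 3), ε ^ n • (c p • V (U n p) + A₀ (V (U n p))) =
      ∑ n ∈ Finset.range (K + 3), ε ^ n • c p • V (U n p) +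
        ∑ n ∈ Finset.range (K + 3), ε ^ n • A₀ (V (U n p)) := fun p => by
    simp only [smul_add, Finset.sum_add_distrib]
  simp only [hF, e1] at key2
  calc _ = _ := by
        rw [← Finset.sum_sub_distrib, ← Finset.sum_add_distrib]
        exact Finset.sum_congr rfl fun p _ => by module
    _ = _ := key2
    _ = _ := by
        simp only [smul_add _ (_ + _), Finset.sum_add_distrib]
        simp only [smul_add, Finset.sum_add_distrib]
        abel

end Algebra

variable {T : ℝ≥0∞} {a lam s : ℝ} {K l : ℕ} {n p N : ℤ} {u : ℤ → ℤ → ℝ → L2} {g : ℝ → L2}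

/-! ### Cubic expansion -/

theorem tripleProd_sum (ha : 1 < a) {ι : Type*} (S : Finset ι) (c : ι → ℂ) (f : ι → L2)
    (hf : ∀ i, ∃ G, f i = J a G) :
    tripleProd (∑ i ∈ S, c i • f i) (∑ i ∈ S, c i • f i) (∑ i ∈ S, c i • f i) =
      ∑ x ∈ S ×ˢ S ×ˢ S,
        (c x.1 * c x.2.1 * c x.2.2) • tripleProd (f x.1) (f x.2.1) (f x.2.2) := by
  choose G hG using hf
  have h1 : ∑ i ∈ S, c i • f i = J a (∑ i ∈ S, c i • G i) := by
    simp only [map_sum, map_smul, hG]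
  rw [h1, tripleProd_J ha]
  simp only [hG, tripleProd_J ha, ← map_smul, ← map_sum]
  congr 1
  simp only [tri, map_sum, map_smul, _root_.sum_apply, smul_apply, Finset.sum_product,
    Finset.smul_sum]
  refine (Finset.sum_congr rfl fun _ _ => Finset.sum_comm).trans ?_
  rw [Finset.sum_comm]
  refine Finset.sum_congr rfl fun x _ => ?_
  rw [Finset.sum_comm]
  refine Finset.sum_congr rfl fun y _ => Finset.sum_congr rfl fun z _ => ?_
  module

/-- Three orders at most K + 2 sum to at most 3K + 6, and three harmonics of modulus at most K + 3
to at most 3K + 9. -/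
theorem sum_triples {M : Type*} [AddCommMonoid M] (f : (ℤ × ℤ) × (ℤ × ℤ) × (ℤ × ℤ) → M) :
    ∑ x ∈ indices K ×ˢ indices K ×ˢ indices K, f x =
      ∑ n ∈ Finset.range (3 * K + 7), ∑ p ∈ Finset.Icc (-(3 * K + 9) : ℤ) (3 * K + 9),
        ∑ x ∈ triples K n p, f x := by
  have h1 := sum_range_int (K := 3 * K + 4) fun n =>
    ∑ p ∈ Finset.Icc (-(3 * K + 9) : ℤ) (3 * K + 9), ∑ x ∈ triples K n p, f x
  rw [show 3 * K + 7 = 3 * K + 4 + 3 by ring, ← h1, ← Finset.sum_product']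
  rw [← Finset.sum_fiberwise_of_maps_to (t := Finset.Icc (0 : ℤ) ((3 * K + 4 : ℕ) + 2) ×ˢ
    Finset.Icc (-(3 * K + 9) : ℤ) (3 * K + 9))
    (g := fun x => (x.1.1 + x.2.1.1 + x.2.2.1, x.1.2 + x.2.1.2 + x.2.2.2))]
  · refine Finset.sum_congr rfl fun y _ => ?_
    simp only [triples, Prod.ext_iff]
  · intro x hx
    simp only [Finset.mem_product, mem_indices, Finset.mem_Icc, mem_harmonics, maxHarmonic,
      abs_le] at hx ⊢
    push_cast
    split_ifs at hx <;> omega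

end KleinGordon

end

/-! ### The approximate solution, its residual and the uniform bounds. -/

noncomputable section

open FourierTransform
open scoped NNReal

namespace KleinGordon

variable {T : ℝ≥0∞} {a lam s σ : ℝ} {K l : ℕ} {n p N : ℤ} {u : ℤ → ℤ → ℝ → L2} {g : ℝ → L2}

/-! ### The approximate solution -/

/-- A set of harmonics that is large enough for all sums below. -/
def allHarmonics (K : ℕ) : Finset ℤ := Finset.Icc (-(3 * K + 9) : ℤ) (3 * K + 9)

/-- The oscillating factor `e^{ipt/ε²}`. -/
def phase (ε t : ℝ) (p : ℤ) : ℂ := Complex.exp (Complex.I * (p : ℂ) * ((t / ε ^ 2 : ℝ) : ℂ))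

theorem norm_phase (ε t : ℝ) (p : ℤ) : ‖phase ε t p‖ = 1 := by
  have : Complex.I * (p : ℂ) * ((t / ε ^ 2 : ℝ) : ℂ) = ((p * (t / ε ^ 2) : ℝ) : ℂ) * Complex.I := by
    push_cast
    ring
  rw [phase, this, Complex.norm_exp_ofReal_mul_I]

theorem phase_add (ε t : ℝ) (p q : ℤ) : phase ε t (p + q) = phase ε t p * phase ε t q := by
  rw [phase, phase, phase, ← Complex.exp_add]
  congr 1
  push_cast
  ring

theorem hasDerivAt_phase (ε t : ℝ) (p : ℤ) : HasDerivAt (fun r => phase ε r p)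
    (Complex.I * p * ((ε : ℂ) ^ 2)⁻¹ * phase ε t p) t := by
  have h1 : HasDerivAt (fun r : ℝ => ((r / ε ^ 2 : ℝ) : ℂ)) (((1 / ε ^ 2 : ℝ)) : ℂ) t :=
    ((hasDerivAt_id t).div_const (ε ^ 2)).ofReal_comp
  have h2 := (h1.const_mul (Complex.I * (p : ℂ))).cexp
  refine h2.congr_deriv ?_
  rw [phase]
  push_cast
  ring

theorem harmonics_subset (hn : n ≤ K + 2) : harmonics n ⊆ allHarmonics K := by
  intro p hp
  rw [mem_harmonics, maxHarmonic, abs_le] at hp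
  rw [allHarmonics, Finset.mem_Icc]
  split_ifs at hp <;> omega

theorem IsExpansion.wkbSum_eq (h : IsExpansion lam K T s g (K + 2) u) (ε t : ℝ) :
    wkbSum K (amp K u) ε t = ∑ n ∈ Finset.range (K + 3), (ε : ℂ) ^ n •
      ∑ p ∈ allHarmonics K, phase ε t p • amp K u n p t := by
  rw [wkbSum, sum_range_int]
  refine Finset.sum_congr rfl fun n hn => ?_
  rw [Finset.mem_range] at hn
  rw [zpow_natCast]
  congr 1
  refine Finset.sum_subset (harmonics_subset (by omega)) fun p _ hp => ?_
  rw [h.amp_eq_zero (by tauto), smul_zero]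

theorem IsExpansion.hasDerivAt_wkbSum (hs : 2 * (K : ℝ) + 5 < s) (hK : Even K)
    (h : IsExpansion lam K T s g (K + 2) u) (ε : ℝ) {t : ℝ} (ht : t ∈ timeIoo T) :
    HasDerivAt (wkbSum K (amp K u) ε) (∑ n ∈ Finset.range (K + 3), (ε : ℂ) ^ n •
      ∑ p ∈ allHarmonics K, (phase ε t p • ampD K u n p t +
        (Complex.I * p * ((ε : ℂ) ^ 2)⁻¹ * phase ε t p) • amp K u n p t)) t := by
  rw [show wkbSum K (amp K u) ε = fun r => ∑ n ∈ Finset.range (K + 3), (ε : ℂ) ^ n •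
      ∑ p ∈ allHarmonics K, phase ε r p • amp K u n p r from funext (h.wkbSum_eq ε)]
  refine HasDerivAt.fun_sum fun n _ => HasDerivAt.fun_const_smul _ (HasDerivAt.fun_sum fun p _ => ?_)
  exact (hasDerivAt_phase ε t p).smul (h.hasDerivAt_amp hs hK n p ht)

/-- The cubic source terms. -/
def cubicVec (lam : ℝ) (K : ℕ) (u : ℤ → ℤ → ℝ → L2) (n p : ℤ) (t : ℝ) : Fin 4 → L2 :=
  ![0, 0, -fCoeff lam K (amp K u) n p t, 0]

theorem IsExpansion.cs_all (hs : 2 * (K : ℝ) + 5 < s) (h : IsExpansion lam K T s g (K + 2) u)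
    (n p : ℤ) : Reg T 0 (s - 2 * K - 4) (u n p) := by
  by_cases hn : n ≤ K + 2
  · have hn' : (n : ℝ) ≤ K + 2 := by exact_mod_cast hn
    exact h.reg_le (by push_cast; omega) (by push_cast; linarith) (by linarith)
  · rw [h.zero n p (by omega)]
    exact .zero

theorem IsExpansion.nonlinF_wkbSum (hs : 2 * (K : ℝ) + 5 < s)
    (h : IsExpansion lam K T s g (K + 2) u) {ε : ℝ} (hε : 0 < ε) {t : ℝ} (ht : t ∈ timeIco T) :
    nonlinF lam (wkbSum K (amp K u) ε t) = ∑ n ∈ Finset.range (K + 1 + (2 * K + 6)), (ε : ℂ) ^ n •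
      ∑ p ∈ allHarmonics K, phase ε t p • cubicVec lam K u n p t := by
  have hε' : (ε : ℂ) ≠ 0 := by exact_mod_cast hε.ne'
  have h3 : wkbSum K (amp K u) ε t 3 = ∑ x ∈ indices K,
      ((ε : ℂ) ^ x.1 * phase ε t x.2) • u x.1 x.2 t := by
    rw [sum_indices, wkbSum, Finset.sum_apply]
    refine Finset.sum_congr rfl fun n hn => ?_
    rw [Pi.smul_apply, Finset.sum_apply, Finset.smul_sum]
    refine Finset.sum_congr rfl fun p _ => ?_
    rw [Pi.smul_apply, smul_smul, amp_of_le (Finset.mem_Icc.1 hn).2]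
    rfl
  have hcub : tripleProd (wkbSum K (amp K u) ε t 3) (wkbSum K (amp K u) ε t 3)
      (wkbSum K (amp K u) ε t 3) = ∑ n ∈ Finset.range (3 * K + 7), (ε : ℂ) ^ n •
        ∑ p ∈ allHarmonics K, phase ε t p • cubSum tripleProd K (fun m q => u m q t) n p := by
    -- The index s - 2K - 4 is available for all amplitudes and still exceeds 1, so the cube may be
    -- expanded.
    rw [h3, tripleProd_sum (a := s - 2 * K - 4) (by linarith) (indices K)
      (fun x => (ε : ℂ) ^ x.1 * phase ε t x.2) (fun x => u x.1 x.2 t)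
      (fun x => (h.cs_all hs x.1 x.2).cs.exists_eq ht), sum_triples]
    refine Finset.sum_congr rfl fun n _ => ?_
    rw [Finset.smul_sum]
    refine Finset.sum_congr rfl fun p _ => ?_
    rw [cubSum, smul_smul, Finset.smul_sum]
    refine Finset.sum_congr rfl fun x hx => ?_
    have hx2 := (mem_triples.1 hx).2
    congr 1
    rw [← hx2.2, phase_add, phase_add, ← zpow_natCast, ← hx2.1, zpow_add₀ hε', zpow_add₀ hε']
    ring
  funext i
  rw [show K + 1 + (2 * K + 6) = 3 * K + 7 by ring]
  fin_cases i
  · simp [nonlinF, cubicVec]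
  · simp [nonlinF, cubicVec]
  · simp only [nonlinF, cubicVec, Fin.reduceFinMk, Matrix.cons_val, Finset.sum_apply, Pi.smul_apply]
    rw [hcub, Finset.smul_sum, ← Finset.sum_neg_distrib]
    refine Finset.sum_congr rfl fun n _ => ?_
    rw [smul_comm, ← smul_neg, Finset.smul_sum, ← Finset.sum_neg_distrib]
    congr 1
    refine Finset.sum_congr rfl fun p _ => ?_
    rw [fCoeff_amp, smul_neg, smul_comm]
  · simp [nonlinF, cubicVec]

/-- `A(∂_x)` on vectors of sufficiently regular functions. -/
def opAL2 (V : Fin 4 → L2) : Fin 4 → L2 :=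
  ![dx 0 (V 2), dx 1 (V 2), dx 0 (V 0) + dx 1 (V 1), 0]

/-- The residual of the approximate solution. -/
def residual (lam : ℝ) (K : ℕ) (u : ℤ → ℤ → ℝ → L2) (ε t : ℝ) : Fin 4 → L2 :=
  -- These are the cubic orders K + 1 to 3K + 6, those the WKB equations do not absorb.
  ∑ i ∈ Finset.range (2 * K + 6), (ε : ℂ) ^ i •
      ∑ p ∈ allHarmonics K, phase ε t p • cubicVec lam K u (K + 1 + i : ℕ) p t -
    ∑ p ∈ allHarmonics K, phase ε t p •
      (ampD K u (K + 1 : ℕ) p t - opAL2 (amp K u (K + 2 : ℕ) p t)) -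
    (ε : ℂ) • ∑ p ∈ allHarmonics K, phase ε t p • ampD K u (K + 2 : ℕ) p t

theorem IsExpansion.vecDist_opAL2 (hs : 2 * (K : ℝ) + 5 < s) (hK : Even K)
    (h : IsExpansion lam K T s g (K + 2) u) (n p : ℤ) {t : ℝ} (ht : t ∈ timeIco T) :
    vecDist (opAL2 (amp K u n p t)) = opA (vecDist (amp K u n p t)) := by
  have hx : ∀ j i, partialX j (toDist (amp K u n p t i)) = toDist (dx j (amp K u n p t i)) :=
    fun j i => partialX_toDist (a := s - 2 * K - 2) j (by linarith) (h.reg_amp_one hs hK n p i).cs ht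
  funext i
  fin_cases i
  · exact (hx 0 2).symm
  · exact (hx 1 2).symm
  · change toDist (dx 0 (amp K u n p t 0) + dx 1 (amp K u n p t 1)) =
      partialX 0 (toDist (amp K u n p t 0)) + partialX 1 (toDist (amp K u n p t 1))
    rw [hx, hx, toDist_add]
  · exact toDist_zero

/-- `residual_identity` applied to `phi_eq`. At n = -2 and n = -1 the time derivative and the cubic
term are zero, and what remains are the two conditions removing ε⁻² and ε⁻¹. -/
theorem IsExpansion.approximate_solution (hs : 2 * (K : ℝ) + 5 < s) (hK : Even K)
    (h : IsExpansion lam K T s g (K + 2) u) {ε : ℝ} (hε : 0 < ε) {t : ℝ} (ht : t ∈ timeIoo T) :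
    ∃ Ua' : Fin 4 → L2, HasDerivAt (wkbSum K (amp K u) ε) Ua' t ∧
      vecDist Ua' - ((1 / ε : ℝ) : ℂ) • opA (vecDist (wkbSum K (amp K u) ε t))
        + ((1 / ε ^ 2 : ℝ) : ℂ) • opA0 (vecDist (wkbSum K (amp K u) ε t))
        = vecDist (nonlinF lam (wkbSum K (amp K u) ε t))
          - ((ε : ℂ) ^ (K + 1)) • vecDist (residual lam K u ε t) := by
  have ht' := timeIoo_subset_timeIco T ht
  have hε' : (ε : ℂ) ≠ 0 := by exact_mod_cast hε.ne'
  refine ⟨_, h.hasDerivAt_wkbSum hs hK ε ht, ?_⟩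
  have hneg : ∀ n p, n < 0 → vecDist (cubicVec lam K u n p t) = 0 ∧
      vecDist (ampD K u n p t) = 0 ∧ opA (vecDist (amp K u n p t)) = 0 := by
    intro n p hn
    have hc : cubSum tripleProd K (fun m q => u m q t) n p = 0 :=
      Finset.sum_eq_zero fun x hx => absurd (mem_triples_le hx).1 (by omega)
    have ha : amp K u n p = fun _ => 0 := h.amp_eq_zero (by omega)
    have hd : ampD K u n p t = 0 := by
      funext i
      simp only [ampD, ha, Pi.zero_apply, dt_zero]
    have hv : cubicVec lam K u n p t = 0 := by
      rw [cubicVec, fCoeff_amp, hc]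
      funext i
      fin_cases i <;> simp
    rw [hd, hv, ha]
    exact ⟨map_zero vecDistₗ, map_zero vecDistₗ, (congrArg opAₗ (map_zero vecDistₗ)).trans
      (map_zero opAₗ)⟩
  have key := residual_identity (K := K) vecDistₗ opAₗ opA0ₗ (allHarmonics K) hε'
    (fun p => Complex.I * p) (phase ε t) (fun n p => amp K u n p t) (fun n p => ampD K u n p t)
    (fun n p => cubicVec lam K u n p t) (fun p => opAL2 (amp K u (K + 2 : ℕ) p t)) (2 * K + 6)
    (fun p => h.vecDist_opAL2 hs hK _ p ht')
    (fun p => by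
      have h1 := h.phi_eq (n := -2) (p := p) hs (by omega) ht'
      rw [(hneg (-2) p (by norm_num)).2.1, show (-2 + 1 : ℤ) = -1 by norm_num,
        (hneg (-1) p (by norm_num)).2.2, sub_zero, zero_add] at h1
      exact h1.trans (hneg (-2) p (by norm_num)).1)
    (fun p => by
      have h1 := h.phi_eq (n := -1) (p := p) hs (by omega) ht'
      rw [(hneg (-1) p (by norm_num)).2.1, zero_sub, neg_add_eq_sub] at h1
      exact sub_eq_zero.1 (h1.trans (hneg (-1) p (by norm_num)).1))
    (fun n hn p => by
      have h1 := h.phi_eq (n := n) (p := p) hs (by exact_mod_cast hn) ht'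
      exact_mod_cast h1)
  rw [← h.nonlinF_wkbSum hs hε ht', ← h.wkbSum_eq ε t] at key
  have c1 : ((1 / ε : ℝ) : ℂ) = (ε : ℂ)⁻¹ := by push_cast; rw [one_div]
  have c2 : ((1 / ε ^ 2 : ℝ) : ℂ) = ((ε : ℂ) ^ 2)⁻¹ := by push_cast; rw [one_div]
  rw [c1, c2]
  exact key

/-! ### Uniform bounds -/

theorem sobolevNormLE_iff (hσ : 0 ≤ σ) {f : L2} {C : ℝ} :
    SobolevNormLE σ f C ↔ ∃ G, f = J σ G ∧ ‖G‖ ≤ C := by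
  simp only [SobolevNormLE, besselPotential_toDist_iff hσ]

/-- `f(ε, t)` is bounded in `H^σ`, uniformly in `ε ∈ (0, 1]` and locally uniformly in `t`. -/
def UniformBound (T : ℝ≥0∞) (σ : ℝ) (f : ℝ → ℝ → L2) : Prop :=
  ∃ c : ℝ → ℝ, ContinuousOn c (timeIco T) ∧ ∀ t ∈ timeIco T, ∀ ε, 0 < ε → ε ≤ 1 →
    ∃ G, f ε t = J σ G ∧ ‖G‖ ≤ c t

theorem UniformBound.of_cs {v : ℝ → L2} (hv : CS T σ v) : UniformBound T σ (fun _ => v) := by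
  obtain ⟨G, h1, h2⟩ := hv
  exact ⟨fun t => ‖G t‖, h1.norm, fun t ht _ _ _ => ⟨G t, h2 t ht, le_rfl⟩⟩

theorem UniformBound.add {f f' : ℝ → ℝ → L2} (h : UniformBound T σ f) (h' : UniformBound T σ f') :
    UniformBound T σ (fun ε t => f ε t + f' ε t) := by
  obtain ⟨c, hc, h⟩ := h
  obtain ⟨c', hc', h'⟩ := h'
  refine ⟨fun t => c t + c' t, hc.add hc', fun t ht ε h0 h1 => ?_⟩
  obtain ⟨G, e, b⟩ := h t ht ε h0 h1
  obtain ⟨G', e', b'⟩ := h' t ht ε h0 h1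
  exact ⟨G + G', by simp only [e, e', map_add], (norm_add_le _ _).trans (add_le_add b b')⟩

theorem UniformBound.smul {f : ℝ → ℝ → L2} {k : ℝ → ℝ → ℂ} (h : UniformBound T σ f)
    (hk : ∀ ε t, 0 < ε → ε ≤ 1 → ‖k ε t‖ ≤ 1) : UniformBound T σ (fun ε t => k ε t • f ε t) := by
  obtain ⟨c, hc, h⟩ := h
  refine ⟨c, hc, fun t ht ε h0 h1 => ?_⟩
  obtain ⟨G, e, b⟩ := h t ht ε h0 h1
  refine ⟨k ε t • G, by simp only [e, map_smul], ?_⟩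
  rw [norm_smul]
  exact (mul_le_of_le_one_left (norm_nonneg _) (hk ε t h0 h1)).trans b

theorem UniformBound.sub {f f' : ℝ → ℝ → L2} (h : UniformBound T σ f) (h' : UniformBound T σ f') :
    UniformBound T σ (fun ε t => f ε t - f' ε t) := by
  have := h.add (h'.smul (k := fun _ _ => -1) fun _ _ _ _ => by simp)
  simpa only [neg_smul, one_smul, ← sub_eq_add_neg] using this

theorem UniformBound.sum {ι : Type*} (S : Finset ι) {f : ι → ℝ → ℝ → L2}
    (h : ∀ i ∈ S, UniformBound T σ (f i)) : UniformBound T σ (fun ε t => ∑ i ∈ S, f i ε t) := by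
  classical
  induction S using Finset.induction_on with
  | empty => simpa using UniformBound.of_cs CS.zero
  | insert i S hi ih =>
    simp_rw [Finset.sum_insert hi]
    exact (h i (Finset.mem_insert_self i S)).add
      (ih fun j hj => h j (Finset.mem_insert_of_mem hj))

/-- Every building block lies in C([0, T); H^{s-2K-4}) and does not depend on ε, which enters only
through phases of modulus 1 and nonnegative powers of ε ≤ 1. -/
theorem IsExpansion.uniformBound_residual (hs : 2 * (K : ℝ) + 5 < s) (hK : Even K)
    (h : IsExpansion lam K T s g (K + 2) u) (i : Fin 4) :
    UniformBound T (s - 2 * K - 4) (fun ε t => residual lam K u ε t i) := by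
  have hphase : ∀ (ε t : ℝ) (p : ℤ), ‖phase ε t p‖ ≤ 1 := fun ε t p => (norm_phase ε t p).le
  have hε : ∀ (m : ℕ) (ε : ℝ), 0 < ε → ε ≤ 1 → ‖(ε : ℂ) ^ m‖ ≤ 1 := fun m ε h0 h1 => by
    rw [norm_pow, Complex.norm_real, Real.norm_of_nonneg h0.le]
    exact pow_le_one₀ h0.le h1
  have hD : ∀ n p, CS T (s - 2 * K - 4) (fun t => ampD K u n p t i) := fun n p =>
    ((h.reg_amp_one hs hK n p i).dt.mono_index (b := s - 2 * K - 4) (by push_cast; linarith)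
      (by linarith)).cs
  have hx : ∀ j n p i, CS T (s - 2 * K - 4) (fun t => dx j (amp K u n p t i)) := fun j n p i =>
    (((h.reg_amp_one hs hK n p i).of_succ.dx j (by push_cast; linarith)).mono_index
      (b := s - 2 * K - 4) (by push_cast; linarith) (by linarith)).cs
  have hQ : ∀ n p, CS T (s - 2 * K - 4) (fun t => opAL2 (amp K u n p t) i) := fun n p => by
    fin_cases i
    · exact hx 0 n p 2
    · exact hx 1 n p 2
    · exact (hx 0 n p 0).add (hx 1 n p 1)
    · exact CS.zero
  have hC : ∀ n p, CS T (s - 2 * K - 4) (fun t => cubicVec lam K u n p t i) := fun n p => by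
    unfold cubicVec
    fin_cases i
    · exact CS.zero
    · exact CS.zero
    · have h1 : Reg T 0 (s - 2 * K - 4)
          (fun t => cubSum tripleProd K (fun m q => u m q t) n p) :=
        Reg.cubSum (by push_cast; linarith) fun m q _ _ => h.cs_all hs m q
      refine (h1.smul (lam : ℂ)).neg.cs.congr fun t _ => ?_
      simp [fCoeff_amp]
    · exact CS.zero
  simp only [residual, Pi.sub_apply, Finset.sum_apply, Pi.smul_apply]
  refine ((UniformBound.sum _ fun m _ => UniformBound.smul (UniformBound.sum _ fun p _ =>
    UniformBound.smul (.of_cs (hC _ p)) fun ε t _ _ => hphase ε t p) fun ε _ => hε m ε).sub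
    (UniformBound.sum _ fun p _ => UniformBound.smul ((UniformBound.of_cs (hD _ p)).sub
      (.of_cs (hQ _ p))) fun ε t _ _ => hphase ε t p)).sub
    (UniformBound.smul (UniformBound.sum _ fun p _ => UniformBound.smul (.of_cs (hD _ p))
      fun ε t _ _ => hphase ε t p) fun ε _ h0 h1 => by simpa using hε 1 ε h0 h1)

/-- The majorant is 1 plus the maximum of the positive part of c(θt) over θ ∈ [0, 1]. Taking the
running maximum over a fixed compact set gives continuity, and rescaling θ by t/t' gives
monotonicity. -/
theorem exists_monotone_majorant {c : ℝ → ℝ} (hc : ContinuousOn c (timeIco T)) :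
    ∃ C : ℝ → ℝ, ContinuousOn C (timeIco T) ∧ MonotoneOn C (timeIco T) ∧
      (∀ t ∈ timeIco T, 0 < C t) ∧ ∀ t ∈ timeIco T, c t ≤ C t := by
  let f : timeIco T → Set.Icc (0 : ℝ) 1 → ℝ := fun t θ => max 0 (c (θ * t))
  have hmem : ∀ (t : timeIco T) (θ : Set.Icc (0 : ℝ) 1), (θ * t : ℝ) ∈ timeIco T := fun t θ =>
    mem_timeIco_of_le t.2 (mul_nonneg θ.2.1 t.2.1) (mul_le_of_le_one_left t.2.1 θ.2.2)
  have hf : Continuous (fun x : timeIco T × Set.Icc (0 : ℝ) 1 => f x.1 x.2) := by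
    refine continuous_const.max (hc.comp_continuous ?_ fun x => hmem x.1 x.2)
    fun_prop
  have hbdd : ∀ t, BddAbove (f t '' Set.univ) := fun t =>
    (isCompact_univ.image (by fun_prop : Continuous (f t))).bddAbove
  have hS : Continuous fun t => sSup (f t '' Set.univ) :=
    isCompact_univ.continuous_sSup hf
  have hnn : ∀ t, 0 ≤ sSup (f t '' Set.univ) := fun t =>
    (le_max_left 0 _).trans (le_csSup (hbdd t) ⟨⟨0, le_rfl, zero_le_one⟩, trivial, rfl⟩)
  classical
  let C : ℝ → ℝ := fun t => if ht : t ∈ timeIco T then 1 + sSup (f ⟨t, ht⟩ '' Set.univ) else 1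
  have hCt : ∀ t (ht : t ∈ timeIco T), C t = 1 + sSup (f ⟨t, ht⟩ '' Set.univ) :=
    fun t ht => dif_pos ht
  refine ⟨C, ?_, ?_, ?_, ?_⟩
  · rw [continuousOn_iff_continuous_domRestrict]
    exact (continuous_const.add hS).congr fun t => (hCt t t.2).symm
  · intro t ht t' ht' htt'
    rw [hCt t ht, hCt t' ht']
    refine add_le_add le_rfl (csSup_le ⟨_, ⟨⟨0, le_rfl, zero_le_one⟩, trivial, rfl⟩⟩ ?_)
    rintro _ ⟨θ, -, rfl⟩
    refine le_csSup (hbdd _) ?_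
    rcases eq_or_lt_of_le ht'.1 with h0 | h0
    · refine ⟨θ, trivial, ?_⟩
      have : t = t' := le_antisymm htt' (h0 ▸ ht.1)
      simp only [f, this]
    · refine ⟨⟨θ * (t / t'), mul_nonneg θ.2.1 (div_nonneg ht.1 h0.le),
        mul_le_one₀ θ.2.2 (div_nonneg ht.1 h0.le) ((div_le_one h0).2 htt')⟩, trivial, ?_⟩
      simp only [f]
      rw [mul_assoc, div_mul_cancel₀ _ h0.ne']
  · intro t ht
    rw [hCt t ht]
    linarith [hnn ⟨t, ht⟩]
  · intro t ht
    rw [hCt t ht]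
    have h1 : f ⟨t, ht⟩ ⟨1, zero_le_one, le_rfl⟩ ≤ sSup (f ⟨t, ht⟩ '' Set.univ) :=
      le_csSup (hbdd _) ⟨_, trivial, rfl⟩
    simp only [f, one_mul] at h1
    linarith [le_max_right 0 (c t)]

end KleinGordon

end

open KleinGordon
theorem mainTheorem9 (lam : ℝ) (hlam : lam < 0) (K : ℕ) (hK : 0 < K) (hKeven : Even K)
    (s : ℝ) (hs : 2 * (K : ℝ) + 5 < s)
    (φ ψ : Lp ℝ 2 (volume : Measure Plane))
    (hφ : MemSobolev s 2 (toDist (complexify φ)))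
    (hψ : MemSobolev s 2 (toDist (complexify ψ)))
    (Tstar : ℝ≥0∞) (hT : Tstar = existenceTime lam s φ ψ) :
    0 < Tstar ∧
    ∃ (g₀ : ℝ → L2) (U : Amplitudes),
      IsNLSSolution lam s φ ψ Tstar g₀ ∧
      IsWKB lam K Tstar U ∧
      (∀ t ∈ timeIco Tstar, U 0 1 t = ![0, 0, Complex.I • g₀ t, g₀ t]) ∧
      (∀ n : ℤ, 0 ≤ n → n ≤ K + 2 → ∀ p ∈ harmonics n, ∀ i : Fin 4,
        ContinuousSobolev (s - 2 * (n : ℝ)) Tstar (fun t => U n p t i)) ∧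
      ∃ (C : ℝ → ℝ) (C₀ : ℝ),
        ContinuousOn C (timeIco Tstar) ∧ MonotoneOn C (timeIco Tstar) ∧
        (∀ t ∈ timeIco Tstar, 0 < C t) ∧
        ∀ ε : ℝ, 0 < ε → ε ≤ 1 →
          ∃ (R : ℝ → Fin 4 → L2) (r : Fin 4 → L2),
            (∀ t ∈ timeIoo Tstar, ∃ Ua' : Fin 4 → L2,
              HasDerivAt (wkbSum K U ε) Ua' t ∧
              vecDist Ua' - ((1 / ε : ℝ) : ℂ) • opA (vecDist (wkbSum K U ε t))
                + ((1 / ε ^ 2 : ℝ) : ℂ) • opA0 (vecDist (wkbSum K U ε t))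
                = vecDist (nonlinF lam (wkbSum K U ε t))
                  - ((ε : ℂ) ^ (K + 1)) • vecDist (R t)) ∧
            vecDist (wkbSum K U ε 0)
              = initialU ε φ ψ - ((ε : ℂ) ^ (K + 2)) • vecDist r ∧
            (∀ t ∈ timeIoo Tstar, ∀ i : Fin 4,
              SobolevNormLE (s - 2 * (K : ℝ) - 4) (R t i) (C t)) ∧
            (∀ i : Fin 4, SobolevNormLE (s - 2 * (K : ℝ) - 2) (r i) C₀) := by
  subst hT
  have hs2 : 2 ≤ s := by
    have : (0 : ℝ) ≤ K := Nat.cast_nonneg K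
    linarith
  obtain ⟨hpos, g, hg, hd⟩ := exists_maximal_nls (lam := lam) hs2 hφ hψ
  refine ⟨hpos, ?_⟩
  obtain ⟨u, h⟩ := exists_isExpansion hs hpos hKeven
    ((cs_iff_continuousSobolev (by linarith)).2 hg.1) hd
  choose c hc hcb using h.uniformBound_residual hs hKeven
  -- Summing over the components yields a single function that bounds all four.
  obtain ⟨C, hC1, hC2, hC3, hC4⟩ := exists_monotone_majorant
    (T := existenceTime lam s φ ψ) (c := fun t => ∑ i, |c i t|)
    (continuousOn_finsetSum _ fun i _ => (hc i).abs)
  -- The datum error is the unmatched coefficient of order K + 2: it is independent of ε and has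
  -- index s - 2K - 2 by `reg_amp_one`.
  have hr : ∀ i, ∃ G, (-dataCoeff K u (K + 2)) i = J (s - 2 * K - 2) G := fun i => by
    have h1 : Reg (existenceTime lam s φ ψ) 1 (s - 2 * K - 2)
        (fun t => -∑ p ∈ harmonics (K + 2), amp K u (K + 2) p t i) :=
      (Reg.sum _ fun p _ => h.reg_amp_one hs hKeven _ p i).neg
    obtain ⟨G, hG⟩ := h1.cs.exists_eq (zero_mem_timeIco hpos)
    exact ⟨G, by rw [← hG, Pi.neg_apply, dataCoeff, Finset.sum_apply]⟩
  choose G hG using hr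
  refine ⟨g, amp K u, hg, h.isWKB hs hKeven, fun t ht => ?_, fun n hn hnK p _ i => ?_, C,
    ∑ i, ‖G i‖, hC1, hC2, hC3, fun ε hε hε1 => ⟨residual lam K u ε, -dataCoeff K u (K + 2),
    fun t ht => h.approximate_solution hs hKeven hε ht,
    h.vecDist_wkbSum_zero hs hpos hKeven hK hg.2.1 ε, fun t ht i => ?_, fun i => ?_⟩⟩
  · rw [amp_of_le (by omega), h.lead t ht, h.zero_of_neg (0 - 1) _ (by norm_num),
      h.zero_of_neg (0 - 2) _ (by norm_num), dt_zero, dx_zero, dx_zero]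
    simp
  · have hn' : (n : ℝ) ≤ K + 2 := by exact_mod_cast hnK
    exact (cs_iff_continuousSobolev (by linarith)).1
      (h.reg_amp hs hn (l := 0) (by push_cast; omega) p i).cs
  · have ht' := timeIoo_subset_timeIco _ ht
    obtain ⟨X, hX1, hX2⟩ := hcb i t ht' ε hε hε1
    refine (sobolevNormLE_iff (by linarith)).2 ⟨X, hX1, ?_⟩
    exact hX2.trans ((le_abs_self _).trans ((Finset.single_le_sum (f := fun i => |c i t|)
      (fun _ _ => abs_nonneg _) (Finset.mem_univ i)).trans (hC4 t ht')))
  · exact (sobolevNormLE_iff (by linarith)).2 ⟨G i, hG i,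
      Finset.single_le_sum (f := fun i => ‖G i‖) (fun _ _ => norm_nonneg _) (Finset.mem_univ i)⟩
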